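/- Conventions. Let $\mathrm{Sch}$ be the category of schemes with the étale topology. A presheaf of groupoids on a category $\mathcal C$ is a pseudofunctor $\mathcal C^{op}\to\mathrm{Grpds}$, and a stack on a site is a presheaf of groupoids satisfying descent. For presheaves of groupoids $\mathscr X,\mathscr Y$, let $\mathrm{Mor}(\mathscr X,\mathscr Y)$ be the groupoid of pseudonatural transformations and modifications. Algebraic stacks are understood in the sense of Laumon and Moret-Bailly: étale stacks with representable, separated and quasi-compact diagonal that admit a smooth surjective morphism from a scheme. A property $P$ of schemes is smooth-local if, for every covering $(S_i\to S)$ by jointly surjective smooth morphisms, $S$ has $P$ if and only if every $S_i$ has $P$. For such a $P$, let $\mathrm{Sch}_P\subset\mathrm{Sch}$ be the full subcategory of schemes with property $P$; an algebraic stack has property $P$ if it admits a smooth surjective morphism from a scheme with property $P$. If $\mathcal D\subset\mathcal C$ is a full subcategory of a site and $\mathscr F$ is a presheaf of groupoids on $\mathcal D$, the sheafified left Kan extension of $\mathscr F$ is the stack associated with the left Kan extension of $\mathscr F$ along $\mathcal D^{op}\to\mathcal C^{op}$ (that is, with the value at $\mathscr F$ of the left adjoint of the restriction of presheaves of groupoids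 from $\mathcal C$ to $\mathcal D$; groupoids are allowed to be large enough for it to exist). Proposition. (1) Let $P$ be a smooth-local property of schemes, let $\mathscr X$ be an algebraic stack with property $P$, and denote by $\mathscr X_P$ the restriction of $\mathscr X$ to $\mathrm{Sch}_P^{op}$. Then (a) for every stack $\mathscr Y:\mathrm{Sch}^{op}\to\mathrm{Grpds}$, the restriction functor $\mathrm{Mor}(\mathscr X,\mathscr Y)\to\mathrm{Mor}(\mathscr X_P,\mathscr Y_P)$ is an equivalence; (b) $\mathscr X$ is the sheafified left Kan extension of $\mathscr X_P$ to $\mathrm{Sch}^{op}$, with unit the identity $\mathscr X_P\to\mathscr X_P$. (2) Let $p$ be a prime. For stacks $\mathscr X$ on the category $\mathrm{Sch}_{\mathbb F_p}$ of $\mathbb F_p$-schemes with the étale topology, let $\mathscr X_{\mathrm{Sm}}$ be the restriction of $\mathscr X$ to the full subcategory $\mathrm{Sm}_{\mathbb F_p}$ of smooth $\mathbb F_p$-schemes. Then (a) the functor $\mathscr X\mapsto\mathscr X_{\mathrm{Sm}}$ is fully faithful on the $(2,1)$-category of smooth algebraic stacks over $\mathbb F_p$: if $\mathscr X,\mathscr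 Y$ are smooth algebraic stacks over $\mathbb F_p$, then $\mathrm{Mor}(\mathscr X,\mathscr Y)\to\mathrm{Mor}(\mathscr X_{\mathrm{Sm}},\mathscr Y_{\mathrm{Sm}})$ is an equivalence; (b) every smooth algebraic stack $\mathscr X$ over $\mathbb F_p$ is the sheafified left Kan extension of $\mathscr X_{\mathrm{Sm}}$ to $\mathrm{Sch}_{\mathbb F_p}^{op}$, with unit the identity of $\mathscr X_{\mathrm{Sm}}$. -/

import Mathlib

open CategoryTheory Opposite Limits AlgebraicGeometry
open scoped CategoryTheory.Bicategory CategoryTheory.Pseudofunctor.StrongTrans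

universe w w' v u v₁ u₁ v₂ u₂ v₃ u₃

noncomputable section

namespace StackyYoneda

/-! ### Restriction of pseudofunctors, strong transformations and modifications -/

section Precomposition

variable {A : Type u₁} [Bicategory.{v₁, w} A] {B : Type u₂} [Bicategory.{v₂, w'} B]
  {C : Type u₃} [Bicategory.{v₃, v} C]

/-- Precomposition of a strong transformation with a pseudofunctor. -/
def precompTrans (H : A ⥤ᵖ B) {F G : B ⥤ᵖ C} (η : F ⟶ G) : H.comp F ⟶ H.comp G where
  app a := η.app (H.obj a)
  naturality f := η.naturality (H.map f)
  naturality_naturality β := η.naturality_naturality (H.map₂ β)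
  naturality_id a := by
    change (η.naturality (H.map (𝟙 a))).hom ≫
        η.app (H.obj a) ◁ (G.map₂ (H.mapId a).hom ≫ (G.mapId (H.obj a)).hom) =
      (F.map₂ (H.mapId a).hom ≫ (F.mapId (H.obj a)).hom) ▷ η.app (H.obj a) ≫
        (λ_ (η.app (H.obj a))).hom ≫ (ρ_ (η.app (H.obj a))).inv
    rw [Bicategory.whiskerLeft_comp, ← η.naturality_naturality_assoc, η.naturality_id,
      Bicategory.comp_whiskerRight, Category.assoc]
  naturality_comp {a b c} f g := by
    change (η.naturality (H.map (f ≫ g))).hom ≫ η.app (H.obj a) ◁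
        (G.map₂ (H.mapComp f g).hom ≫ (G.mapComp (H.map f) (H.map g)).hom) =
      (F.map₂ (H.mapComp f g).hom ≫ (F.mapComp (H.map f) (H.map g)).hom) ▷ η.app (H.obj c) ≫
        (α_ (F.map (H.map f)) (F.map (H.map g)) (η.app (H.obj c))).hom ≫
        F.map (H.map f) ◁ (η.naturality (H.map g)).hom ≫
        (α_ (F.map (H.map f)) (η.app (H.obj b)) (G.map (H.map g))).inv ≫
        (η.naturality (H.map f)).hom ▷ G.map (H.map g) ≫
        (α_ (η.app (H.obj a)) (G.map (H.map f)) (G.map (H.map g))).hom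
    rw [Bicategory.whiskerLeft_comp, ← η.naturality_naturality_assoc, η.naturality_comp,
      Bicategory.comp_whiskerRight, Category.assoc]

/-- Precomposition with a pseudofunctor, as a functor between categories of strong
transformations (with modifications as morphisms). -/
def precompFunctor (H : A ⥤ᵖ B) (F G : B ⥤ᵖ C) : (F ⟶ G) ⥤ (H.comp F ⟶ H.comp G) where
  obj η := precompTrans H η
  map Γ := ⟨{ app a := Γ.as.app (H.obj a)
              naturality f := Γ.as.naturality (H.map f) }⟩

end Precomposition


/-! ### Presheaves and stacks of groupoids -/

section Presheaves

variable {C : Type u₁} [Category.{v₁} C] {D : Type u₂} [Category.{v₂} D]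

/-- Presheaves of categories on `C`: pseudofunctors `Cᵒᵖ ⥤ᵖ Cat`. For two of them `𝒳`, `𝒴`, the
category `𝒳 ⟶ 𝒴` is the category of strong (= pseudonatural) transformations and
modifications. -/
abbrev PreStk (C : Type u₁) [Category.{v₁} C] : Type _ :=
  LocallyDiscrete Cᵒᵖ ⥤ᵖ Cat.{w, w'}

/-- The values of `𝒳` are groupoids. -/
def IsGroupoidValued (𝒳 : PreStk.{w, w'} C) : Prop :=
  ∀ S : C, IsGroupoid (𝒳.obj (.mk (op S)))

/-- `𝒳` is a stack (= sheaf) of groupoids for the topology `J`. -/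
structure IsGroupoidStack (J : GrothendieckTopology C) (𝒳 : PreStk.{w, w'} C) : Prop where
  isGroupoidValued : IsGroupoidValued 𝒳
  isStack : 𝒳.IsStack J

/-- The pullback of `x ∈ 𝒳(S)` along `f : T ⟶ S`. -/
abbrev pull (𝒳 : PreStk.{w, w'} C) {S T : C} (f : T ⟶ S) (x : 𝒳.obj (.mk (op S))) :
    𝒳.obj (.mk (op T)) :=
  (𝒳.map f.op.toLoc).toFunctor.obj x

/-- The restriction of a presheaf of categories along `ι : D ⥤ C`. -/
abbrev restrict (ι : D ⥤ C) (𝒳 : PreStk.{w, w'} C) : PreStk.{w, w'} D :=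
  ι.op.toPseudofunctor.comp 𝒳

/-- The restriction functor `Mor(𝒳, 𝒴) ⥤ Mor(𝒳|_D, 𝒴|_D)`. -/
abbrev restrictMor (ι : D ⥤ C) (𝒳 𝒴 : PreStk.{w, w'} C) :
    (𝒳 ⟶ 𝒴) ⥤ (restrict ι 𝒳 ⟶ restrict ι 𝒴) :=
  precompFunctor ι.op.toPseudofunctor 𝒳 𝒴

/-- `η : 𝓕 ⟶ 𝒦|_D` exhibits `𝒦` as the left Kan extension of `𝓕` along `Dᵒᵖ ⥤ Cᵒᵖ` among presheaves
of groupoids, i.e. as the value at `𝓕` of the left adjoint of the restriction: for every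
presheaf of groupoids `𝒢` on `C`, the functor `Mor(𝒦, 𝒢) ⥤ Mor(𝓕, 𝒢|_D)` induced by `η` is an
equivalence. -/
structure IsLeftKanExtension (ι : D ⥤ C) {𝓕 : PreStk.{w, w'} D} {𝒦 : PreStk.{w, w'} C}
    (η : 𝓕 ⟶ restrict ι 𝒦) : Prop where
  isGroupoidValued : IsGroupoidValued 𝒦
  isEquivalence (𝒢 : PreStk.{w, w'} C) (h𝒢 : IsGroupoidValued 𝒢) :
    (restrictMor ι 𝒦 𝒢 ⋙ Bicategory.precomp (restrict ι 𝒢) η).IsEquivalence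

/-- `θ : 𝒦 ⟶ ℒ` exhibits `ℒ` as the stack associated with `𝒦` (the sheafification of `𝒦`), i.e. as
the value at `𝒦` of the left adjoint of the inclusion of stacks of groupoids into
presheaves of groupoids. -/
structure IsStackification (J : GrothendieckTopology C) {𝒦 ℒ : PreStk.{w, w'} C}
    (θ : 𝒦 ⟶ ℒ) : Prop where
  isGroupoidStack : IsGroupoidStack J ℒ
  isEquivalence (𝒴 : PreStk.{w, w'} C) (h𝒴 : IsGroupoidStack J 𝒴) :
    (Bicategory.precomp 𝒴 θ).IsEquivalence

/-- `η : 𝓕 ⟶ ℒ|_D` exhibits `ℒ` as the sheafified left Kan extension of `𝓕` along `Dᵒᵖ ⥤ Cᵒᵖ`: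
there is a left Kan extension `𝒦` of `𝓕`, and `ℒ` is the stack associated with `𝒦`, in such a way
that `η` is isomorphic to the composite `𝓕 ⟶ 𝒦|_D ⟶ ℒ|_D`. -/
def IsSheafifiedLeftKanExtension (J : GrothendieckTopology C) (ι : D ⥤ C)
    {𝓕 : PreStk.{w, w'} D} {ℒ : PreStk.{w, w'} C} (η : 𝓕 ⟶ restrict ι ℒ) : Prop :=
  ∃ (𝒦 : PreStk.{w, w'} C) (η₀ : 𝓕 ⟶ restrict ι 𝒦) (θ : 𝒦 ⟶ ℒ),
    IsLeftKanExtension ι η₀ ∧ IsStackification J θ ∧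
      Nonempty (η₀ ≫ (restrictMor ι 𝒦 ℒ).obj θ ≅ η)

end Presheaves

/-! ### Algebraic spaces and algebraic stacks

The objects of the category `C` are thought of as schemes via a functor `U : C ⥤ Scheme`. It will be
the identity of `Scheme`, the functor `Over S ⥤ Scheme`, or `Over T ⥤ C ⥤ Scheme` for such a `C`;
all these functors respect fiber products. The topology `J` will be the étale topology. A section
`v ∈ F(V)` of a presheaf `F` is the same as a morphism `V ⟶ F`. -/

section Algebraic

variable {C : Type u₁} [Category.{v₁} C] (U : C ⥤ Scheme.{u}) (J : GrothendieckTopology C)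

/-- The object `W`, with `a : W ⟶ V` and `b : W ⟶ T`, represents the fiber product `V ×_F T` of
`v : V ⟶ F` and `t : T ⟶ F`. -/
structure IsFiberProduct (F : Cᵒᵖ ⥤ Type w) {V T W : C} (v : F.obj (op V)) (t : F.obj (op T))
    (a : W ⟶ V) (b : W ⟶ T) : Prop where
  comm : F.map a.op v = F.map b.op t
  existsUnique (Z : C) (a' : Z ⟶ V) (b' : Z ⟶ T) (h : F.map a'.op v = F.map b'.op t) :
    ∃! l : Z ⟶ W, l ≫ a = a' ∧ l ≫ b = b'

/-- `v : V ⟶ F` is schematic, étale and surjective. -/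
def IsEtaleAtlas (F : Cᵒᵖ ⥤ Type w) {V : C} (v : F.obj (op V)) : Prop :=
  ∀ (T : C) (t : F.obj (op T)), ∃ (W : C) (a : W ⟶ V) (b : W ⟶ T),
    IsFiberProduct F v t a b ∧ Etale (U.map b) ∧ Surjective (U.map b)

/-- The diagonal `F ⟶ F × F` is schematic and has the property `Q`: for `s t : T ⟶ F`, the locus
`s = t` in `T` is represented by some `i : E ⟶ T` with the property `Q`. -/
def DiagonalHas (Q : MorphismProperty Scheme.{u}) (F : Cᵒᵖ ⥤ Type w) : Prop :=
  ∀ (T : C) (s t : F.obj (op T)), ∃ (E : C) (i : E ⟶ T), Q (U.map i) ∧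
    F.map i.op s = F.map i.op t ∧
    ∀ (Z : C) (f : Z ⟶ T), F.map f.op s = F.map f.op t → ∃! l : Z ⟶ E, l ≫ i = f

/-- Algebraic spaces (in the sense of Laumon and Moret-Bailly, so quasi-separated): sheaves of sets
with a schematic and quasi-compact diagonal and with an étale atlas. -/
structure IsAlgebraicSpace (F : Cᵒᵖ ⥤ Type w) : Prop where
  isSheaf : Presieve.IsSheaf J F
  diagonal : DiagonalHas U @QuasiCompact F
  atlas : ∃ (V : C) (v : F.obj (op V)), IsEtaleAtlas U F v

/-- An algebraic space `F` is separated (over the final object of `C`, if there is one). -/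
def IsSeparatedSpace (F : Cᵒᵖ ⥤ Type w) : Prop :=
  DiagonalHas U @IsClosedImmersion F

/-- An algebraic space `F` is quasi-compact. -/
def IsQuasiCompactSpace (F : Cᵒᵖ ⥤ Type w) : Prop :=
  ∃ (V : C) (v : F.obj (op V)), CompactSpace (U.obj V) ∧ IsEtaleAtlas U F v

variable [HasBinaryProducts C]

/-- `v : V ⟶ 𝒳` is smooth and surjective: for every `t : T ⟶ 𝒳`, the fiber product `V ×_𝒳 T`, which is
the sheaf `Isom(pr₁^* v, pr₂^* t)` over `V × T`, has an étale atlas `W` such that the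
composite `W ⟶ V ×_𝒳 T ⟶ T` is smooth and surjective. -/
def IsSmoothAtlas (𝒳 : PreStk.{w, w'} C) {V : C} (v : 𝒳.obj (.mk (op V))) : Prop :=
  ∀ (T : C) (t : 𝒳.obj (.mk (op T))), ∃ (W : Over (V ⨯ T))
    (α : (𝒳.presheafHom (pull 𝒳 prod.fst v) (pull 𝒳 prod.snd t)).obj (op W)),
      IsEtaleAtlas (Over.forget (V ⨯ T) ⋙ U)
        (𝒳.presheafHom (pull 𝒳 prod.fst v) (pull 𝒳 prod.snd t)) α ∧
      Smooth (U.map (W.hom ≫ prod.snd)) ∧ Surjective (U.map (W.hom ≫ prod.snd))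

/-- Algebraic stacks in the sense of Laumon and Moret-Bailly: stacks of groupoids whose diagonal is
representable, separated and quasi-compact (i.e. for all `x y : T ⟶ 𝒳` with `T` affine, `Isom(x, y)`
is an algebraic space, separated and quasi-compact over `T`), and which admit a smooth
surjective morphism from a scheme. -/
structure IsAlgebraicStack (𝒳 : PreStk.{w, w'} C) : Prop where
  isGroupoidStack : IsGroupoidStack J 𝒳
  diagonal (T : C) (hT : IsAffine (U.obj T)) (x y : 𝒳.obj (.mk (op T))) :
    IsAlgebraicSpace (Over.forget T ⋙ U) (J.over T) (𝒳.presheafHom x y) ∧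
    IsSeparatedSpace (Over.forget T ⋙ U) (𝒳.presheafHom x y) ∧
    IsQuasiCompactSpace (Over.forget T ⋙ U) (𝒳.presheafHom x y)
  atlas : ∃ (V : C) (v : 𝒳.obj (.mk (op V))), IsSmoothAtlas U 𝒳 v

/-- The algebraic stack `𝒳` has the (smooth-local) property `P`: it has a smooth atlas by a scheme
with the property `P`. -/
def HasProperty (P : ObjectProperty C) (𝒳 : PreStk.{w, w'} C) : Prop :=
  ∃ (V : C) (v : 𝒳.obj (.mk (op V))), IsSmoothAtlas U 𝒳 v ∧ P V

end Algebraic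

/-- A property `P` of schemes is smooth-local: for every smooth covering `(S_i ⟶ S)`, the scheme `S`
has the property `P` if and only if all `S_i` have it. -/
def IsSmoothLocal (P : ObjectProperty Scheme.{u}) : Prop :=
  ∀ (S : Scheme.{u}) (𝒮 : Scheme.Cover.{u} (Scheme.precoverage @Smooth) S),
    P S ↔ ∀ i, P (𝒮.X i)

/-! ### Stacks on the category of all schemes -/

/-- Presheaves of categories on the category of schemes. -/
abbrev SchPreStk : Type _ := PreStk.{w, w'} Scheme.{u}

/-- Stacks of groupoids on the category of schemes, for the étale topology. -/
abbrev IsStk (𝒴 : SchPreStk.{w, w', u}) : Prop :=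
  IsGroupoidStack Scheme.etaleTopology 𝒴

/-- Algebraic stacks (over `ℤ`) with the property `P`. -/
def IsAlgStk (P : ObjectProperty Scheme.{u}) (𝒳 : SchPreStk.{w, w', u}) : Prop :=
  IsAlgebraicStack (𝟭 Scheme.{u}) Scheme.etaleTopology 𝒳 ∧ HasProperty (𝟭 Scheme.{u}) P 𝒳

/-! ### Stacks over `𝔽_p` -/

/-- `Spec 𝔽_p`. -/
abbrev specF (p : ℕ) : Scheme.{u} := Spec (.of (ULift.{u} (ZMod p)))

/-- The category of `𝔽_p`-schemes. -/
abbrev SchF (p : ℕ) : Type _ := Over (specF.{u} p)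

/-- The étale topology on the category of `𝔽_p`-schemes. -/
abbrev etaleF (p : ℕ) : GrothendieckTopology (SchF.{u} p) :=
  Scheme.etaleTopology.over (specF p)

/-- Smoothness over `𝔽_p`. -/
def smF (p : ℕ) : ObjectProperty (SchF.{u} p) := fun X => Smooth X.hom

/-- Smooth algebraic stacks over `𝔽_p`. -/
def IsSmoothAlgStkF (p : ℕ) (𝒳 : PreStk.{w, w'} (SchF.{u} p)) : Prop :=
  IsAlgebraicStack (Over.forget (specF p)) (etaleF p) 𝒳 ∧
    HasProperty (Over.forget (specF p)) (smF p) 𝒳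

end StackyYoneda

end

/-!
A morphism `𝒳 ⟶ 𝒴` of presheaves of groupoids is the same thing as a cartesian section of `𝒴` over
the total category of `𝒳`, and a morphism between the restrictions to a full subcategory is a
section over the part of the total category lying over this subcategory. The question is thus
whether a section `y` over this part extends uniquely to the whole total category, which carries
the topology of the base and over which `𝒴` still satisfies descent.

Smooth surjective morphisms of schemes have sections étale locally, so an atlas `v : V ⟶ 𝒳` by a
scheme with property `P` covers the final object of the total category: it suffices to glue the
value of `y` at `v`, and the pullbacks of the resulting objects are determined by their
restrictions to `V ×_𝒳 T`. For `T` with property `P`, the algebraic space `V ×_𝒳 T` has an étale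
atlas `W`, which is smooth over `T`, so `W` has property `P` too. Hence `y` is defined at `W`, and
comparing its value there with those at `T` and at `V` transports the value at `T` to the value at
`V`. With `T = V` this is the descent datum on the value at `v`, and for general `T` it shows that
the glued section restricts to `y`.

The left Kan extension of `𝓕` is the presheaf whose value at `T` is the free groupoid on the
category of morphisms from `T` to the bases of the objects of the total category of `𝓕`: a section
over the objects of a category is extended by pullback to the morphisms into them. That `𝒳` is the
associated stack of the left Kan extension of its restriction then follows from the equivalence
`Mor(𝒳, 𝒴) ≃ Mor(𝒳_P, 𝒴_P)` for all stacks `𝒴` by two out of three.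
-/

open StackyYoneda

noncomputable section

namespace StackyYoneda

/-! ### Étale-local sections of smooth morphisms -/

section EtaleLocalSections

open Polynomial in
lemma exists_pow_eq_one_eval_ne_zero {L : Type*} [Field L] [IsAlgClosed L] {g : L[X]} (hg : g ≠ 0)
    {m : ℕ} (hm : (m : L) ≠ 0) (hgm : g.natDegree < m) : ∃ z : L, z ^ m = 1 ∧ g.eval z ≠ 0 := by
  classical
  by_contra! h
  have hsep : (X ^ m - 1 : L[X]).Separable := by
    simpa only [map_one] using separable_X_pow_sub_C (1 : L) hm one_ne_zero
  have hcard : Fintype.card ((X ^ m - 1 : L[X]).rootSet L) = m := by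
    rw [card_rootSet_eq_natDegree hsep (IsAlgClosed.splits _)]
    simpa only [map_one] using natDegree_X_pow_sub_C (R := L) (n := m) (r := 1)
  refine hg (eq_zero_of_natDegree_lt_card_of_eval_eq_zero g
    (Subtype.val_injective (p := (· ∈ (X ^ m - 1 : L[X]).rootSet L))) (fun z => h z ?_)
    (hgm.trans_eq hcard.symm))
  simpa [sub_eq_zero] using (mem_rootSet.mp z.2).2

lemma exists_natCast_ne_zero_lt (K : Type*) [AddGroupWithOne K] [NeZero (1 : K)] (d : ℕ) :
    ∃ m : ℕ, ((m + 1 : ℕ) : K) ≠ 0 ∧ d < m + 1 := by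
  by_cases h : ((d + 1 : ℕ) : K) = 0
  · exact ⟨d + 1, by rw [Nat.cast_succ, h, zero_add]; exact one_ne_zero, by omega⟩
  · exact ⟨d, h, by omega⟩

/-- The standard étale algebra over `A` classifying the roots of unity of order `k + 1`, invertible
in the algebra, at which `g` takes an invertible value. -/
@[simps]
def rootsOfUnityEtalePair {A : Type*} [CommRing A] (g : Polynomial A) (k : ℕ) :
    StandardEtalePair A where
  f := .X ^ (k + 1) - 1
  monic_f := by simpa using Polynomial.monic_X_pow_sub_C (1 : A) (Nat.succ_ne_zero k)
  g := .C ((k + 1 : ℕ) : A) * g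
  cond := by
    refine ⟨.X * g, -.C ((k + 1 : ℕ) : A) * g, 1, ?_⟩
    simp only [Polynomial.derivative_sub, Polynomial.derivative_X_pow, Polynomial.derivative_one,
      Nat.add_sub_cancel]
    ring

-- Over a finite field `g` may vanish at all rational points, but it does not vanish at all roots of
-- unity of an invertible order exceeding its degree.
lemma exists_etale_isUnit_polynomialAeval {A : Type u} [CommRing A] {L : Type*} [Field L]
    [IsAlgClosed L] (φ : A →+* L) (g : Polynomial A) (hg : g.map φ ≠ 0) :
    ∃ (B : Type u) (_ : CommRing B) (_ : Algebra A B) (b : B) (ψ : B →+* L), Algebra.Etale A B ∧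
      IsUnit (Polynomial.aeval b g) ∧ ψ.comp (algebraMap A B) = φ := by
  obtain ⟨k, hk, hgk⟩ := exists_natCast_ne_zero_lt L (g.map φ).natDegree
  obtain ⟨z, hz, hgz⟩ := exists_pow_eq_one_eval_ne_zero hg hk hgk
  let P := rootsOfUnityEtalePair g k
  let := φ.toAlgebra
  have hzP : P.HasMap z := by
    have hgz' : Polynomial.aeval z g ≠ 0 := by rwa [Polynomial.eval_map] at hgz
    refine ⟨by simp [P, hz], ?_⟩
    simp only [P, rootsOfUnityEtalePair_g, map_mul, map_natCast]
    exact (IsUnit.mk0 _ hk).mul (IsUnit.mk0 _ hgz')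
  have hX : IsUnit (Polynomial.aeval P.X (.C ((k + 1 : ℕ) : A) * g)) := P.hasMap_X.2
  rw [map_mul] at hX
  exact ⟨P.Ring, inferInstance, inferInstance, P.X, P.lift z hzP, inferInstance,
    isUnit_of_mul_isUnit_right hX, (P.lift z hzP).comp_algebraMap⟩

lemma exists_eval₂_C_ne_zero {R σ : Type*} [CommRing R] [IsDomain R] {h : MvPolynomial σ R}
    (hh : h ≠ 0) : ∃ s : σ → Polynomial R, h.eval₂ Polynomial.C s ≠ 0 := by
  by_contra! hs
  refine hh (MvPolynomial.map_injective _ (Polynomial.C_injective (R := R)) ?_)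
  rw [map_zero]
  exact MvPolynomial.funext fun s => by rw [MvPolynomial.eval_map, hs, map_zero]

lemma exists_etale_isUnit_mvPolynomialAeval {A : Type u} [CommRing A] {L : Type*} [Field L]
    [IsAlgClosed L] (φ : A →+* L) {σ : Type*} (h : MvPolynomial σ A) (hh : h.map φ ≠ 0) :
    ∃ (B : Type u) (_ : CommRing B) (_ : Algebra A B) (b : σ → B) (ψ : B →+* L),
      Algebra.Etale A B ∧ IsUnit (MvPolynomial.aeval b h) ∧ ψ.comp (algebraMap A B) = φ := by
  have hφ : φ.range.subtype.comp φ.rangeRestrict = φ := RingHom.ext fun _ => rfl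
  obtain ⟨s, hs⟩ := exists_eval₂_C_ne_zero (h := h.map φ.rangeRestrict) fun h0 => hh <| by
    rw [← hφ, ← MvPolynomial.map_map, h0, map_zero]
  choose t ht using fun i => Polynomial.map_surjective _ φ.rangeRestrict_surjective (s i)
  have ht0 : (MvPolynomial.aeval t h).map φ ≠ 0 := by
    rw [← hφ, ← Polynomial.map_map, Polynomial.map_ne_zero_iff φ.range.subtype_injective]
    convert hs using 1
    rw [MvPolynomial.aeval_def, ← Polynomial.coe_mapRingHom, MvPolynomial.hom_eval₂,
      MvPolynomial.eval₂_map]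
    congr 1
    · ext1 a
      simp
    · exact funext ht
  obtain ⟨B, _, _, b, ψ, hB, hb, hψ⟩ := exists_etale_isUnit_polynomialAeval φ _ ht0
  refine ⟨B, inferInstance, inferInstance, fun i => Polynomial.aeval b (t i), ψ, hB, ?_, hψ⟩
  have hcomp : (MvPolynomial.aeval fun i => Polynomial.aeval b (t i)) =
      (Polynomial.aeval b).comp (MvPolynomial.aeval (R := A) t) := by
    ext i
    simp
  rwa [hcomp]

lemma exists_etale_comap_aeval_mem {A : Type u} [CommRing A] {σ : Type*}
    {W : Set (PrimeSpectrum (MvPolynomial σ A))} (hW : IsOpen W)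
    {q : PrimeSpectrum (MvPolynomial σ A)} (hq : q ∈ W) :
    ∃ (B : Type u) (_ : CommRing B) (_ : Algebra A B) (b : σ → B) (r : PrimeSpectrum B),
      Algebra.Etale A B ∧ r.comap (MvPolynomial.aeval (R := A) b).toRingHom ∈ W ∧
      r.comap (algebraMap A B) = q.comap MvPolynomial.C := by
  obtain ⟨_, ⟨h, rfl⟩, hqh, hhW⟩ :=
    PrimeSpectrum.isTopologicalBasis_basic_opens.exists_subset_of_mem_open hq hW
  let ev : MvPolynomial σ A →+* AlgebraicClosure q.asIdeal.ResidueField := algebraMap _ _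
  have hev : RingHom.ker ev = q.asIdeal := by
    rw [show ev = (algebraMap q.asIdeal.ResidueField _).comp (algebraMap _ _) from
      IsScalarTower.algebraMap_eq _ _ _, RingHom.ker_comp_of_injective _ (RingHom.injective _),
      Ideal.ker_algebraMap_residueField]
  have hh : h.map (ev.comp MvPolynomial.C) ≠ 0 := by
    intro h0
    apply hqh
    have hevh : ev h = MvPolynomial.eval (fun i => ev (.X i)) (h.map (ev.comp MvPolynomial.C)) := by
      rw [MvPolynomial.eval_map, ← MvPolynomial.hom_eval₂, MvPolynomial.eval₂_eta]
    rw [← hev, RingHom.mem_ker, hevh, h0, map_zero]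
  obtain ⟨B, _, _, b, ψ, hB, hb, hψ⟩ := exists_etale_isUnit_mvPolynomialAeval _ h hh
  refine ⟨B, inferInstance, inferInstance, b, ⟨RingHom.ker ψ, RingHom.ker_isPrime _⟩, hB,
    hhW fun hmem => (RingHom.ker_isPrime ψ).ne_top (Ideal.eq_top_of_isUnit_mem _ hmem hb), ?_⟩
  ext1
  change (RingHom.ker ψ).comap _ = q.asIdeal.comap _
  exact (RingHom.comap_ker _ _).trans (by rw [hψ, ← RingHom.comap_ker, hev])

-- Smooth morphisms are locally étale over affine spaces, so it suffices to find an étale-local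
-- section of an affine space meeting the image of an étale morphism, which is open.
lemma exists_etale_factorization {X Y : Scheme.{u}} (f : X ⟶ Y) [Smooth f] (x : X) :
    ∃ (Z : Scheme.{u}) (g : Z ⟶ X), Etale (g ≫ f) ∧ f x ∈ Set.range (g ≫ f) := by
  obtain ⟨U, hU, V, hV, hx, e, hf⟩ := Smooth.exists_isStandardSmooth f x
  obtain ⟨n, φ, hφ, hφ'⟩ := RingHom.IsStandardSmooth.exists_etale_mvPolynomial hf
  let A := Γ(Y, U)
  let a := Spec.map (CommRingCat.ofHom φ)
  let c := Spec.map (CommRingCat.ofHom (MvPolynomial.C (σ := Fin n) (R := A)))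
  have : Etale a := (HasRingHomProperty.Spec_iff (P := @Etale)).mpr hφ'
  have hac : a ≫ c = Spec.map (f.appLE U V e) := by
    rw [← Spec.map_comp, ← CommRingCat.ofHom_comp, hφ]
    rfl
  obtain ⟨q, rfl⟩ : x ∈ Set.range hV.fromSpec := by rwa [hV.range_fromSpec]
  obtain ⟨B, _, _, b, r, hB, ⟨t, ht⟩, hr⟩ :=
    exists_etale_comap_aeval_mem a.isOpenMap.isOpen_range (Set.mem_range_self (f := a) q)
  let s : Spec (.of B) ⟶ Spec (.of (MvPolynomial (Fin n) A)) :=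
    Spec.map (CommRingCat.ofHom (MvPolynomial.aeval (R := A) b).toRingHom)
  have hsc : s ≫ c = Spec.map (CommRingCat.ofHom (algebraMap A B)) := by
    rw [← Spec.map_comp, ← CommRingCat.ofHom_comp]
    exact congrArg (fun i => Spec.map (CommRingCat.ofHom i)) (MvPolynomial.aeval b).comp_algebraMap
  have : Etale (Spec.map (CommRingCat.ofHom (algebraMap A B))) :=
    (HasRingHomProperty.Spec_iff (P := @Etale)).mpr (RingHom.etale_algebraMap.mpr hB)
  obtain ⟨z, hz, -⟩ := Scheme.Pullback.exists_preimage_pullback (f := s) (g := a) r t ht.symm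
  have hgf : (pullback.snd s a ≫ hV.fromSpec) ≫ f = pullback.fst s a ≫
      Spec.map (CommRingCat.ofHom (algebraMap A B)) ≫ hU.fromSpec := by
    rw [Category.assoc, ← IsAffineOpen.SpecMap_appLE_fromSpec f hU hV e, ← hac, ← hsc,
      Category.assoc, Category.assoc, pullback.condition_assoc]
  refine ⟨pullback s a, pullback.snd s a ≫ hV.fromSpec, by rw [hgf]; infer_instance, z, ?_⟩
  rw [hgf, Scheme.Hom.comp_apply, hz, ← Scheme.Hom.comp_apply hV.fromSpec,
    ← IsAffineOpen.SpecMap_appLE_fromSpec f hU hV e, Scheme.Hom.comp_apply, ← hac]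
  exact congrArg hU.fromSpec hr

lemma generate_singleton_mem_etaleTopology {X Y : Scheme.{u}} (f : X ⟶ Y) [Smooth f]
    [Surjective f] : Sieve.generate (Presieve.singleton f) ∈ Scheme.etaleTopology Y := by
  choose s hs using f.surjective
  choose Z g hg hgs using fun y => exists_etale_factorization f (s y)
  refine Scheme.mem_grothendieckTopology_iff.mpr ⟨Scheme.Cover.mkOfCovers Y Z (fun y => g y ≫ f)
    (fun y => ⟨y, ?_⟩) hg, ?_⟩
  · obtain ⟨z, hz⟩ := hgs y
    exact ⟨z, hz.trans (hs y)⟩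
  · rintro _ _ ⟨y⟩
    exact ⟨X, g y, f, Presieve.singleton_self f, rfl⟩

end EtaleLocalSections

/-! ### Total categories -/

section Total

variable {C : Type u₁} [Category.{v₁} C]

/-- The total category of a presheaf of categories. -/
abbrev Tot (𝒴 : PreStk.{w, w'} C) : Type _ := Pseudofunctor.CoGrothendieck 𝒴

namespace Tot

variable {𝒴 : PreStk.{w, w'} C}

/-- The object of the total category given by `x ∈ 𝒴(S)`. -/
abbrev mk {S : C} (x : 𝒴.obj (.mk (op S))) : Tot 𝒴 := ⟨S, x⟩

/-- The morphism of the total category over `f` given by a morphism in the fiber. -/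
abbrev homMk {a b : Tot 𝒴} (f : a.base ⟶ b.base) (α : a.fiber ⟶ pull 𝒴 f b.fiber) : a ⟶ b :=
  ⟨f, α⟩

/-- The unit constraint of a presheaf of categories. -/
def pullId {S : C} (x : 𝒴.obj (.mk (op S))) : x ≅ pull 𝒴 (𝟙 S) x :=
  (Cat.Hom.toNatIso (𝒴.mapId (.mk (op S)))).symm.app x

/-- The composition constraint of a presheaf of categories. -/
def pullComp {S T Z : C} (f : T ⟶ S) (g : Z ⟶ T) (k : Z ⟶ S) (hk : g ≫ f = k)
    (y : 𝒴.obj (.mk (op S))) : pull 𝒴 g (pull 𝒴 f y) ≅ pull 𝒴 k y :=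
  (Cat.Hom.toNatIso (𝒴.mapComp' f.op.toLoc g.op.toLoc k.op.toLoc (by rw [← hk]; rfl))).symm.app y

/-- Morphisms of a fiber, seen in the total category. -/
def vert {S : C} {x y : 𝒴.obj (.mk (op S))} (φ : x ⟶ y) : mk x ⟶ mk y :=
  homMk (𝟙 S) (φ ≫ (pullId y).hom)

/-- The canonical morphism from a pullback. -/
def cart {S T : C} (f : T ⟶ S) (y : 𝒴.obj (.mk (op S))) : mk (pull 𝒴 f y) ⟶ mk y :=
  homMk f (𝟙 _)

@[simp] lemma vert_base {S : C} {x y : 𝒴.obj (.mk (op S))} (φ : x ⟶ y) :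
    (vert φ).base = 𝟙 S := rfl

@[simp] lemma cart_base {S T : C} (f : T ⟶ S) (y : 𝒴.obj (.mk (op S))) :
    (cart f y).base = f := rfl

@[simp] lemma comp_base {a b c : Tot 𝒴} (f : a ⟶ b) (g : b ⟶ c) :
    (f ≫ g).base = f.base ≫ g.base := rfl

lemma homMk_injective {a b : Tot 𝒴} {f : a.base ⟶ b.base} {α β : a.fiber ⟶ pull 𝒴 f b.fiber}
    (h : (homMk f α : a ⟶ b) = homMk f β) : α = β := by
  have := Pseudofunctor.CoGrothendieck.Hom.congr h
  rwa [eqToHom_refl, Category.comp_id] at this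

lemma vert_comp_homMk {S : C} {x y : 𝒴.obj (.mk (op S))} (φ : x ⟶ y) {b : Tot 𝒴}
    (f : S ⟶ b.base) (α : y ⟶ pull 𝒴 f b.fiber) :
    vert φ ≫ (homMk f α : mk y ⟶ b) = homMk f (φ ≫ α) := by
  have h := Pseudofunctor.CoGrothendieck.Hom.congr (Category.id_comp (homMk f α : mk y ⟶ b))
  refine Pseudofunctor.CoGrothendieck.Hom.ext _ _ (Category.id_comp f) ?_
  exact (Category.assoc φ _ _).trans ((congrArg (φ ≫ ·) h).trans (Category.assoc _ _ _).symm)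

lemma cart_comp_vert {S T : C} (f : T ⟶ S) {x y : 𝒴.obj (.mk (op S))} (φ : x ⟶ y) :
    cart f x ≫ vert φ =
      (homMk f ((𝒴.map f.op.toLoc).toFunctor.map φ) : mk (pull 𝒴 f x) ⟶ mk y) := by
  have h := Pseudofunctor.CoGrothendieck.Hom.congr (Category.comp_id (cart f y))
  refine Pseudofunctor.CoGrothendieck.Hom.ext _ _ (Category.comp_id f) ?_
  have h1 : (cart f x ≫ vert φ).fiber =
    (𝒴.map f.op.toLoc).toFunctor.map φ ≫ (cart f y ≫ 𝟙 _).fiber := by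
    refine (Category.id_comp _).trans ?_
    refine Eq.trans ?_ (congrArg (_ ≫ ·) (Category.id_comp _).symm)
    refine Eq.trans ?_ (Category.assoc _ _ _)
    exact congrArg (· ≫ _) ((𝒴.map f.op.toLoc).toFunctor.map_comp φ (pullId y).hom)
  rw [h1]
  refine (congrArg (_ ≫ ·) h).trans ?_
  exact congrArg (_ ≫ ·) (Category.id_comp _)

lemma vert_comp_cart {S T : C} (f : T ⟶ S) {x : 𝒴.obj (.mk (op T))} {y : 𝒴.obj (.mk (op S))}
    (φ : x ⟶ pull 𝒴 f y) : vert φ ≫ cart f y = (homMk f φ : mk x ⟶ mk y) := by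
  refine (vert_comp_homMk (b := mk y) φ f (𝟙 _)).trans ?_
  exact congrArg (fun t => (homMk f t : mk x ⟶ mk y)) (Category.comp_id φ)

lemma vert_map_comp_cart {S T : C} (f : T ⟶ S) {x y : 𝒴.obj (.mk (op S))} (φ : x ⟶ y) :
    vert ((𝒴.map f.op.toLoc).toFunctor.map φ) ≫ cart f y = cart f x ≫ vert φ := by
  rw [vert_comp_cart, cart_comp_vert]

lemma vert_map_comp_cart_assoc {S T : C} (f : T ⟶ S) {x y : 𝒴.obj (.mk (op S))} (φ : x ⟶ y)
    {c : Tot 𝒴} (h : mk y ⟶ c) :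
    vert ((𝒴.map f.op.toLoc).toFunctor.map φ) ≫ cart f y ≫ h = cart f x ≫ vert φ ≫ h := by
  rw [← Category.assoc, vert_map_comp_cart, Category.assoc]

@[simp] lemma vert_id {S : C} (x : 𝒴.obj (.mk (op S))) : vert (𝟙 x) = 𝟙 (mk x) := by
  unfold vert
  rw [Category.id_comp]
  rfl

@[simp]
lemma vert_comp {S : C} {x y z : 𝒴.obj (.mk (op S))} (φ : x ⟶ y) (ψ : y ⟶ z) :
    vert (φ ≫ ψ) = vert φ ≫ vert ψ := by
  conv_rhs => rw [vert.eq_def ψ, vert_comp_homMk]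
  rw [vert, Category.assoc]

@[simp]
lemma vert_comp_assoc {S : C} {x y z : 𝒴.obj (.mk (op S))} (φ : x ⟶ y) (ψ : y ⟶ z)
    {c : Tot 𝒴} (h : mk z ⟶ c) : vert (φ ≫ ψ) ≫ h = vert φ ≫ vert ψ ≫ h := by
  rw [vert_comp, Category.assoc]

lemma vert_injective {S : C} {x y : 𝒴.obj (.mk (op S))} {φ ψ : x ⟶ y} (h : vert φ = vert ψ) :
    φ = ψ :=
  (cancel_mono (pullId y).hom).mp (homMk_injective h)

lemma eq_of_vert_comp_cart {S T : C} {f : T ⟶ S} {x : 𝒴.obj (.mk (op T))}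
    {y : 𝒴.obj (.mk (op S))} {φ ψ : x ⟶ pull 𝒴 f y} (h : vert φ ≫ cart f y = vert ψ ≫ cart f y) :
    φ = ψ := by
  rw [vert_comp_cart, vert_comp_cart] at h
  exact homMk_injective h

/-- The fiber component of a morphism over `f`. -/
def fiberOver {a b : Tot 𝒴} (m : a ⟶ b) (f : a.base ⟶ b.base) (hf : m.base = f) :
    a.fiber ⟶ pull 𝒴 f b.fiber :=
  m.fiber ≫ eqToHom (by rw [hf])

@[simp]
lemma vert_fiberOver_comp_cart {a b : Tot 𝒴} (m : a ⟶ b) (f : a.base ⟶ b.base) (hf : m.base = f) :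
    vert (fiberOver m f hf) ≫ cart f b.fiber = m := by
  subst hf
  rw [fiberOver, eqToHom_refl, Category.comp_id, vert_comp_cart]
  rfl

@[simp]
lemma vert_pullComp_hom_comp_cart {S T Z : C} (f : T ⟶ S) (g : Z ⟶ T) (k : Z ⟶ S)
    (hk : g ≫ f = k) (y : 𝒴.obj (.mk (op S))) :
    vert (pullComp f g k hk y).hom ≫ cart k y = cart g (pull 𝒴 f y) ≫ cart f y := by
  subst hk
  rw [vert_comp_cart]
  refine Pseudofunctor.CoGrothendieck.Hom.ext _ _ rfl ?_
  refine Eq.trans ?_ (Category.comp_id _).symm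
  refine Eq.trans ?_ (Category.id_comp _).symm
  refine Eq.trans ?_ (congrArg (· ≫ _) ((𝒴.map g.op.toLoc).toFunctor.map_id (pull 𝒴 f y)).symm)
  refine Eq.trans ?_ (Category.id_comp _).symm
  exact congrArg (fun t => t.inv.toNatTrans.app y) (𝒴.mapComp'_eq_mapComp f.op.toLoc g.op.toLoc)

@[simp]
lemma vert_pullComp_hom_comp_cart_assoc {S T Z : C} (f : T ⟶ S) (g : Z ⟶ T) (k : Z ⟶ S)
    (hk : g ≫ f = k) (y : 𝒴.obj (.mk (op S))) {c : Tot 𝒴} (h : mk y ⟶ c) :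
    vert (pullComp f g k hk y).hom ≫ cart k y ≫ h = cart g (pull 𝒴 f y) ≫ cart f y ≫ h := by
  rw [← Category.assoc, vert_pullComp_hom_comp_cart, Category.assoc]

@[simp]
lemma vert_pullComp_inv_comp_cart {S T Z : C} (f : T ⟶ S) (g : Z ⟶ T) (k : Z ⟶ S)
    (hk : g ≫ f = k) (y : 𝒴.obj (.mk (op S))) :
    vert (pullComp f g k hk y).inv ≫ cart g (pull 𝒴 f y) ≫ cart f y = cart k y := by
  rw [← vert_pullComp_hom_comp_cart f g k hk, ← vert_comp_assoc, Iso.inv_hom_id, vert_id,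
    Category.id_comp]

@[simp]
lemma vert_pullComp_inv_comp_cart_assoc {S T Z : C} (f : T ⟶ S) (g : Z ⟶ T) (k : Z ⟶ S)
    (hk : g ≫ f = k) (y : 𝒴.obj (.mk (op S))) {c : Tot 𝒴} (h : mk y ⟶ c) :
    vert (pullComp f g k hk y).inv ≫ cart g (pull 𝒴 f y) ≫ cart f y ≫ h = cart k y ≫ h := by
  rw [← vert_pullComp_inv_comp_cart f g k hk]
  simp only [Category.assoc]

@[simp]
lemma vert_pullId_hom_comp_cart {S : C} (y : 𝒴.obj (.mk (op S))) :
    vert (pullId y).hom ≫ cart (𝟙 S) y = 𝟙 (mk y) := by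
  rw [vert_comp_cart]
  rfl

section Groupoid

variable (h𝒴 : IsGroupoidValued 𝒴)
include h𝒴

lemma hom_ext_of_comp {a b c : Tot 𝒴} (g : b ⟶ c) {l l' : a ⟶ b} (hb : l.base = l'.base)
    (h : l ≫ g = l' ≫ g) : l = l' := by
  obtain ⟨k, α⟩ := l
  obtain ⟨k', β⟩ := l'
  obtain rfl : k = k' := hb
  have := h𝒴 a.base
  have := IsGroupoid.all_isIso ((𝒴.map k.op.toLoc).toFunctor.map g.fiber ≫
    (𝒴.mapComp g.base.op.toLoc k.op.toLoc).inv.toNatTrans.app c.fiber)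
  exact congrArg (homMk k) ((cancel_mono _).mp (homMk_injective h))

lemma exists_lift {a b c : Tot 𝒴} (g : b ⟶ c) (h : a ⟶ c) (k : a.base ⟶ b.base)
    (hk : k ≫ g.base = h.base) : ∃ l : a ⟶ b, l.base = k ∧ l ≫ g = h := by
  let γ : b.fiber ⟶ pull 𝒴 g.base c.fiber := fiberOver g g.base rfl
  have := h𝒴 a.base
  have := IsGroupoid.all_isIso ((𝒴.map k.op.toLoc).toFunctor.map γ)
  have hg : cart k b.fiber ≫ g = vert ((𝒴.map k.op.toLoc).toFunctor.map γ) ≫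
      cart k _ ≫ cart g.base c.fiber := by
    rw [vert_map_comp_cart_assoc, vert_fiberOver_comp_cart]
  refine ⟨vert (fiberOver h (k ≫ g.base) hk.symm ≫
    (pullComp g.base k (k ≫ g.base) rfl c.fiber).inv ≫
      inv ((𝒴.map k.op.toLoc).toFunctor.map γ)) ≫ cart k b.fiber, Category.id_comp k, ?_⟩
  rw [Category.assoc, hg, ← vert_comp_assoc, Category.assoc, Category.assoc, IsIso.inv_hom_id,
    Category.comp_id, vert_comp_assoc, vert_pullComp_inv_comp_cart]
  exact vert_fiberOver_comp_cart h (k ≫ g.base) hk.symm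

end Groupoid

end Tot

end Total

/-! ### Descent in total categories -/

section Descent

variable {C : Type u₁} [Category.{v₁} C]

/-- The morphisms of a site that generate a covering sieve. -/
def coveringMorphisms (J : GrothendieckTopology C) : MorphismProperty C :=
  fun _ S f => Sieve.generate (Presieve.singleton f) ∈ J S

lemma coveringMorphisms.ofArrows_mem {J : GrothendieckTopology C} {S T : C} {f : T ⟶ S}
    (hf : coveringMorphisms J f) :
    Sieve.ofArrows (fun _ : Unit => T) (fun _ : Unit => f) ∈ J S := by
  rw [Sieve.ofArrows, Presieve.ofArrows_pUnit]
  exact hf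

/-- A descent datum on `x ∈ 𝒴(X)` relative to `u : X ⟶ T`, phrased in the total category: a
morphism `k` to `x` over some `Z ⟶ X` is transported to a morphism over any other `f : Z ⟶ X` with
the same composite to `T`. -/
structure GluingDatum (𝒴 : PreStk.{w, w'} C) {X T : C} (u : X ⟶ T) (x : 𝒴.obj (.mk (op X))) where
  tr {z : Tot 𝒴} (k : z ⟶ Tot.mk x) (f : z.base ⟶ X) (h : k.base ≫ u = f ≫ u) : z ⟶ Tot.mk x
  tr_base {z : Tot 𝒴} (k : z ⟶ Tot.mk x) (f : z.base ⟶ X) (h : k.base ≫ u = f ≫ u) :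
    (tr k f h).base = f
  tr_comp {z' z : Tot 𝒴} (l : z' ⟶ z) (k : z ⟶ Tot.mk x) (f : z.base ⟶ X)
    (h : k.base ≫ u = f ≫ u) (k' : z' ⟶ Tot.mk x) (f' : z'.base ⟶ X) (h' : k'.base ≫ u = f' ≫ u)
    (hk : k' = l ≫ k) (hf : f' = l.base ≫ f) : tr k' f' h' = l ≫ tr k f h
  tr_self {z : Tot 𝒴} (k : z ⟶ Tot.mk x) : tr k k.base rfl = k
  tr_tr {z : Tot 𝒴} (k : z ⟶ Tot.mk x) (f f' : z.base ⟶ X) (h : k.base ≫ u = f ≫ u)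
    (h' : (tr k f h).base ≫ u = f' ≫ u) (h'' : k.base ≫ u = f' ≫ u) :
    tr (tr k f h) f' h' = tr k f' h''

/-- The presheaf of groupoids `𝒴` satisfies descent along the morphisms in `W`. The three clauses
are the usual ones (morphisms are determined locally and can be glued, and objects can be glued), in
terms of the total category, which needs no coherence isomorphisms. -/
structure HasDescent (W : MorphismProperty C) (𝒴 : PreStk.{w, w'} C) : Prop where
  isGroupoidValued : IsGroupoidValued 𝒴
  hom_ext {a' a b : Tot 𝒴} (u : a' ⟶ a) (hu : W u.base) {m m' : a ⟶ b} (hb : m.base = m'.base)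
    (h : u ≫ m = u ≫ m') : m = m'
  exists_desc {a' a b : Tot 𝒴} (u : a' ⟶ a) (hu : W u.base) (f : a.base ⟶ b.base) (n : a' ⟶ b)
    (hn : n.base = u.base ≫ f)
    (h : ∀ (z : Tot 𝒴) (k₁ k₂ : z ⟶ a'), k₁ ≫ u = k₂ ≫ u → k₁ ≫ n = k₂ ≫ n) :
    ∃ m : a ⟶ b, m.base = f ∧ u ≫ m = n
  exists_descent {X T : C} (u : X ⟶ T) (hu : W u) (x : 𝒴.obj (.mk (op X)))
    (δ : GluingDatum 𝒴 u x) :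
    ∃ (y : 𝒴.obj (.mk (op T))) (m : Tot.mk x ⟶ Tot.mk y), m.base = u ∧
      ∀ {z : Tot 𝒴} (k : z ⟶ Tot.mk x) (f : z.base ⟶ X) (h : k.base ≫ u = f ≫ u),
        δ.tr k f h ≫ m = k ≫ m

namespace Tot

variable {𝒴 : PreStk.{w, w'} C} {J : GrothendieckTopology C} (h𝒴 : IsGroupoidStack J 𝒴)

lemma exists_iso_pull (h𝒴 : IsGroupoidValued 𝒴) {a' a : Tot 𝒴} (u : a' ⟶ a) :
    ∃ l : mk (pull 𝒴 u.base a.fiber) ≅ a', l.hom.base = 𝟙 _ ∧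
      l.hom ≫ u = cart u.base a.fiber := by
  have hu : vert (fiberOver u u.base rfl) ≫ cart u.base a.fiber = u :=
    vert_fiberOver_comp_cart u u.base rfl
  obtain ⟨l, hl, hlu⟩ := exists_lift h𝒴 u (cart u.base a.fiber) (𝟙 _) (Category.id_comp _)
  refine ⟨⟨l, vert (fiberOver u u.base rfl), hom_ext_of_comp h𝒴 (cart u.base a.fiber) ?_ ?_,
    hom_ext_of_comp h𝒴 u ((Category.id_comp _).trans hl) ?_⟩, hl, hlu⟩
  · exact (Category.comp_id _).trans hl
  · rw [Category.assoc, Category.id_comp]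
    exact (congrArg (l ≫ ·) hu).trans hlu
  · rw [Category.assoc, hlu, Category.id_comp]
    exact hu

include h𝒴

lemma hom_ext_of_coveringMorphisms {a' a b : Tot 𝒴} (u : a' ⟶ a)
    (hu : coveringMorphisms J u.base) {m m' : a ⟶ b} (hb : m.base = m'.base)
    (h : u ≫ m = u ≫ m') : m = m' := by
  have := h𝒴.isStack
  have hff := 𝒴.fullyFaithfulToDescentData (J := J) _ hu.ofArrows_mem
  obtain ⟨l, -, hl⟩ := exists_iso_pull h𝒴.isGroupoidValued u
  have hfiber : fiberOver m m.base rfl = fiberOver m' m.base hb.symm := by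
    apply hff.map_injective
    ext i
    apply eq_of_vert_comp_cart (f := u.base)
    refine (vert_map_comp_cart u.base _).trans (Eq.trans ?_ (vert_map_comp_cart u.base _).symm)
    refine hom_ext_of_comp h𝒴.isGroupoidValued (cart m.base b.fiber) (by rfl) ?_
    rw [Category.assoc, Category.assoc]
    refine (congrArg (cart u.base a.fiber ≫ ·) (vert_fiberOver_comp_cart m m.base rfl)).trans
      (Eq.trans ?_ (congrArg (cart u.base a.fiber ≫ ·)
        (vert_fiberOver_comp_cart m' m.base hb.symm)).symm)
    change cart u.base a.fiber ≫ m = cart u.base a.fiber ≫ m'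
    rw [← hl, Category.assoc, Category.assoc, h]
  rw [← vert_fiberOver_comp_cart m m.base rfl, hfiber]
  exact vert_fiberOver_comp_cart m' m.base hb.symm

lemma exists_desc_cart {X S : C} {u : X ⟶ S} (hu : coveringMorphisms J u)
    {y : 𝒴.obj (.mk (op S))} {b : Tot 𝒴} (f : S ⟶ b.base) (n : mk (pull 𝒴 u y) ⟶ b)
    (hn : n.base = u ≫ f)
    (h : ∀ (z : Tot 𝒴) (k₁ k₂ : z ⟶ mk (pull 𝒴 u y)),
      k₁ ≫ cart u y = k₂ ≫ cart u y → k₁ ≫ n = k₂ ≫ n) :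
    ∃ m : mk y ⟶ b, m.base = f ∧ cart u y ≫ m = n := by
  have := h𝒴.isStack
  have hff := 𝒴.fullyFaithfulToDescentData (J := J) _ hu.ofArrows_mem
  let φ : pull 𝒴 u y ⟶ pull 𝒴 u (pull 𝒴 f b.fiber) :=
    fiberOver n (u ≫ f) hn ≫ (pullComp f u (u ≫ f) rfl b.fiber).inv
  have hφ : vert φ ≫ cart u _ ≫ cart f b.fiber = n := by
    rw [vert_comp, Category.assoc, vert_pullComp_inv_comp_cart]
    exact vert_fiberOver_comp_cart n (u ≫ f) hn
  let Φ : (𝒴.toDescentData (fun _ : Unit => u)).obj y ⟶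
      (𝒴.toDescentData (fun _ : Unit => u)).obj (pull 𝒴 f b.fiber) :=
    { hom := fun _ => φ
      comm := fun Y q _ _ f₁ f₂ hf₁ hf₂ => by
        change (𝒴.map f₁.op.toLoc).toFunctor.map φ ≫
          (pullComp u f₁ q hf₁ (pull 𝒴 f b.fiber)).hom ≫
            (pullComp u f₂ q hf₂ (pull 𝒴 f b.fiber)).inv =
          ((pullComp u f₁ q hf₁ y).hom ≫ (pullComp u f₂ q hf₂ y).inv) ≫
            (𝒴.map f₂.op.toLoc).toFunctor.map φ
        apply eq_of_vert_comp_cart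
        refine hom_ext_of_comp h𝒴.isGroupoidValued (cart u _ ≫ cart f b.fiber) (by rfl) ?_
        simp only [vert_comp, Category.assoc, vert_pullComp_inv_comp_cart_assoc,
          vert_pullComp_hom_comp_cart_assoc, vert_map_comp_cart_assoc, hφ]
        refine (h _ (cart f₁ _) (vert (pullComp u f₁ q hf₁ y).hom ≫
          vert (pullComp u f₂ q hf₂ y).inv ≫ cart f₂ _) ?_).trans ?_
        · simp only [Category.assoc, vert_pullComp_inv_comp_cart, vert_pullComp_hom_comp_cart]
        · simp only [Category.assoc] }
  obtain ⟨m, hm⟩ := hff.map_surjective Φ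
  have hmφ : (𝒴.map u.op.toLoc).toFunctor.map m = φ :=
    congrArg (fun t => Pseudofunctor.DescentData.Hom.hom t ()) hm
  refine ⟨vert m ≫ cart f b.fiber, Category.id_comp f, ?_⟩
  rw [← vert_map_comp_cart_assoc, hmφ, hφ]

lemma exists_desc_of_coveringMorphisms {a' a b : Tot 𝒴} (u : a' ⟶ a)
    (hu : coveringMorphisms J u.base) (f : a.base ⟶ b.base) (n : a' ⟶ b)
    (hn : n.base = u.base ≫ f)
    (h : ∀ (z : Tot 𝒴) (k₁ k₂ : z ⟶ a'), k₁ ≫ u = k₂ ≫ u → k₁ ≫ n = k₂ ≫ n) :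
    ∃ m : a ⟶ b, m.base = f ∧ u ≫ m = n := by
  obtain ⟨l, hl, hlu⟩ := exists_iso_pull h𝒴.isGroupoidValued u
  have hln : (l.hom ≫ n).base = u.base ≫ f := by
    rw [comp_base, hl, hn]
    exact Category.id_comp _
  obtain ⟨m, hm, hlm⟩ := exists_desc_cart h𝒴 hu f (l.hom ≫ n) hln fun z k₁ k₂ hk => by
    have := h z (k₁ ≫ l.hom) (k₂ ≫ l.hom) (by rw [Category.assoc, hlu, hk, Category.assoc, hlu])
    rwa [Category.assoc, Category.assoc] at this
  refine ⟨m, hm, ?_⟩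
  rw [← cancel_epi l.hom, ← Category.assoc, hlu, hlm]

end Tot

namespace GluingDatum

open Tot

variable {𝒴 : PreStk.{w, w'} C} {X T : C} {u : X ⟶ T} {x : 𝒴.obj (.mk (op X))}
  (δ : GluingDatum 𝒴 u x)

/-- The comparison isomorphism `f₁^* x ≅ f₂^* x` of a gluing datum. -/
def pullHom {Y : C} (f₁ f₂ : Y ⟶ X) (h : f₁ ≫ u = f₂ ≫ u) : pull 𝒴 f₁ x ⟶ pull 𝒴 f₂ x :=
  fiberOver (δ.tr (cart f₁ x) f₂ h) f₂ (δ.tr_base _ _ _)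

lemma vert_pullHom_comp_cart {Y : C} (f₁ f₂ : Y ⟶ X) (h : f₁ ≫ u = f₂ ≫ u) :
    vert (δ.pullHom f₁ f₂ h) ≫ cart f₂ x = δ.tr (cart f₁ x) f₂ h :=
  vert_fiberOver_comp_cart _ _ _

/-- The descent datum in the sense of Mathlib given by a gluing datum. -/
def toDescentData : 𝒴.DescentData (fun _ : Unit => u) where
  obj _ := x
  hom _ _ _ _ f₁ f₂ hf₁ hf₂ := δ.pullHom f₁ f₂ (hf₁.trans hf₂.symm)
  pullHom_hom := fun Y' Y g q q' hq i₁ i₂ f₁ f₂ hf₁ hf₂ gf₁ gf₂ hgf₁ hgf₂ => by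
    change (pullComp f₁ g gf₁ hgf₁ x).inv ≫ (𝒴.map g.op.toLoc).toFunctor.map
      (δ.pullHom f₁ f₂ _) ≫ (pullComp f₂ g gf₂ hgf₂ x).hom = _
    apply eq_of_vert_comp_cart
    simp only [vert_comp, Category.assoc, vert_pullComp_hom_comp_cart, vert_map_comp_cart_assoc,
      vert_pullHom_comp_cart]
    rw [← Category.assoc]
    refine (δ.tr_comp _ _ _ _ _ _ _ ?_ ?_).symm
    · rw [Category.assoc, vert_pullComp_inv_comp_cart]
    · rw [← hgf₂]
      exact congrArg (· ≫ f₂) (Category.id_comp g).symm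
  hom_self Y q i g hg := by
    apply eq_of_vert_comp_cart
    rw [vert_pullHom_comp_cart, vert_id, Category.id_comp]
    exact δ.tr_self (cart g x)
  hom_comp Y q _ _ _ f₁ f₂ f₃ hf₁ hf₂ hf₃ := by
    apply eq_of_vert_comp_cart
    have h₁₂ : f₁ ≫ u = f₂ ≫ u := hf₁.trans hf₂.symm
    have h₁₃ : (δ.tr (cart f₁ x) f₂ h₁₂).base ≫ u = f₃ ≫ u :=
      (congrArg (· ≫ u) (δ.tr_base (cart f₁ x) f₂ h₁₂)).trans (hf₂.trans hf₃.symm)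
    rw [vert_pullHom_comp_cart, vert_comp, Category.assoc, vert_pullHom_comp_cart]
    refine (δ.tr_comp _ _ _ _ (δ.tr (cart f₁ x) f₂ h₁₂) f₃ h₁₃ ?_ ?_).symm.trans
      (δ.tr_tr (cart f₁ x) f₂ f₃ h₁₂ h₁₃ (hf₁.trans hf₃.symm))
    · rw [vert_pullHom_comp_cart]
    · exact (Category.id_comp f₃).symm

lemma tr_comp_eq_of_cart {b : Tot 𝒴} (m : Tot.mk x ⟶ b)
    (hm : ∀ {Y : C} (f₁ f₂ : Y ⟶ X) (h : f₁ ≫ u = f₂ ≫ u),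
      δ.tr (cart f₁ x) f₂ h ≫ m = cart f₁ x ≫ m)
    {z : Tot 𝒴} (k : z ⟶ Tot.mk x) (f : z.base ⟶ X) (h : k.base ≫ u = f ≫ u) :
    δ.tr k f h ≫ m = k ≫ m := by
  have hk : k = vert (fiberOver k k.base rfl) ≫ cart k.base x :=
    (vert_fiberOver_comp_cart k k.base rfl).symm
  rw [δ.tr_comp (vert (fiberOver k k.base rfl)) (cart k.base x) f h k f h hk
    (Category.id_comp f).symm, Category.assoc, hm k.base f h, ← Category.assoc]
  exact congrArg (· ≫ m) hk.symm

lemma exists_descent {J : GrothendieckTopology C} (h𝒴 : IsGroupoidStack J 𝒴)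
    (hu : coveringMorphisms J u) :
    ∃ (y : 𝒴.obj (.mk (op T))) (m : Tot.mk x ⟶ Tot.mk y), m.base = u ∧
      ∀ {z : Tot 𝒴} (k : z ⟶ Tot.mk x) (f : z.base ⟶ X) (h : k.base ≫ u = f ≫ u),
        δ.tr k f h ≫ m = k ≫ m := by
  have := h𝒴.isStack
  obtain ⟨y, ⟨e⟩⟩ := (𝒴.isEquivalence_toDescentData (J := J) _
    hu.ofArrows_mem).essSurj.mem_essImage δ.toDescentData
  let α : x ⟶ pull 𝒴 u y := e.inv.hom ()
  refine ⟨y, vert α ≫ cart u y, Category.id_comp u, δ.tr_comp_eq_of_cart _ fun f₁ f₂ hf => ?_⟩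
  have hα : (𝒴.map f₁.op.toLoc).toFunctor.map α ≫ (pullComp u f₁ (f₂ ≫ u) hf y).hom ≫
      (pullComp u f₂ (f₂ ≫ u) rfl y).inv =
      δ.pullHom f₁ f₂ hf ≫ (𝒴.map f₂.op.toLoc).toFunctor.map α :=
    e.inv.comm (f₂ ≫ u) (i₁ := ()) (i₂ := ()) f₁ f₂ hf rfl
  have hαcart := congrArg (fun t => vert t ≫ cart f₂ _ ≫ cart u y) hα
  simp only [vert_comp, Category.assoc, vert_pullComp_inv_comp_cart,
    vert_pullComp_hom_comp_cart, vert_map_comp_cart_assoc] at hαcart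
  rw [hαcart, ← Category.assoc (vert (δ.pullHom _ _ _)), vert_pullHom_comp_cart]

end GluingDatum

lemma IsGroupoidStack.hasDescent {J : GrothendieckTopology C} {𝒴 : PreStk.{w, w'} C}
    (h𝒴 : IsGroupoidStack J 𝒴) : HasDescent (coveringMorphisms J) 𝒴 where
  isGroupoidValued := h𝒴.isGroupoidValued
  hom_ext := Tot.hom_ext_of_coveringMorphisms h𝒴
  exists_desc := Tot.exists_desc_of_coveringMorphisms h𝒴
  exists_descent _ hu _ δ := δ.exists_descent h𝒴 hu

end Descent

/-! ### Restriction to the total category of another presheaf -/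

section Restriction

variable {C : Type u₁} [Category.{v₁} C] {D : Type u₂} [Category.{v₂} D]

lemma map₂_app_eq_eqToHom (𝒳 : PreStk.{w, w'} C) {a b : LocallyDiscrete Cᵒᵖ} {f g : a ⟶ b}
    (α : f ⟶ g) (x : 𝒳.obj a) (h : (𝒳.map f).toFunctor.obj x = (𝒳.map g).toFunctor.obj x) :
    (𝒳.map₂ α).toNatTrans.app x = eqToHom h := by
  obtain rfl := LocallyDiscrete.eq_of_hom α
  obtain rfl : α = 𝟙 _ := Subsingleton.elim _ _
  rw [PrelaxFunctor.map₂_id]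
  rfl

/-- The functor from the total category of a restriction to the total category. -/
def totRestrict (ι : D ⥤ C) (𝒳 : PreStk.{w, w'} C) : Tot (restrict ι 𝒳) ⥤ Tot 𝒳 where
  obj e := ⟨ι.obj e.base, e.fiber⟩
  map u := ⟨ι.map u.base, u.fiber⟩
  map_id e := by
    refine Pseudofunctor.CoGrothendieck.Hom.ext _ _ (ι.map_id _) ?_
    exact congrArg (_ ≫ ·) (map₂_app_eq_eqToHom 𝒳 _ _ _)
  map_comp {a b c} f g := by
    refine Pseudofunctor.CoGrothendieck.Hom.ext _ _ (ι.map_comp _ _) ?_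
    refine Eq.trans ?_ (Category.assoc _ _ _).symm
    refine congrArg (_ ≫ ·) (Eq.trans ?_ (Category.assoc _ _ _).symm)
    exact congrArg (_ ≫ _ ≫ ·) (map₂_app_eq_eqToHom 𝒳 _ _ _)

variable {ι : D ⥤ C} {𝒳 : PreStk.{w, w'} C}

lemma totRestrict_map_injective {a b : Tot (restrict ι 𝒳)} {u u' : a ⟶ b} (hb : u.base = u'.base)
    (h : (totRestrict ι 𝒳).map u = (totRestrict ι 𝒳).map u') : u = u' := by
  obtain ⟨f, α⟩ := u
  obtain ⟨f', β⟩ := u'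
  obtain rfl : f = f' := hb
  congr 1
  exact Tot.homMk_injective (𝒴 := 𝒳) (a := (totRestrict ι 𝒳).obj a)
    (b := (totRestrict ι 𝒳).obj b) h

lemma exists_totRestrict_map_eq {a b : Tot (restrict ι 𝒳)} (f : a.base ⟶ b.base)
    (n : (totRestrict ι 𝒳).obj a ⟶ (totRestrict ι 𝒳).obj b) (hn : n.base = ι.map f) :
    ∃ u : a ⟶ b, u.base = f ∧ (totRestrict ι 𝒳).map u = n := by
  obtain ⟨g, β⟩ := n
  obtain rfl : g = ι.map f := hn
  exact ⟨⟨f, β⟩, rfl, rfl⟩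

end Restriction

section BaseChange

open Pseudofunctor.CoGrothendieck (forget)

variable {C : Type u₁} [Category.{v₁} C] {𝒳 : PreStk.{v, u} C} {𝒴 : PreStk.{w, w'} C}

/-- Any two morphisms to the same object, the second of them in `W`, can be completed to a
commutative square, with the morphism opposite to the second one in `W`. -/
def HasWeakBaseChange (W : MorphismProperty C) : Prop :=
  ∀ ⦃x y z : C⦄ (t : x ⟶ z) (s : y ⟶ z), W s → ∃ (x' : C) (r : x' ⟶ x) (t' : x' ⟶ y),
    W r ∧ r ≫ t = t' ≫ s

lemma hasWeakBaseChange_coveringMorphisms [HasPullbacks C] (J : GrothendieckTopology C) :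
    HasWeakBaseChange (coveringMorphisms J) := by
  intro x y z t s hs
  refine ⟨_, pullback.fst t s, pullback.snd t s, ?_, pullback.condition⟩
  refine J.superset_covering ?_ (J.pullback_stable t hs)
  rintro Z h ⟨V, l, _, ⟨⟩, hl⟩
  exact ⟨_, pullback.lift h l hl.symm, _, ⟨⟩, pullback.lift_fst _ _ _⟩

lemma HasWeakBaseChange.inverseImage_forget {W : MorphismProperty C} (hW : HasWeakBaseChange W)
    (h𝒴 : IsGroupoidValued 𝒴) : HasWeakBaseChange (W.inverseImage (forget 𝒴)) := by
  intro x y z t s hs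
  obtain ⟨S, r, t', hr, h⟩ := hW t.base s.base hs
  obtain ⟨k, -, hk⟩ := Tot.exists_lift h𝒴 s (Tot.cart r x.fiber ≫ t) t' h.symm
  exact ⟨_, Tot.cart r x.fiber, k, hr, hk.symm⟩

/-- The object `x` of the total category together with an object of `𝒴` over the same base. -/
abbrev totPair (x : Tot 𝒳) (y : 𝒴.obj (.mk (op x.base))) : Tot (restrict (forget 𝒳) 𝒴) :=
  ⟨x, y⟩

/-- The pullback of `x` along the base of a morphism `k` to `y`, with `k` as second component. -/
abbrev cartPair {z : Tot 𝒴} (x : Tot 𝒳) {y : 𝒴.obj (.mk (op x.base))} (k : z ⟶ Tot.mk y) :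
    totPair (Tot.mk (pull 𝒳 k.base x.fiber)) z.fiber ⟶ totPair x y :=
  ⟨Tot.cart k.base x.fiber, k.fiber⟩

variable {X T : Tot 𝒳} {u : X ⟶ T} {x : 𝒴.obj (.mk (op X.base))}

lemma exists_comp_eq_comp_of_base (h𝒳 : IsGroupoidValued 𝒳) {z : Tot 𝒴} (k : z ⟶ Tot.mk x)
    (u : X ⟶ T) (f : z.base ⟶ X.base) (h : k.base ≫ u.base = f ≫ u.base) :
    ∃ φ : Tot.mk (pull 𝒳 k.base X.fiber) ⟶ X,
      φ.base = f ∧ (cartPair X k).base ≫ u = φ ≫ u := by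
  obtain ⟨φ, hφ, hφu⟩ := Tot.exists_lift h𝒳 u (Tot.cart k.base X.fiber ≫ u) f h.symm
  exact ⟨φ, hφ, hφu.symm⟩

/-- The morphism `t` of `𝒴` underlies all transports, in the restriction of `𝒴` to the total
category of `𝒳`, of morphisms over `k` to morphisms over `f`. -/
def GluingDatum.IsTransport (δ : GluingDatum (restrict (forget 𝒳) 𝒴) (X := X) (T := T) u x)
    {z : Tot 𝒴} (k : z ⟶ Tot.mk x) (f : z.base ⟶ X.base) (t : z ⟶ Tot.mk x) : Prop :=
  ∀ (e : Tot (restrict (forget 𝒳) 𝒴)) (l : (totRestrict (forget 𝒳) 𝒴).obj e ⟶ z)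
    (K : e ⟶ totPair X x) (φ : e.base ⟶ X) (hφ : K.base ≫ u = φ ≫ u),
    (totRestrict (forget 𝒳) 𝒴).map K = l ≫ k → φ.base = l.base ≫ f →
      (totRestrict (forget 𝒳) 𝒴).map (δ.tr K φ hφ) = l ≫ t

namespace GluingDatum

variable (h𝒳 : IsGroupoidValued 𝒳)
  (δ : GluingDatum (restrict (forget 𝒳) 𝒴) (X := X) (T := T) u x)

include h𝒳 in
lemma exists_isTransport {z : Tot 𝒴} (k : z ⟶ Tot.mk x) (f : z.base ⟶ X.base)
    (h : k.base ≫ u.base = f ≫ u.base) :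
    ∃ t : z ⟶ Tot.mk x, t.base = f ∧ δ.IsTransport k f t := by
  obtain ⟨φ₀, rfl, hφ₀⟩ := exists_comp_eq_comp_of_base h𝒳 k u f h
  refine ⟨(totRestrict (forget 𝒳) 𝒴).map (δ.tr (cartPair X k) φ₀ hφ₀),
    congrArg Pseudofunctor.CoGrothendieck.Hom.base (δ.tr_base _ _ hφ₀),
    fun e l K φ hφ hK hf => ?_⟩
  obtain ⟨m, hm, hmK⟩ := Tot.exists_lift h𝒳 (Tot.cart k.base X.fiber) K.base l.base
    ((forget 𝒴).congr_map hK).symm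
  obtain ⟨L, rfl, rfl⟩ := exists_totRestrict_map_eq (ι := forget 𝒳) (𝒳 := 𝒴)
    (b := totPair (Tot.mk (pull 𝒳 k.base X.fiber)) z.fiber) m l hm.symm
  have hLK : K = L ≫ cartPair X k :=
    totRestrict_map_injective hmK.symm
      (hK.trans ((totRestrict (forget 𝒳) 𝒴).map_comp L (cartPair X k)).symm)
  have hLφ : φ = L.base ≫ φ₀ := by
    refine Tot.hom_ext_of_comp h𝒳 u hf ?_
    rw [← hφ, Category.assoc, ← hφ₀, ← Category.assoc]
    exact congrArg (· ≫ u) hmK.symm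
  rw [δ.tr_comp L (cartPair X k) φ₀ hφ₀ K φ hφ hLK hLφ]
  exact (totRestrict _ 𝒴).map_comp _ _

/-- The gluing datum relative to a morphism of `C` underlying one relative to a morphism of the
total category. -/
def ofForget : GluingDatum 𝒴 u.base x where
  tr k f h := (δ.exists_isTransport h𝒳 k f h).choose
  tr_base k f h := (δ.exists_isTransport h𝒳 k f h).choose_spec.1
  tr_comp l k f h k' f' h' hk hf := by
    obtain ⟨φ, hφ, hφu⟩ := exists_comp_eq_comp_of_base h𝒳 k' u f' h'
    have h₁ := (δ.exists_isTransport h𝒳 k' f' h').choose_spec.2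
      (totPair (Tot.mk (pull 𝒳 k'.base X.fiber)) _) (𝟙 _) (cartPair X k') φ hφu
      (Category.id_comp _).symm (hφ.trans (Category.id_comp _).symm)
    have h₂ := (δ.exists_isTransport h𝒳 k f h).choose_spec.2
      (totPair (Tot.mk (pull 𝒳 k'.base X.fiber)) _) l (cartPair X k') φ hφu hk
      (hφ.trans hf)
    exact (Category.id_comp _).symm.trans (h₁.symm.trans h₂)
  tr_self k := by
    have h := (δ.exists_isTransport h𝒳 k k.base rfl).choose_spec.2 _ (𝟙 _) (cartPair X k)
      (cartPair X k).base rfl (Category.id_comp _).symm (Category.id_comp _).symm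
    rw [δ.tr_self] at h
    exact (Category.id_comp _).symm.trans h.symm
  tr_tr {z} k f f' h h' h'' := by
    obtain ⟨φ, hφ, hφu⟩ := exists_comp_eq_comp_of_base h𝒳 k u f h
    obtain ⟨φ', hφ', hφu'⟩ := exists_comp_eq_comp_of_base h𝒳 k u f' h''
    have hφφ' : (δ.tr (cartPair X k) φ hφu).base ≫ u = φ' ≫ u := by
      rw [δ.tr_base, ← hφu, hφu']
    have h₁ := (δ.exists_isTransport h𝒳 k f h).choose_spec.2 _ (𝟙 _) (cartPair X k) φ hφu
      (Category.id_comp _).symm (hφ.trans (Category.id_comp _).symm)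
    have h₂ := (δ.exists_isTransport h𝒳 _ f' h').choose_spec.2
      (totPair (Tot.mk (pull 𝒳 k.base X.fiber)) z.fiber) (𝟙 _) _ φ' hφφ' h₁
      (hφ'.trans (Category.id_comp _).symm)
    have h₃ := (δ.exists_isTransport h𝒳 k f' h'').choose_spec.2 _ (𝟙 _) (cartPair X k) φ' hφu'
      (Category.id_comp _).symm (hφ'.trans (Category.id_comp _).symm)
    rw [δ.tr_tr _ _ _ _ _ hφu'] at h₂
    exact (Category.id_comp _).symm.trans (h₂.symm.trans (h₃.trans (Category.id_comp _)))

lemma tr_ofForget {e : Tot (restrict (forget 𝒳) 𝒴)} (K : e ⟶ totPair X x) (φ : e.base ⟶ X)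
    (h : K.base ≫ u = φ ≫ u)
    (h' : ((totRestrict (forget 𝒳) 𝒴).map K).base ≫ u.base = φ.base ≫ u.base) :
    (δ.ofForget h𝒳).tr ((totRestrict (forget 𝒳) 𝒴).map K) φ.base h' =
      (totRestrict (forget 𝒳) 𝒴).map (δ.tr K φ h) :=
  ((δ.exists_isTransport h𝒳 _ _ h').choose_spec.2 e (𝟙 _) K φ h (Category.id_comp _).symm
    (Category.id_comp _).symm |>.trans (Category.id_comp _)).symm

end GluingDatum

namespace HasDescent

variable {W : MorphismProperty C} (h𝒴 : HasDescent W 𝒴) (h𝒳 : IsGroupoidValued 𝒳)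
include h𝒴

lemma hom_ext_forget {a' a b : Tot (restrict (forget 𝒳) 𝒴)} (u : a' ⟶ a) (hu : W u.base.base)
    {m m' : a ⟶ b} (hb : m.base = m'.base) (h : u ≫ m = u ≫ m') : m = m' := by
  refine totRestrict_map_injective hb (h𝒴.hom_ext ((totRestrict (forget 𝒳) 𝒴).map u) hu
    ((forget 𝒳).congr_map hb) ?_)
  rw [← Functor.map_comp, h, Functor.map_comp]

include h𝒳

lemma exists_desc_forget {a' a b : Tot (restrict (forget 𝒳) 𝒴)} (u : a' ⟶ a) (hu : W u.base.base)
    (f : a.base ⟶ b.base) (n : a' ⟶ b) (hn : n.base = u.base ≫ f)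
    (h : ∀ (z : Tot (restrict (forget 𝒳) 𝒴)) (k₁ k₂ : z ⟶ a'), k₁ ≫ u = k₂ ≫ u →
      k₁ ≫ n = k₂ ≫ n) :
    ∃ m : a ⟶ b, m.base = f ∧ u ≫ m = n := by
  obtain ⟨m, hm, hum⟩ := h𝒴.exists_desc ((totRestrict (forget 𝒳) 𝒴).map u) hu
    (b := (totRestrict (forget 𝒳) 𝒴).obj b) ((forget 𝒳).map f)
    ((totRestrict (forget 𝒳) 𝒴).map n) ((forget 𝒳).congr_map hn)
    fun z k₁ k₂ hk => by
      obtain ⟨κ, hκ, hκu⟩ := exists_comp_eq_comp_of_base (𝒴 := 𝒴) h𝒳 (x := a'.fiber) k₁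
        u.base k₂.base
        ((forget 𝒴).congr_map hk)
      obtain ⟨K₂, rfl, rfl⟩ := exists_totRestrict_map_eq (ι := forget 𝒳) (𝒳 := 𝒴)
        (a := totPair (Tot.mk (pull 𝒳 k₁.base a'.base.fiber)) z.fiber) (b := a') κ k₂ hκ.symm
      have hK : (cartPair a'.base k₁ : _ ⟶ a') ≫ u = K₂ ≫ u :=
        totRestrict_map_injective hκu
          (((totRestrict _ 𝒴).map_comp _ _).trans
            (hk.trans ((totRestrict _ 𝒴).map_comp _ _).symm))
      exact ((totRestrict _ 𝒴).map_comp (cartPair a'.base k₁ : _ ⟶ a') n).symm.trans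
        ((congrArg (totRestrict _ 𝒴).map (h _ _ K₂ hK)).trans ((totRestrict _ 𝒴).map_comp _ _))
  obtain ⟨M, rfl, rfl⟩ := exists_totRestrict_map_eq (ι := forget 𝒳) (𝒳 := 𝒴) f m hm
  exact ⟨M, rfl, totRestrict_map_injective hn.symm (((totRestrict _ 𝒴).map_comp _ _).trans hum)⟩

lemma exists_descent_forget {X T : Tot 𝒳} (u : X ⟶ T) (hu : W u.base)
    (x : 𝒴.obj (.mk (op X.base))) (δ : GluingDatum (restrict (forget 𝒳) 𝒴) (X := X) (T := T) u x) :
    ∃ (y : 𝒴.obj (.mk (op T.base))) (m : totPair X x ⟶ totPair T y), m.base = u ∧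
      ∀ {z : Tot (restrict (forget 𝒳) 𝒴)} (k : z ⟶ totPair X x) (f : z.base ⟶ X)
        (h : k.base ≫ u = f ≫ u), δ.tr k f h ≫ m = k ≫ m := by
  obtain ⟨y, m, hm, h⟩ := h𝒴.exists_descent u.base hu x (δ.ofForget h𝒳)
  obtain ⟨M, hM, rfl⟩ := exists_totRestrict_map_eq (ι := forget 𝒳) (𝒳 := 𝒴)
    (a := totPair X x) (b := totPair T y) u m hm
  refine ⟨y, M, hM, fun {z} k f hf => totRestrict_map_injective ?_ ?_⟩
  · rw [Tot.comp_base, Tot.comp_base, δ.tr_base, hM]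
    exact hf.symm
  · rw [Functor.map_comp, Functor.map_comp, ← δ.tr_ofForget h𝒳 k f hf
      ((forget 𝒳).congr_map hf)]
    exact h _ _ _

lemma restrict_forget :
    HasDescent (W.inverseImage (forget 𝒳)) (restrict (forget 𝒳) 𝒴) where
  isGroupoidValued x := h𝒴.isGroupoidValued x.base
  hom_ext := h𝒴.hom_ext_forget
  exists_desc := h𝒴.exists_desc_forget h𝒳
  exists_descent := h𝒴.exists_descent_forget h𝒳

end HasDescent

end BaseChange

/-! ### Extension of cartesian sections along an atlas -/

section Sections

variable {C : Type u₁} [Category.{v₁} C] {A : Type u₂} [Category.{v₂} A]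

/-- Cartesian sections over `π : A ⥤ C` of a presheaf of categories `𝒴` on `C`. -/
structure Sec (π : A ⥤ C) (𝒴 : PreStk.{w, w'} C) where
  fib (a : A) : 𝒴.obj (.mk (op (π.obj a)))
  map {a b : A} (f : a ⟶ b) : Tot.mk (fib a) ⟶ Tot.mk (fib b)
  map_base {a b : A} (f : a ⟶ b) : (map f).base = π.map f
  map_id (a : A) : map (𝟙 a) = 𝟙 _
  map_comp {a b c : A} (f : a ⟶ b) (g : b ⟶ c) : map (f ≫ g) = map f ≫ map g

namespace Sec

attribute [simp] map_base map_id
attribute [simp] map_comp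

variable {π : A ⥤ C} {𝒴 : PreStk.{w, w'} C}

/-- Morphisms of sections. -/
@[ext]
structure Hom (y y' : Sec π 𝒴) where
  app (a : A) : Tot.mk (y.fib a) ⟶ Tot.mk (y'.fib a)
  app_base (a : A) : (app a).base = 𝟙 _
  naturality {a b : A} (f : a ⟶ b) : y.map f ≫ app b = app a ≫ y'.map f

attribute [simp] Hom.app_base
lemma Hom.naturality_assoc {y y' : Sec π 𝒴} (φ : Hom y y') {a b : A} (f : a ⟶ b) {c : Tot 𝒴}
    (h : Tot.mk (y'.fib b) ⟶ c) : y.map f ≫ φ.app b ≫ h = φ.app a ≫ y'.map f ≫ h := by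
  rw [← Category.assoc, φ.naturality, Category.assoc]

instance : Category (Sec π 𝒴) where
  Hom := Hom
  id y :=
    { app _ := 𝟙 _
      app_base _ := rfl
      naturality _ := by rw [Category.id_comp, Category.comp_id] }
  comp φ ψ :=
    { app a := φ.app a ≫ ψ.app a
      app_base a := by rw [Tot.comp_base, φ.app_base, ψ.app_base]; exact Category.comp_id _
      naturality f := by
        rw [φ.naturality_assoc, ψ.naturality, Category.assoc] }
  id_comp _ := Hom.ext (funext fun _ => Category.id_comp _)
  comp_id _ := Hom.ext (funext fun _ => Category.comp_id _)
  assoc _ _ _ := Hom.ext (funext fun _ => Category.assoc _ _ _)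

@[ext]
lemma hom_ext {y y' : Sec π 𝒴} {φ ψ : y ⟶ y'} (h : ∀ a, φ.app a = ψ.app a) : φ = ψ :=
  Hom.ext (funext h)

/-- Morphisms between sections of presheaves of groupoids are isomorphisms. -/
def isoOfHom (h𝒴 : IsGroupoidValued 𝒴) {y y' : Sec π 𝒴} (φ : y ⟶ y') : y ≅ y' := by
  have h (a : A) : ∃ ψ : Tot.mk (y'.fib a) ⟶ Tot.mk (y.fib a), ψ.base = 𝟙 _ ∧
      ψ ≫ φ.app a = 𝟙 _ :=
    Tot.exists_lift h𝒴 (φ.app a) (𝟙 _) (𝟙 _) (by rw [φ.app_base]; exact Category.comp_id _)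
  choose ψ hψ hψ' using h
  have hψ'' (a : A) : φ.app a ≫ ψ a = 𝟙 _ := by
    refine Tot.hom_ext_of_comp h𝒴 (φ.app a) ?_ ?_
    · rw [Tot.comp_base, hψ, φ.app_base]; exact Category.comp_id _
    · rw [Category.assoc, hψ', Category.comp_id, Category.id_comp]
  exact
    { hom := φ
      inv :=
        { app := ψ
          app_base := hψ
          naturality := fun {a b} f => by
            calc y'.map f ≫ ψ b = (ψ a ≫ φ.app a) ≫ y'.map f ≫ ψ b := by
                  rw [hψ', Category.id_comp]
              _ = ψ a ≫ (φ.app a ≫ y'.map f) ≫ ψ b := by simp only [Category.assoc]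
              _ = ψ a ≫ y.map f := by
                  rw [← φ.naturality, Category.assoc, hψ'', Category.comp_id] }
      hom_inv_id := hom_ext hψ''
      inv_hom_id := hom_ext hψ' }

/-- The restriction of sections. -/
abbrev pre {B : Type u₃} [Category.{v₃} B] (j : B ⥤ A) (π : A ⥤ C) (𝒴 : PreStk.{w, w'} C) :
    Sec π 𝒴 ⥤ Sec (j ⋙ π) 𝒴 where
  obj y :=
    { fib b := y.fib (j.obj b)
      map f := y.map (j.map f)
      map_base f := y.map_base (j.map f)
      map_id b := by rw [j.map_id]; exact y.map_id _
      map_comp f g := by rw [j.map_comp]; exact y.map_comp _ _ }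
  map φ :=
    { app b := φ.app (j.obj b)
      app_base b := φ.app_base (j.obj b)
      naturality f := φ.naturality (j.map f) }

end Sec

end Sections

section SectionsOfRestriction

variable {C : Type u₁} [Category.{v₁} C] {D : Type u₂} [Category.{v₂} D] {A : Type u₃}
  [Category.{v₃} A] {ι : D ⥤ C} {𝒳 𝒴 : PreStk.{w, w'} C}

/-- The map on homs of total categories induced by a restriction. -/
def totRestrictHom {S T : D} {x : 𝒳.obj (.mk (op (ι.obj S)))} {y : 𝒳.obj (.mk (op (ι.obj T)))}
    (u : Tot.mk (𝒴 := restrict ι 𝒳) (S := S) x ⟶ Tot.mk (𝒴 := restrict ι 𝒳) (S := T) y) :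
    Tot.mk x ⟶ Tot.mk y := (totRestrict ι 𝒳).map u

lemma totRestrictHom_vert {S : D} {x y : 𝒳.obj (.mk (op (ι.obj S)))} (φ : x ⟶ y) :
    totRestrictHom (ι := ι) (Tot.vert (𝒴 := restrict ι 𝒳) (S := S) φ) = Tot.vert φ := by
  refine Pseudofunctor.CoGrothendieck.Hom.ext _ _ (ι.map_id _) ?_
  refine Eq.trans ?_ (Category.assoc _ _ _).symm
  refine congrArg (_ ≫ ·) ?_
  refine congrArg (_ ≫ ·) ?_
  exact map₂_app_eq_eqToHom 𝒳 _ _ _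

/-- Sections of a restriction are sections over the composite functor. -/
def secRestrict (π : A ⥤ D) (ι : D ⥤ C) (𝒴 : PreStk.{w, w'} C) :
    Sec π (restrict ι 𝒴) ⥤ Sec (π ⋙ ι) 𝒴 where
  obj y :=
    { fib := y.fib
      map u := totRestrictHom (ι := ι) (y.map u)
      map_base u := congrArg ι.map (y.map_base u)
      map_id a := (congrArg (totRestrict ι 𝒴).map (y.map_id a)).trans
        ((totRestrict ι 𝒴).map_id _)
      map_comp f g := (congrArg (totRestrict ι 𝒴).map (y.map_comp f g)).trans
        ((totRestrict ι 𝒴).map_comp _ _) }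
  map φ :=
    { app a := totRestrictHom (ι := ι) (φ.app a)
      app_base a := (congrArg ι.map (φ.app_base a)).trans (ι.map_id _)
      naturality f := ((totRestrict ι 𝒴).map_comp _ _).symm.trans
        ((congrArg (totRestrict ι 𝒴).map (φ.naturality f)).trans
          ((totRestrict ι 𝒴).map_comp _ _)) }
  map_id _ := Sec.hom_ext fun _ => (totRestrict ι 𝒴).map_id _
  map_comp _ _ := Sec.hom_ext fun _ => (totRestrict ι 𝒴).map_comp _ _

lemma isEquivalence_secRestrict (π : A ⥤ D) (ι : D ⥤ C) (h𝒴 : IsGroupoidValued 𝒴) :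
    (secRestrict π ι 𝒴).IsEquivalence where
  faithful := ⟨fun {y y'} φ ψ h => Sec.hom_ext fun a => totRestrict_map_injective
    ((φ.app_base a).trans (ψ.app_base a).symm) (congrArg (fun t => Sec.Hom.app t a) h)⟩
  full := ⟨fun {y y'} φ => by
    choose ψ hψ hψ' using fun a => exists_totRestrict_map_eq (ι := ι) (𝒳 := 𝒴)
      (a := Tot.mk (y.fib a)) (b := Tot.mk (y'.fib a)) (𝟙 _) (φ.app a)
      ((φ.app_base a).trans (ι.map_id _).symm)
    refine ⟨{ app := ψ, app_base := hψ, naturality := fun {a b} f => ?_ }, Sec.hom_ext hψ'⟩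
    refine totRestrict_map_injective ?_ ?_
    · rw [Tot.comp_base, Tot.comp_base, hψ, hψ]
      exact ((Category.comp_id _).trans ((y.map_base f).trans (y'.map_base f).symm)).trans
        (Category.id_comp _).symm
    · refine ((totRestrict ι 𝒴).map_comp _ _).trans (Eq.trans ?_
        ((totRestrict ι 𝒴).map_comp _ _).symm)
      rw [hψ', hψ']
      exact φ.naturality f⟩
  essSurj := ⟨fun s => by
    choose ψ hψ hψ' using fun (a b : A) (f : a ⟶ b) =>
      exists_totRestrict_map_eq (ι := ι) (𝒳 := 𝒴) (a := ⟨π.obj a, s.fib a⟩)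
      (b := ⟨π.obj b, s.fib b⟩) (π.map f) (s.map f) (s.map_base f)
    let y : Sec π (restrict ι 𝒴) :=
      { fib := s.fib
        map := fun f => ψ _ _ f
        map_base := fun f => hψ _ _ f
        map_id := fun a => totRestrict_map_injective ((hψ _ _ _).trans (π.map_id a))
          ((hψ' _ _ _).trans ((s.map_id a).trans ((totRestrict ι 𝒴).map_id
            ⟨π.obj a, s.fib a⟩).symm))
        map_comp := fun f g => totRestrict_map_injective
          ((hψ _ _ _).trans ((π.map_comp f g).trans
            (congrArg₂ (· ≫ ·) (hψ _ _ f) (hψ _ _ g)).symm))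
          ((hψ' _ _ _).trans ((s.map_comp f g).trans
            ((congrArg₂ (· ≫ ·) (hψ' _ _ f) (hψ' _ _ g)).symm.trans
              ((totRestrict ι 𝒴).map_comp _ _).symm))) }
    exact ⟨y, ⟨Sec.isoOfHom h𝒴
      { app := fun _ => 𝟙 _
        app_base := fun _ => rfl
        naturality := fun {a b} f => (Category.comp_id _).trans
          ((hψ' a b f).trans (Category.id_comp _).symm) }⟩⟩⟩

end SectionsOfRestriction

section Atlases

variable {C : Type u₁} [Category.{v₁} C] {A : Type u₂} [Category.{v₂} A]

/-- The pair `(p, q) : w ⟶ e × x` is locally surjective, with respect to the morphisms in `W`. -/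
def LocallyLifts (W : MorphismProperty C) {e x w : C} (p : w ⟶ e) (q : w ⟶ x) : Prop :=
  ∀ ⦃z : C⦄ (f : z ⟶ e) (g : z ⟶ x), ∃ (z' : C) (s : z' ⟶ z) (h : z' ⟶ w),
    W s ∧ s ≫ f = h ≫ p ∧ s ≫ g = h ≫ q

/-- The pair `(p, q) : w ⟶ d × v` is locally surjective after applying `j`, and its pullbacks to
objects of `A` are represented, up to taking weak fiber products, by objects of `A`. -/
structure IsProductChart (W : MorphismProperty C) (j : A ⥤ C) {d v w : A} (p : w ⟶ d) (q : w ⟶ v) :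
    Prop where
  locallyLifts : LocallyLifts W (j.map p) (j.map q)
  exists_fiberProduct {a : A} (α : a ⟶ d) (β : a ⟶ v) :
    ∃ (a' : A) (s : a' ⟶ a) (h : a' ⟶ w), s ≫ α = h ≫ p ∧ s ≫ β = h ≫ q ∧
      ∀ ⦃z : C⦄ (k : z ⟶ j.obj a) (l : z ⟶ j.obj w), k ≫ j.map α = l ≫ j.map p →
        k ≫ j.map β = l ≫ j.map q → ∃ m : z ⟶ j.obj a', m ≫ j.map s = k ∧ m ≫ j.map h = l

/-- The object `v` of `A` covers the final object of `C` locally, and its products with objects of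
`A` are covered by objects of `A`. -/
structure IsAtlas (W : MorphismProperty C) (j : A ⥤ C) (v : A) : Prop where
  exists_cover (e : C) : ∃ (w : C) (p : w ⟶ e) (_ : w ⟶ j.obj v), W p
  exists_productChart (d : A) : ∃ (w : A) (p : w ⟶ d) (q : w ⟶ v), IsProductChart W j p q

end Atlases

section Transport

variable {C : Type u₁} [Category.{v₁} C] {A : Type u₂} [Category.{v₂} A]
  {𝒴 : PreStk.{w, w'} C} {W : MorphismProperty C} {j : A ⥤ C} {v : A}

lemma HasWeakBaseChange.exists_total (hW : HasWeakBaseChange W) (h𝒴 : IsGroupoidValued 𝒴)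
    {x y z : Tot 𝒴} (t : x ⟶ z) (s : y ⟶ z) (hs : W s.base) :
    ∃ (x' : Tot 𝒴) (r : x' ⟶ x) (t' : x' ⟶ y), W r.base ∧ r ≫ t = t' ≫ s :=
  hW.inverseImage_forget h𝒴 t s hs

/-- Functorial transport of morphisms to the values of the section `y` to morphisms to its value
at `v`, over a prescribed morphism of the base. -/
structure TransportSystem (y : Sec j 𝒴) (v : A) where
  tr {d : A} {z : Tot 𝒴} (k : z ⟶ Tot.mk (y.fib d)) (g : z.base ⟶ j.obj v) : z ⟶ Tot.mk (y.fib v)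
  tr_base {d : A} {z : Tot 𝒴} (k : z ⟶ Tot.mk (y.fib d)) (g : z.base ⟶ j.obj v) :
    (tr k g).base = g
  comp_tr {d : A} {z z' : Tot 𝒴} (r : z' ⟶ z) (k : z ⟶ Tot.mk (y.fib d))
    (g : z.base ⟶ j.obj v) : r ≫ tr k g = tr (r ≫ k) (r.base ≫ g)
  tr_map {d d' : A} {z : Tot 𝒴} (k : z ⟶ Tot.mk (y.fib d)) (u : d ⟶ d')
    (g : z.base ⟶ j.obj v) : tr (k ≫ y.map u) g = tr k g
  tr_self {d : A} {z : Tot 𝒴} (k : z ⟶ Tot.mk (y.fib d)) (β : d ⟶ v) :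
    tr k (k.base ≫ j.map β) = k ≫ y.map β
  tr_tr {d : A} {z : Tot 𝒴} (k : z ⟶ Tot.mk (y.fib d)) (g g' : z.base ⟶ j.obj v) :
    tr (tr k g) g' = tr k g'

lemma TransportSystem.tr_eq_self {y : Sec j 𝒴} (τ : TransportSystem y v) {z : Tot 𝒴}
    (k : z ⟶ Tot.mk (y.fib v)) (g : z.base ⟶ j.obj v) (h : k.base = g) : τ.tr k g = k := by
  subst h
  simpa only [j.map_id, Category.comp_id, y.map_id] using τ.tr_self k (𝟙 v)

namespace IsProductChart

variable {d w : A} {p : w ⟶ d} {q : w ⟶ v} (hpq : IsProductChart W j p q)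
  (h𝒴 : IsGroupoidValued 𝒴) {y : Sec j 𝒴}
include hpq h𝒴

lemma exists_local_factorization {z : Tot 𝒴} (k : z ⟶ Tot.mk (y.fib d)) (g : z.base ⟶ j.obj v) :
    ∃ (z' : Tot 𝒴) (s : z' ⟶ z) (n : z' ⟶ Tot.mk (y.fib w)), W s.base ∧
      n ≫ y.map p = s ≫ k ∧ s.base ≫ g = n.base ≫ j.map q := by
  obtain ⟨S, s, h, hs, hp, hq⟩ := hpq.locallyLifts k.base g
  obtain ⟨n, rfl, hn⟩ := Tot.exists_lift h𝒴 (y.map p) (Tot.cart s z.fiber ≫ k) h (by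
    rw [y.map_base]; exact hp.symm)
  exact ⟨_, Tot.cart s z.fiber, n, hs, hn, hq⟩

lemma comp_map_eq_comp_map {x : Tot 𝒴} {a : A} (n : x ⟶ Tot.mk (y.fib a))
    (n' : x ⟶ Tot.mk (y.fib w)) (α : a ⟶ d) (β : a ⟶ v) (h : n' ≫ y.map p = n ≫ y.map α)
    (hb : n'.base ≫ j.map q = n.base ≫ j.map β) : n' ≫ y.map q = n ≫ y.map β := by
  obtain ⟨a', s, l, hd, hv, hlift⟩ := hpq.exists_fiberProduct α β
  have hbase : n.base ≫ j.map α = n'.base ≫ j.map p := by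
    simpa only [Tot.comp_base, y.map_base] using congrArg (fun t => t.base) h.symm
  obtain ⟨m, hms, hml⟩ := hlift n.base n'.base hbase hb.symm
  obtain ⟨m, rfl, rfl⟩ := Tot.exists_lift h𝒴 (y.map s) n m (by rw [y.map_base, hms])
  obtain rfl : m ≫ y.map l = n' := by
    refine Tot.hom_ext_of_comp h𝒴 (y.map p) (by rw [Tot.comp_base, y.map_base, hml]) ?_
    rw [h, Category.assoc, ← y.map_comp, ← hd, y.map_comp, Category.assoc]
  rw [Category.assoc, ← y.map_comp, ← hv, y.map_comp, Category.assoc]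

end IsProductChart

/-- The morphism `t` is compatible with `k`: it agrees with `y.map β` on all factorizations of `k`
through some `y.map α`. -/
def Sec.Compatible (y : Sec j 𝒴) {d v : A} {z : Tot 𝒴} (k : z ⟶ Tot.mk (y.fib d))
    (t : z ⟶ Tot.mk (y.fib v)) : Prop :=
  ∀ ⦃z' : Tot 𝒴⦄ (r : z' ⟶ z) (a : A) (n : z' ⟶ Tot.mk (y.fib a)) (α : a ⟶ d) (β : a ⟶ v),
    r ≫ k = n ≫ y.map α → r.base ≫ t.base = n.base ≫ j.map β → r ≫ t = n ≫ y.map β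

namespace IsAtlas

variable (hv : IsAtlas W j v) (h𝒴 : HasDescent W 𝒴) {y : Sec j 𝒴}
include hv h𝒴

lemma eq_of_compatible {d : A} {z : Tot 𝒴} {k : z ⟶ Tot.mk (y.fib d)}
    {t t' : z ⟶ Tot.mk (y.fib v)} (h : y.Compatible k t) (h' : y.Compatible k t')
    (hb : t.base = t'.base) : t = t' := by
  obtain ⟨w, p, q, hpq⟩ := hv.exists_productChart d
  obtain ⟨z', s, n, hs, hn, hb'⟩ := hpq.exists_local_factorization h𝒴.isGroupoidValued k t.base
  refine h𝒴.hom_ext s hs hb ?_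
  rw [h s w n p q hn.symm hb', h' s w n p q hn.symm (by rw [← hb, hb'])]

lemma exists_compatible (hW : HasWeakBaseChange W) {d : A} {z : Tot 𝒴}
    (k : z ⟶ Tot.mk (y.fib d)) (g : z.base ⟶ j.obj v) :
    ∃ t : z ⟶ Tot.mk (y.fib v), t.base = g ∧ y.Compatible k t := by
  have hG := h𝒴.isGroupoidValued
  obtain ⟨w, p, q, hpq⟩ := hv.exists_productChart d
  obtain ⟨z', s, n, hs, hn, hb⟩ := hpq.exists_local_factorization hG k g
  obtain ⟨t, rfl, ht⟩ := h𝒴.exists_desc s hs g (n ≫ y.map q)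
    (by rw [Tot.comp_base, y.map_base, hb]) fun x k₁ k₂ hk => by
      rw [← Category.assoc, ← Category.assoc]
      refine hpq.comp_map_eq_comp_map hG _ _ p q ?_ ?_
      · rw [Category.assoc, Category.assoc, hn, ← Category.assoc, hk, Category.assoc]
      · have hkb := congrArg (fun t => t.base ≫ g) hk
        simp only [Tot.comp_base, Category.assoc] at hkb ⊢
        rw [← hb, hkb]
  refine ⟨t, rfl, fun z₁ r a m α β hr hrb => ?_⟩
  obtain ⟨z₂, ρ, r', hρ, hρr⟩ := hW.exists_total hG r s hs
  refine h𝒴.hom_ext ρ hρ (by rw [Tot.comp_base, hrb, Tot.comp_base, y.map_base]) ?_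
  rw [← Category.assoc, hρr, Category.assoc, ht, ← Category.assoc, ← Category.assoc]
  refine hpq.comp_map_eq_comp_map hG _ _ α β ?_ ?_
  · rw [Category.assoc, hn, ← Category.assoc, ← hρr, Category.assoc, hr, Category.assoc]
  · have hρb := congrArg (fun x => x.base ≫ t.base) hρr
    simp only [Tot.comp_base, Category.assoc] at hρb ⊢
    rw [← hb, ← hρb, hrb]

lemma nonempty_transportSystem (hW : HasWeakBaseChange W) (y : Sec j 𝒴) :
    Nonempty (TransportSystem y v) := by
  choose tr hb hc using fun (d : A) (z : Tot 𝒴) (k : z ⟶ Tot.mk (y.fib d))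
    (g : z.base ⟶ j.obj v) => hv.exists_compatible h𝒴 hW k g
  have comp_tr {d : A} {z z' : Tot 𝒴} (r : z' ⟶ z) (k : z ⟶ Tot.mk (y.fib d))
      (g : z.base ⟶ j.obj v) : r ≫ tr d z k g = tr d z' (r ≫ k) (r.base ≫ g) := by
    refine hv.eq_of_compatible h𝒴 (fun z₁ r₁ a n α β h₁ h₂ => ?_) (hc _ _ _ _)
      (by rw [hb, Tot.comp_base, hb])
    rw [← Category.assoc]
    exact hc d z k g (r₁ ≫ r) a n α β (by rw [Category.assoc, h₁])
      (by rw [← h₂]; exact Category.assoc _ _ _)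
  have tr_self {d : A} {z : Tot 𝒴} (k : z ⟶ Tot.mk (y.fib d)) (β : d ⟶ v) :
      tr d z k (k.base ≫ j.map β) = k ≫ y.map β := by
    have h := hc d z k (k.base ≫ j.map β) (𝟙 z) d k (𝟙 d) β
      (by rw [y.map_id, Category.id_comp, Category.comp_id])
      (by rw [hb]; exact Category.id_comp _)
    rwa [Category.id_comp] at h
  have tr_map {d d' : A} {z : Tot 𝒴} (k : z ⟶ Tot.mk (y.fib d)) (u : d ⟶ d')
      (g : z.base ⟶ j.obj v) : tr d' z (k ≫ y.map u) g = tr d z k g := by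
    refine hv.eq_of_compatible h𝒴 (fun z' r a n α β h₁ h₂ => ?_) (hc d z k g) (by rw [hb, hb])
    refine hc d' z (k ≫ y.map u) g r a n (α ≫ u) β ?_ h₂
    rw [← Category.assoc, h₁, y.map_comp, Category.assoc]
  refine ⟨⟨tr _ _, hb _ _, comp_tr, tr_map, tr_self, fun {d z} k g g' => ?_⟩⟩
  obtain ⟨w, p, q, hpq⟩ := hv.exists_productChart d
  obtain ⟨z₁, s, n, hs, hn, hsb⟩ := hpq.exists_local_factorization h𝒴.isGroupoidValued k g
  refine h𝒴.hom_ext s hs (by rw [hb, hb]) ?_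
  rw [comp_tr, comp_tr, comp_tr, ← hn, hsb]
  simp only [tr_map, tr_self]

end IsAtlas

end Transport

section Trivializations

variable {C : Type u₁} [Category.{v₁} C] {A : Type u₂} [Category.{v₂} A]
  {𝒴 : PreStk.{w, w'} C} {W : MorphismProperty C} {j : A ⥤ C} {v : A}

/-- An identification of `T` with the value at `v` of the section `y`, locally on the base of `T`:
morphisms to `T` are transported to morphisms to `y.fib v`, over a prescribed morphism of the
base. -/
structure Trivialization {y : Sec j 𝒴} (τ : TransportSystem y v) (T : Tot 𝒴) where
  tr {z : Tot 𝒴} (t : z ⟶ T) (g : z.base ⟶ j.obj v) : z ⟶ Tot.mk (y.fib v)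
  tr_base {z : Tot 𝒴} (t : z ⟶ T) (g : z.base ⟶ j.obj v) : (tr t g).base = g
  comp_tr {z z' : Tot 𝒴} (r : z' ⟶ z) (t : z ⟶ T) (g : z.base ⟶ j.obj v) :
    r ≫ tr t g = tr (r ≫ t) (r.base ≫ g)
  tr_tr {z : Tot 𝒴} (t : z ⟶ T) (g g' : z.base ⟶ j.obj v) : τ.tr (tr t g) g' = tr t g'

/-- The trivialization of the value at `d` given by a transport system. -/
def TransportSystem.trivialization {y : Sec j 𝒴} (τ : TransportSystem y v) (d : A) :
    Trivialization τ (Tot.mk (y.fib d)) where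
  tr := τ.tr
  tr_base := τ.tr_base
  comp_tr := τ.comp_tr
  tr_tr := τ.tr_tr

namespace Trivialization

variable {y : Sec j 𝒴} {τ : TransportSystem y v} {T T' : Tot 𝒴} (θ : Trivialization τ T)
  (θ' : Trivialization τ T')

/-- The pullback of a trivialization along a morphism. -/
def comp (c : T' ⟶ T) : Trivialization τ T' where
  tr t g := θ.tr (t ≫ c) g
  tr_base _ _ := θ.tr_base _ _
  comp_tr r t g := by rw [θ.comp_tr, Category.assoc]
  tr_tr _ _ _ := θ.tr_tr _ _ _

/-- The morphism `κ` is compatible with trivializations of its source and target. -/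
def Preserves (κ : T ⟶ T') : Prop :=
  ∀ ⦃z : Tot 𝒴⦄ (t : z ⟶ T) (g : z.base ⟶ j.obj v), θ'.tr (t ≫ κ) g = θ.tr t g

variable {θ θ'} in
lemma Preserves.comp {T'' : Tot 𝒴} {θ'' : Trivialization τ T''} {κ : T ⟶ T'} {κ' : T' ⟶ T''}
    (h : θ.Preserves θ' κ) (h' : θ'.Preserves θ'' κ') : θ.Preserves θ'' (κ ≫ κ') := fun z t g => by
  rw [← Category.assoc, h', h]

lemma preserves_id : θ.Preserves θ (𝟙 T) := fun z t g => by rw [Category.comp_id]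

variable {θ θ'} in
lemma tr_comp_eq_tr_comp {x : Tot 𝒴} {c : x ⟶ T} {n : x ⟶ T'} {q : x.base ⟶ j.obj v}
    (h : θ'.tr n q = θ.tr c q) {z : Tot 𝒴} (l : z ⟶ x) (g : z.base ⟶ j.obj v) :
    θ'.tr (l ≫ n) g = θ.tr (l ≫ c) g := by
  rw [← θ'.tr_tr _ (l.base ≫ q), ← θ.tr_tr _ (l.base ≫ q), ← θ'.comp_tr, ← θ.comp_tr, h]

lemma eq_of_tr_eq (h𝒴 : IsGroupoidValued 𝒴) {z : Tot 𝒴} {t t' : z ⟶ T} (hb : t.base = t'.base)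
    (g : z.base ⟶ j.obj v) (h : θ.tr t g = θ.tr t' g) : t = t' := by
  obtain ⟨l, hl, hlt⟩ := Tot.exists_lift h𝒴 (Tot.cart t.base T.fiber) t (𝟙 _) (Category.id_comp _)
  obtain ⟨l', hl', hlt'⟩ := Tot.exists_lift h𝒴 (Tot.cart t.base T.fiber) t' (𝟙 _)
    ((Category.id_comp _).trans hb)
  have htr (k : z ⟶ Tot.mk (pull 𝒴 t.base T.fiber)) (hk : k.base = 𝟙 _) :
      k ≫ θ.tr (Tot.cart t.base T.fiber) g = θ.tr (k ≫ Tot.cart t.base T.fiber) g := by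
    rw [θ.comp_tr, hk]
    exact congrArg (θ.tr _) (Category.id_comp g)
  obtain rfl : l = l' := Tot.hom_ext_of_comp h𝒴 (θ.tr (Tot.cart t.base T.fiber) g)
    (hl.trans hl'.symm) (by rw [htr l hl, htr l' hl', hlt, hlt', h])
  exact hlt.symm.trans hlt'

lemma exists_tr_eq (h𝒴 : IsGroupoidValued 𝒴) {z : Tot 𝒴} (b : z ⟶ Tot.mk (y.fib v))
    (f : z.base ⟶ T.base) : ∃ t : z ⟶ T, t.base = f ∧ θ.tr t b.base = b := by
  obtain ⟨l, hl, hlb⟩ := Tot.exists_lift h𝒴 (θ.tr (Tot.cart f T.fiber) b.base) b (𝟙 _)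
    (by rw [θ.tr_base]; exact Category.id_comp _)
  refine ⟨l ≫ Tot.cart f T.fiber, by rw [Tot.comp_base, hl]; exact Category.id_comp f, ?_⟩
  rw [θ.comp_tr, hl] at hlb
  exact (congrArg (θ.tr _) (Category.id_comp _).symm).trans hlb

lemma eq_of_preserves (hv : IsAtlas W j v) (h𝒴 : HasDescent W 𝒴) {κ κ' : T ⟶ T'}
    (h : θ.Preserves θ' κ) (h' : θ.Preserves θ' κ') (hb : κ.base = κ'.base) : κ = κ' := by
  obtain ⟨w, p, q, hp⟩ := hv.exists_cover T.base
  refine h𝒴.hom_ext (Tot.cart p T.fiber) hp hb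
    (θ'.eq_of_tr_eq h𝒴.isGroupoidValued (congrArg (p ≫ ·) hb) q ?_)
  rw [h, h']

lemma exists_preserves (hW : HasWeakBaseChange W) (hv : IsAtlas W j v) (h𝒴 : HasDescent W 𝒴)
    (f : T.base ⟶ T'.base) : ∃ κ : T ⟶ T', κ.base = f ∧ θ.Preserves θ' κ := by
  have hG := h𝒴.isGroupoidValued
  obtain ⟨w, p, q, hp⟩ := hv.exists_cover T.base
  let c := Tot.cart p T.fiber
  obtain ⟨n, hn, hnc⟩ := θ'.exists_tr_eq hG (θ.tr c q) (p ≫ f)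
  rw [θ.tr_base] at hnc
  have htr {z : Tot 𝒴} (l : z ⟶ _) (g : z.base ⟶ j.obj v) : θ'.tr (l ≫ n) g = θ.tr (l ≫ c) g :=
    tr_comp_eq_tr_comp hnc l g
  obtain ⟨κ, hκ, hcκ⟩ := h𝒴.exists_desc c hp f n hn fun z k₁ k₂ hk => by
    refine θ'.eq_of_tr_eq hG ?_ (k₁.base ≫ q) (by rw [htr, htr, hk])
    have hkb := congrArg (fun t => t.base ≫ f) hk
    simp only [Tot.comp_base, hn, Category.assoc] at hkb ⊢
    exact hkb
  refine ⟨κ, hκ, fun z t g => ?_⟩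
  obtain ⟨x, r, t', hr, hrt⟩ := hW.exists_total hG t c hp
  refine h𝒴.hom_ext r hr (by rw [θ'.tr_base, θ.tr_base]) ?_
  rw [θ'.comp_tr, θ.comp_tr, ← Category.assoc, hrt, Category.assoc, hcκ, htr]

/-- The morphism `b` is the transport of `t : z ⟶ T` computed after pulling back along `m`. -/
def IsTransportVia {a z : Tot 𝒴} (θ₀ : Trivialization τ a) (m : a ⟶ T) (t : z ⟶ T)
    (b : z ⟶ Tot.mk (y.fib v)) : Prop :=
  ∀ ⦃z' : Tot 𝒴⦄ (s : z' ⟶ z) (n : z' ⟶ a), s ≫ t = n ≫ m → s ≫ b = θ₀.tr n (s.base ≫ b.base)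

section Descent

variable (hW : HasWeakBaseChange W) (h𝒴 : HasDescent W 𝒴) {a : Tot 𝒴} {θ₀ : Trivialization τ a}
  {m : a ⟶ T} (hm : W m.base)
include hW h𝒴 hm

lemma eq_of_isTransportVia {z : Tot 𝒴} {t : z ⟶ T} {b b' : z ⟶ Tot.mk (y.fib v)}
    (h : IsTransportVia θ₀ m t b) (h' : IsTransportVia θ₀ m t b') (hb : b.base = b'.base) :
    b = b' := by
  obtain ⟨x, r, t', hr, hrt⟩ := hW.exists_total h𝒴.isGroupoidValued t m hm
  exact h𝒴.hom_ext r hr hb (by rw [h r t' hrt, h' r t' hrt, hb])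

lemma exists_isTransportVia
    (h₀ : ∀ ⦃z : Tot 𝒴⦄ (n₁ n₂ : z ⟶ a), n₁ ≫ m = n₂ ≫ m → ∀ g, θ₀.tr n₁ g = θ₀.tr n₂ g)
    {z : Tot 𝒴} (t : z ⟶ T) (g : z.base ⟶ j.obj v) :
    ∃ b : z ⟶ Tot.mk (y.fib v), b.base = g ∧ IsTransportVia θ₀ m t b := by
  have hG := h𝒴.isGroupoidValued
  obtain ⟨x, r, t', hr, hrt⟩ := hW.exists_total hG t m hm
  obtain ⟨b, rfl, hrb⟩ := h𝒴.exists_desc r hr g (θ₀.tr t' (r.base ≫ g)) (θ₀.tr_base _ _)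
    fun z' k₁ k₂ hk => by
      have hkb : k₁.base ≫ r.base ≫ g = k₂.base ≫ r.base ≫ g := by
        simpa only [Tot.comp_base, Category.assoc] using congrArg (fun l => l.base ≫ g) hk
      rw [θ₀.comp_tr, θ₀.comp_tr, hkb]
      refine h₀ _ _ ?_ _
      rw [Category.assoc, Category.assoc, ← hrt, ← Category.assoc, hk, Category.assoc]
  refine ⟨b, rfl, fun z' s n hsn => ?_⟩
  obtain ⟨x', ρ, r', hρ, hρr⟩ := hW.exists_total hG s r hr
  refine h𝒴.hom_ext ρ hρ (by rw [Tot.comp_base, θ₀.tr_base]) ?_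
  have hρb : r'.base ≫ r.base ≫ b.base = ρ.base ≫ s.base ≫ b.base := by
    simpa only [Tot.comp_base, Category.assoc] using congrArg (fun l => l.base ≫ b.base) hρr.symm
  rw [← Category.assoc, hρr, Category.assoc, hrb, θ₀.comp_tr, θ₀.comp_tr, hρb]
  refine h₀ _ _ ?_ _
  rw [Category.assoc, Category.assoc, ← hrt, ← hsn, ← Category.assoc, ← Category.assoc, hρr]

lemma nonempty_of_cover
    (h₀ : ∀ ⦃z : Tot 𝒴⦄ (n₁ n₂ : z ⟶ a), n₁ ≫ m = n₂ ≫ m → ∀ g, θ₀.tr n₁ g = θ₀.tr n₂ g) :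
    Nonempty (Trivialization τ T) := by
  choose tr hb htr using fun (z : Tot 𝒴) (t : z ⟶ T) (g : z.base ⟶ j.obj v) =>
    exists_isTransportVia hW h𝒴 hm h₀ t g
  refine ⟨⟨tr _, hb _, fun {z z'} r t g => ?_, fun {z} t g g' => ?_⟩⟩
  · refine eq_of_isTransportVia hW h𝒴 hm (fun z'' s n hsn => ?_) (htr _ (r ≫ t) _)
      (by rw [Tot.comp_base, hb, hb])
    rw [← Category.assoc] at hsn ⊢
    rw [htr z t g (s ≫ r) n hsn]
    exact congrArg (θ₀.tr n) (Category.assoc _ _ _)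
  · refine eq_of_isTransportVia hW h𝒴 hm (fun z' s n hsn => ?_) (htr _ t g')
      (by rw [τ.tr_base, hb])
    rw [τ.comp_tr, htr z t g s n hsn, θ₀.tr_tr, τ.tr_base]

end Descent

end Trivialization

namespace TransportSystem

variable {y : Sec j 𝒴} (τ : TransportSystem y v)

lemma exists_gluingDatum (h𝒴 : IsGroupoidValued 𝒴) {w e : C} (p : w ⟶ e) (q : w ⟶ j.obj v) :
    ∃ δ : GluingDatum 𝒴 p (pull 𝒴 q (y.fib v)), ∀ {z : Tot 𝒴} (k : z ⟶ _) (f : z.base ⟶ w) h,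
      δ.tr k f h ≫ Tot.cart q (y.fib v) = τ.tr (k ≫ Tot.cart q (y.fib v)) (f ≫ q) := by
  let c := Tot.cart q (y.fib v)
  choose tr hb htr using fun (z : Tot 𝒴) (k : z ⟶ Tot.mk (pull 𝒴 q (y.fib v))) (f : z.base ⟶ w) =>
    Tot.exists_lift h𝒴 c (τ.tr (k ≫ c) (f ≫ q)) f (τ.tr_base _ _).symm
  refine ⟨⟨fun k f _ => tr _ k f, fun k f _ => hb _ k f, ?_, ?_, ?_⟩, fun k f _ => htr _ k f⟩
  · rintro z' z l k f - k' f' - rfl rfl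
    refine Tot.hom_ext_of_comp h𝒴 c (by rw [hb, Tot.comp_base, hb]) ?_
    rw [Category.assoc, htr, htr, τ.comp_tr, Category.assoc, Category.assoc]
  · intro z k
    refine Tot.hom_ext_of_comp h𝒴 c (hb _ _ _) ?_
    rw [htr]
    exact τ.tr_eq_self _ _ rfl
  · intro z k f f' _ _ _
    refine Tot.hom_ext_of_comp h𝒴 c (by rw [hb, hb]) ?_
    rw [htr, htr, htr, τ.tr_tr]

lemma exists_trivialization (hW : HasWeakBaseChange W) (hv : IsAtlas W j v) (h𝒴 : HasDescent W 𝒴)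
    (e : C) : ∃ x : 𝒴.obj (.mk (op e)), Nonempty (Trivialization τ (Tot.mk x)) := by
  have hG := h𝒴.isGroupoidValued
  obtain ⟨w, p, q, hp⟩ := hv.exists_cover e
  obtain ⟨δ, hδ⟩ := τ.exists_gluingDatum hG p q
  obtain ⟨x, m, rfl, hm⟩ := h𝒴.exists_descent p hp _ δ
  refine ⟨x, Trivialization.nonempty_of_cover hW h𝒴 (m := m)
    (θ₀ := (τ.trivialization v).comp (Tot.cart q (y.fib v))) hp fun z n₁ n₂ hn g => ?_⟩
  have hb : n₁.base ≫ m.base = n₂.base ≫ m.base := congrArg (fun t => t.base) hn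
  have hn₂ : δ.tr n₁ n₂.base hb = n₂ :=
    Tot.hom_ext_of_comp hG m (δ.tr_base _ _ _) ((hm _ _ _).trans hn)
  calc τ.tr (n₁ ≫ Tot.cart q (y.fib v)) g
      = τ.tr (τ.tr (n₁ ≫ Tot.cart q (y.fib v)) (n₂.base ≫ q)) g := (τ.tr_tr _ _ _).symm
    _ = τ.tr (n₂ ≫ Tot.cart q (y.fib v)) g := by rw [← hδ _ _ hb, hn₂]

end TransportSystem

end Trivializations

section Extension

variable {C : Type u₁} [Category.{v₁} C] {A : Type u₂} [Category.{v₂} A]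
  {𝒴 : PreStk.{w, w'} C} {W : MorphismProperty C} {j : A ⥤ C} {v : A}

lemma TransportSystem.exists_extension {y : Sec j 𝒴} (τ : TransportSystem y v)
    (hW : HasWeakBaseChange W) (hv : IsAtlas W j v) (h𝒴 : HasDescent W 𝒴) :
    ∃ s : Sec (𝟭 C) 𝒴, Nonempty ((Sec.pre j (𝟭 C) 𝒴).obj s ⟶ y) := by
  choose x θ using fun e => τ.exists_trivialization hW hv h𝒴 e
  replace θ := fun e => (θ e).some
  choose κ hκ hκθ using fun (e e' : C) (u : e ⟶ e') =>
    (θ e).exists_preserves (θ e') hW hv h𝒴 u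
  choose φ hφ hφθ using fun d : A => (θ (j.obj d)).exists_preserves (τ.trivialization d) hW hv h𝒴
    (𝟙 _)
  refine ⟨⟨x, fun {e e'} => κ e e', fun {e e'} => hκ e e', fun e => ?_, fun {a b c} f g => ?_⟩,
    ⟨⟨φ, hφ, fun {d d'} u => ?_⟩⟩⟩
  · exact (θ e).eq_of_preserves (θ e) hv h𝒴 (hκθ _ _ _) (θ e).preserves_id (hκ _ _ _)
  · exact (θ a).eq_of_preserves (θ c) hv h𝒴 (hκθ _ _ _) ((hκθ _ _ f).comp (hκθ _ _ g))
      (by rw [hκ, Tot.comp_base, hκ, hκ])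
  · have hb : (κ _ _ (j.map u) ≫ φ d').base = (φ d ≫ y.map u).base := by
      rw [Tot.comp_base, Tot.comp_base, hκ, hφ, hφ, y.map_base]
      exact (Category.comp_id _).trans (Category.id_comp _).symm
    exact (θ (j.obj d)).eq_of_preserves (τ.trivialization d') hv h𝒴 ((hκθ _ _ _).comp (hφθ d'))
      ((hφθ d).comp fun z t g => τ.tr_map t u g) hb

namespace Sec

section Hom

variable {y y' : Sec j 𝒴} (φ : y ⟶ y') (hv : IsAtlas W j v) (h𝒴 : HasDescent W 𝒴)

include hv h𝒴 in
lemma Hom.tr_comp_app (τ : TransportSystem y v) (τ' : TransportSystem y' v) {d : A} {z : Tot 𝒴}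
    (t : z ⟶ Tot.mk (y.fib d)) (g : z.base ⟶ j.obj v) :
    τ'.tr (t ≫ φ.app d) g = τ.tr t g ≫ φ.app v := by
  obtain ⟨w, p, q, hpq⟩ := hv.exists_productChart d
  obtain ⟨z', s, n, hs, hn, hb⟩ := hpq.exists_local_factorization h𝒴.isGroupoidValued t g
  have hbase : (τ'.tr (t ≫ φ.app d) g).base = (τ.tr t g ≫ φ.app v).base := by
    rw [τ'.tr_base, Tot.comp_base, τ.tr_base, φ.app_base]
    exact (Category.comp_id g).symm
  have hnb : (n ≫ φ.app w).base ≫ j.map q = s.base ≫ g := by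
    rw [Tot.comp_base, φ.app_base, hb]
    exact congrArg (· ≫ j.map q) (Category.comp_id n.base)
  refine h𝒴.hom_ext s hs hbase ?_
  calc s ≫ τ'.tr (t ≫ φ.app d) g
      = τ'.tr ((n ≫ φ.app w) ≫ y'.map p) ((n ≫ φ.app w).base ≫ j.map q) := by
        rw [τ'.comp_tr, ← Category.assoc, ← hn, Category.assoc, φ.naturality, hnb, Category.assoc]
    _ = (n ≫ y.map q) ≫ φ.app v := by
        rw [τ'.tr_map, τ'.tr_self, Category.assoc, Category.assoc, φ.naturality]
    _ = s ≫ τ.tr t g ≫ φ.app v := by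
        rw [← Category.assoc, τ.comp_tr, ← hn, hb, τ.tr_map, τ.tr_self]

/-- The pushforward of a trivialization along a morphism of sections. -/
def Hom.trivialization {τ : TransportSystem y v} (τ' : TransportSystem y' v) {T : Tot 𝒴}
    (θ : Trivialization τ T) : Trivialization τ' T where
  tr t g := θ.tr t g ≫ φ.app v
  tr_base t g := by
    rw [Tot.comp_base, θ.tr_base, φ.app_base]
    exact Category.comp_id g
  comp_tr r t g := by rw [← Category.assoc, θ.comp_tr]
  tr_tr t g g' := by rw [φ.tr_comp_app hv h𝒴 τ τ', θ.tr_tr]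

end Hom

section Canonical

variable (y : Sec (𝟭 C) 𝒴)

section CartesianLift

variable (hG : IsGroupoidValued 𝒴) {e : C} {z : Tot 𝒴} (t : z ⟶ Tot.mk (y.fib e))
include hG

lemma exists_cartesianLift :
    ∃ l : z ⟶ Tot.mk (y.fib z.base), l.base = 𝟙 _ ∧ l ≫ y.map t.base = t :=
  Tot.exists_lift hG (y.map t.base) t (𝟙 _) (by rw [y.map_base]; exact Category.id_comp _)

/-- The lift of a morphism to a value of a section over the whole base category to a morphism in a
fiber. -/
def cartesianLift : z ⟶ Tot.mk (y.fib z.base) :=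
  (y.exists_cartesianLift hG t).choose

lemma cartesianLift_base : (y.cartesianLift hG t).base = 𝟙 _ :=
  (y.exists_cartesianLift hG t).choose_spec.1

lemma cartesianLift_comp_map : y.cartesianLift hG t ≫ y.map t.base = t :=
  (y.exists_cartesianLift hG t).choose_spec.2

lemma comp_cartesianLift {z' : Tot 𝒴} (r : z' ⟶ z) :
    r ≫ y.cartesianLift hG t = y.cartesianLift hG (r ≫ t) ≫ y.map r.base := by
  refine Tot.hom_ext_of_comp hG (y.map t.base) ?_ ?_
  · rw [Tot.comp_base, Tot.comp_base, cartesianLift_base, cartesianLift_base, y.map_base]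
    exact (Category.comp_id _).trans (Category.id_comp _).symm
  · rw [Category.assoc, cartesianLift_comp_map, Category.assoc, ← y.map_comp]
    exact (y.cartesianLift_comp_map hG (r ≫ t)).symm

lemma cartesianLift_of_comp_map {e' : C} (u : e ⟶ e') :
    y.cartesianLift hG (t ≫ y.map u) = y.cartesianLift hG t := by
  refine Tot.hom_ext_of_comp hG (y.map (t.base ≫ u))
    (by rw [cartesianLift_base, cartesianLift_base]) ?_
  conv_rhs => rw [y.map_comp, ← Category.assoc, cartesianLift_comp_map]
  refine Eq.trans (congrArg (fun b => _ ≫ y.map b) ?_) (y.cartesianLift_comp_map hG (t ≫ y.map u))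
  rw [Tot.comp_base, y.map_base]
  rfl

end CartesianLift

variable {v : A} (hv : IsAtlas W j v) (h𝒴 : HasDescent W 𝒴)
  (τ : TransportSystem ((pre j (𝟭 C) 𝒴).obj y) v)
include hv h𝒴

lemma tr_map_eq_map {e : C} {d : A} (f : e ⟶ j.obj d) (g : e ⟶ j.obj v) :
    τ.tr (d := d) (y.map f) g = y.map g := by
  obtain ⟨w, p, q, hpq⟩ := hv.exists_productChart d
  obtain ⟨e', s, h, hs, hp, hq⟩ := hpq.locallyLifts f g
  refine h𝒴.hom_ext (y.map s) (by rwa [y.map_base]) (by rw [τ.tr_base, y.map_base]; rfl) ?_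
  calc y.map s ≫ τ.tr (d := d) (y.map f) g
      = τ.tr (d := d) (y.map s ≫ y.map f) (s ≫ g) := by rw [τ.comp_tr, y.map_base]; rfl
    _ = τ.tr (d := d) (y.map h ≫ y.map (j.map p)) ((y.map h).base ≫ j.map q) := by
        rw [← y.map_comp, hp, y.map_comp, hq, y.map_base]
        rfl
    _ = y.map h ≫ y.map (j.map q) :=
        (τ.tr_map (d := w) (y.map h) p _).trans (τ.tr_self (d := w) (y.map h) q)
    _ = y.map s ≫ y.map g := by rw [← y.map_comp, ← hq, y.map_comp]

lemma tr_cartesianLift_comp_map {e : C} {d : A} {z : Tot 𝒴} (t : z ⟶ Tot.mk (y.fib e))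
    (f : z.base ⟶ j.obj d) (g : z.base ⟶ j.obj v) :
    τ.tr (d := d) (y.cartesianLift h𝒴.isGroupoidValued t ≫ y.map f) g =
      y.cartesianLift h𝒴.isGroupoidValued t ≫ y.map g := by
  rw [← y.tr_map_eq_map hv h𝒴 τ f g, τ.comp_tr, cartesianLift_base]
  exact congrArg (τ.tr (d := d) _) (Category.id_comp g).symm

/-- The trivializations of the values of a section over the whole base category. -/
def canonicalTrivialization (e : C) : Trivialization τ (Tot.mk (y.fib e)) where
  tr t g := y.cartesianLift h𝒴.isGroupoidValued t ≫ y.map g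
  tr_base t g := by
    rw [Tot.comp_base, cartesianLift_base, y.map_base]
    exact Category.id_comp g
  comp_tr r t g := by rw [← Category.assoc, comp_cartesianLift, Category.assoc, y.map_comp]
  tr_tr t g g' := y.tr_cartesianLift_comp_map hv h𝒴 τ t g g'

lemma canonicalTrivialization_preserves_map {e e' : C} (u : e ⟶ e') :
    (y.canonicalTrivialization hv h𝒴 τ e).Preserves (y.canonicalTrivialization hv h𝒴 τ e')
      (y.map u) :=
  fun _ t g => congrArg (· ≫ y.map g) (y.cartesianLift_of_comp_map h𝒴.isGroupoidValued t u)

lemma canonicalTrivialization_tr (d : A) {z : Tot 𝒴} (t : z ⟶ Tot.mk (y.fib (j.obj d)))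
    (g : z.base ⟶ j.obj v) :
    (y.canonicalTrivialization hv h𝒴 τ (j.obj d)).tr t g = τ.tr (d := d) t g := by
  refine (y.tr_cartesianLift_comp_map hv h𝒴 τ t t.base g).symm.trans ?_
  rw [cartesianLift_comp_map]

end Canonical

lemma pre_faithful (hv : IsAtlas W j v) (h𝒴 : HasDescent W 𝒴) : (pre j (𝟭 C) 𝒴).Faithful where
  map_injective {y y'} φ ψ h := by
    refine hom_ext fun e => ?_
    obtain ⟨w, p, q, hp⟩ := hv.exists_cover e
    have hφψ : φ.app (j.obj v) = ψ.app (j.obj v) := congrArg (fun t => Hom.app t v) h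
    have hw : φ.app w = ψ.app w := by
      refine Tot.hom_ext_of_comp h𝒴.isGroupoidValued (y'.map q)
        ((φ.app_base _).trans (ψ.app_base _).symm) ?_
      rw [← φ.naturality, ← ψ.naturality, hφψ]
    refine h𝒴.hom_ext (y.map p) (by rwa [y.map_base]) ((φ.app_base _).trans (ψ.app_base _).symm) ?_
    rw [φ.naturality, ψ.naturality, hw]

lemma pre_full (hW : HasWeakBaseChange W) (hv : IsAtlas W j v) (h𝒴 : HasDescent W 𝒴) :
    (pre j (𝟭 C) 𝒴).Full where
  map_surjective {y y'} φ := by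
    obtain ⟨τ⟩ := hv.nonempty_transportSystem (j := j) h𝒴 hW ((pre j (𝟭 C) 𝒴).obj y)
    obtain ⟨τ'⟩ := hv.nonempty_transportSystem (j := j) h𝒴 hW ((pre j (𝟭 C) 𝒴).obj y')
    let θ (e : C) := Hom.trivialization φ hv h𝒴 τ' (y.canonicalTrivialization hv h𝒴 τ e)
    let θ' (e : C) := y'.canonicalTrivialization hv h𝒴 τ' e
    choose κ hκ hκθ using fun e => (θ e).exists_preserves (θ' e) hW hv h𝒴 (𝟙 e)
    refine ⟨⟨κ, hκ, fun {a b} u => ?_⟩, hom_ext fun d => ?_⟩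
    · have hθ : (θ a).Preserves (θ b) (y.map u) := fun z t g =>
        congrArg (· ≫ φ.app v) (y.canonicalTrivialization_preserves_map hv h𝒴 τ u t g)
      refine (θ a).eq_of_preserves (θ' b) hv h𝒴 (hθ.comp (hκθ b)) ((hκθ a).comp
        (y'.canonicalTrivialization_preserves_map hv h𝒴 τ' u)) ?_
      rw [Tot.comp_base, Tot.comp_base, hκ, hκ, y.map_base, y'.map_base]
      exact (Category.comp_id _).trans (Category.id_comp _).symm
    · refine (θ (j.obj d)).eq_of_preserves (θ' (j.obj d)) hv h𝒴 (hκθ _) (fun z t g => ?_)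
        ((hκ _).trans (φ.app_base d).symm)
      rw [y'.canonicalTrivialization_tr, φ.tr_comp_app hv h𝒴 τ τ',
        ← y.canonicalTrivialization_tr hv h𝒴]
      rfl

end Sec

lemma IsAtlas.isEquivalence_pre (hW : HasWeakBaseChange W) (hv : IsAtlas W j v)
    (h𝒴 : HasDescent W 𝒴) : (Sec.pre j (𝟭 C) 𝒴).IsEquivalence where
  faithful := Sec.pre_faithful hv h𝒴
  full := Sec.pre_full hW hv h𝒴
  essSurj := ⟨fun y => by
    obtain ⟨τ⟩ := hv.nonempty_transportSystem h𝒴 hW (j := j) y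
    obtain ⟨s, ⟨φ⟩⟩ := τ.exists_extension hW hv h𝒴
    exact ⟨s, ⟨Sec.isoOfHom h𝒴.isGroupoidValued φ⟩⟩⟩

lemma IsAtlas.isEquivalence_pre_forget {𝒳 : PreStk.{w, w'} C} (hW : HasWeakBaseChange W)
    (h𝒳 : IsGroupoidValued 𝒳) (h𝒴 : HasDescent W 𝒴) {k : A ⥤ Tot 𝒳}
    (hv : IsAtlas (W.inverseImage (Pseudofunctor.CoGrothendieck.forget 𝒳)) k v) :
    (Sec.pre k (Pseudofunctor.CoGrothendieck.forget 𝒳) 𝒴).IsEquivalence := by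
  -- Replacing `C` by `Tot 𝒳` and `𝒴` by its restriction reduces to the case where `𝒳` is final.
  let π := Pseudofunctor.CoGrothendieck.forget 𝒳
  have := isEquivalence_secRestrict (𝟭 _) π h𝒴.isGroupoidValued
  have := isEquivalence_secRestrict k π h𝒴.isGroupoidValued
  have := hv.isEquivalence_pre (hW.inverseImage_forget h𝒳) (h𝒴.restrict_forget h𝒳)
  let e : secRestrict (𝟭 _) π 𝒴 ⋙ Sec.pre k π 𝒴 ≅
      Sec.pre k (𝟭 _) (restrict π 𝒴) ⋙ secRestrict k π 𝒴 := Iso.refl _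
  have := Functor.isEquivalence_of_iso e.symm
  exact Functor.isEquivalence_of_comp_left (secRestrict (𝟭 _) π 𝒴) (Sec.pre k π 𝒴)

end Extension

/-! ### Morphisms of presheaves as cartesian sections -/

section Transformations

variable {C : Type u₁} [Category.{v₁} C]

namespace Tot

variable {𝒴 : PreStk.{w, w'} C}

lemma cart_id {S : C} (y : 𝒴.obj (.mk (op S))) : cart (𝟙 S) y = vert (pullId y).inv := by
  have h : vert (pullId y).inv ≫ vert (pullId y).hom = 𝟙 _ := by
    rw [← vert_comp, Iso.inv_hom_id, vert_id]
  rw [← Category.comp_id (vert (pullId y).inv), ← vert_pullId_hom_comp_cart, ← Category.assoc, h]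
  exact (Category.id_comp _).symm

/-- The morphism of a fiber given by a morphism of the total category over an identity. -/
def fiberHom {S : C} {x y : 𝒴.obj (.mk (op S))} (m : mk x ⟶ mk y) (hm : m.base = 𝟙 S) : x ⟶ y :=
  fiberOver m (𝟙 S) hm ≫ (pullId y).inv

@[simp]
lemma vert_fiberHom {S : C} {x y : 𝒴.obj (.mk (op S))} (m : mk x ⟶ mk y) (hm : m.base = 𝟙 S) :
    vert (fiberHom m hm) = m := by
  rw [fiberHom, vert_comp, ← cart_id]
  exact vert_fiberOver_comp_cart m (𝟙 S) hm

lemma pullComp_inv_eq {S T Z : C} (f : T ⟶ S) (g : Z ⟶ T) (y : 𝒴.obj (.mk (op S))) :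
    (pullComp f g (g ≫ f) rfl y).inv =
      (𝒴.mapComp f.op.toLoc g.op.toLoc).hom.toNatTrans.app y :=
  congrArg (fun t => t.hom.toNatTrans.app y) (𝒴.mapComp'_eq_mapComp f.op.toLoc g.op.toLoc)

end Tot

variable {𝓕 𝒢 ℋ : PreStk.{w, w'} C}

/-- The action of a morphism of presheaves on sections. -/
abbrev appObj (η : 𝓕 ⟶ 𝒢) {S : C} (x : 𝓕.obj (.mk (op S))) : 𝒢.obj (.mk (op S)) :=
  (η.app (.mk (op S))).toFunctor.obj x

/-- The naturality constraint of a morphism of presheaves. -/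
def appPull (η : 𝓕 ⟶ 𝒢) {S T : C} (f : T ⟶ S) (x : 𝓕.obj (.mk (op S))) :
    appObj η (pull 𝓕 f x) ≅ pull 𝒢 f (appObj η x) :=
  (Cat.Hom.toNatIso (η.naturality f.op.toLoc)).app x

/-- The morphism of total categories induced by a morphism of presheaves. -/
def totMap (η : 𝓕 ⟶ 𝒢) {a b : Tot 𝓕} (u : a ⟶ b) :
    Tot.mk (appObj η a.fiber) ⟶ Tot.mk (appObj η b.fiber) :=
  (Pseudofunctor.CoGrothendieck.map η).map u

lemma totMap_id (η : 𝓕 ⟶ 𝒢) (a : Tot 𝓕) : totMap η (𝟙 a) = 𝟙 _ :=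
  (Pseudofunctor.CoGrothendieck.map η).map_id a

lemma totMap_comp (η : 𝓕 ⟶ 𝒢) {a b c : Tot 𝓕} (u : a ⟶ b) (u' : b ⟶ c) :
    totMap η (u ≫ u') = totMap η u ≫ totMap η u' :=
  (Pseudofunctor.CoGrothendieck.map η).map_comp u u'

lemma totMap_trans (η : 𝓕 ⟶ 𝒢) (θ : 𝒢 ⟶ ℋ) {a b : Tot 𝓕} (u : a ⟶ b) :
    totMap (η ≫ θ) u = totMap θ (totMap η u) :=
  (Category.comp_id _).symm.trans
    (((Pseudofunctor.CoGrothendieck.mapCompIso η θ).hom.naturality u).trans (Category.id_comp _))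

lemma totMap_eq (η : 𝓕 ⟶ 𝒢) {a b : Tot 𝓕} (u : a ⟶ b) :
    totMap η u = Tot.vert ((η.app (.mk (op a.base))).toFunctor.map (Tot.fiberOver u u.base rfl) ≫
        (appPull η u.base b.fiber).hom) ≫ Tot.cart u.base (appObj η b.fiber) := by
  rw [Tot.vert_comp_cart, Tot.fiberOver, eqToHom_refl, Category.comp_id]
  rfl

lemma map_pullId_comp_appPull (η : 𝓕 ⟶ 𝒢) {S : C} (y : 𝓕.obj (.mk (op S))) :
    (η.app (.mk (op S))).toFunctor.map (Tot.pullId y).hom ≫ (appPull η (𝟙 S) y).hom =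
      (Tot.pullId (appObj η y)).hom :=
  Tot.homMk_injective (a := Tot.mk (appObj η y)) (b := Tot.mk (appObj η y))
    (totMap_id η (Tot.mk y))

lemma totMap_vert (η : 𝓕 ⟶ 𝒢) {S : C} {x y : 𝓕.obj (.mk (op S))} (φ : x ⟶ y) :
    totMap η (Tot.vert φ) = Tot.vert ((η.app (.mk (op S))).toFunctor.map φ) := by
  refine congrArg (fun t => (Tot.homMk (𝟙 S) t : Tot.mk (appObj η x) ⟶ Tot.mk (appObj η y))) ?_
  rw [← map_pullId_comp_appPull, ← Category.assoc, ← Functor.map_comp]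
  rfl

lemma totMap_cart (η : 𝓕 ⟶ 𝒢) {S T : C} (f : T ⟶ S) (x : 𝓕.obj (.mk (op S))) :
    totMap η (Tot.cart f x) = Tot.vert (appPull η f x).hom ≫ Tot.cart f (appObj η x) := by
  rw [Tot.vert_comp_cart]
  refine congrArg (fun t => (Tot.homMk f t : Tot.mk (appObj η (pull 𝓕 f x)) ⟶
    Tot.mk (appObj η x))) ?_
  refine (congrArg (· ≫ _) ((η.app (.mk (op T))).toFunctor.map_id (pull 𝓕 f x))).trans ?_
  exact Category.id_comp _

lemma modification_naturality {η θ : 𝓕 ⟶ 𝒢} (Γ : η ⟶ θ) {S T : C} (f : T ⟶ S)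
    (x : 𝓕.obj (.mk (op S))) :
    (Γ.as.app (.mk (op T))).toNatTrans.app (pull 𝓕 f x) ≫ (appPull θ f x).hom =
      (appPull η f x).hom ≫
        (𝒢.map f.op.toLoc).toFunctor.map ((Γ.as.app (.mk (op S))).toNatTrans.app x) :=
  congrArg (fun t => t.toNatTrans.app x) (Γ.as.naturality f.op.toLoc)

lemma totMap_comp_vert {η θ : 𝓕 ⟶ 𝒢} (Γ : η ⟶ θ) {a b : Tot 𝓕} (u : a ⟶ b) :
    totMap η u ≫ Tot.vert ((Γ.as.app (.mk (op b.base))).toNatTrans.app b.fiber) =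
      Tot.vert ((Γ.as.app (.mk (op a.base))).toNatTrans.app a.fiber) ≫ totMap θ u := by
  rw [totMap_eq, totMap_eq, Category.assoc, ← Tot.vert_map_comp_cart, ← Tot.vert_comp_assoc,
    ← Tot.vert_comp_assoc, Category.assoc, ← modification_naturality, ← Category.assoc,
    ← Category.assoc, NatTrans.naturality]

/-- A morphism of presheaves, seen as a section over the total category. -/
def Sec.ofTrans (η : 𝓕 ⟶ 𝒢) : Sec (Pseudofunctor.CoGrothendieck.forget 𝓕) 𝒢 where
  fib e := appObj η e.fiber
  map u := totMap η u
  map_base _ := rfl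
  map_id e := totMap_id η e
  map_comp f g := totMap_comp η f g

variable (𝓕 𝒢) in
/-- Morphisms of presheaves, seen as sections over the total category. -/
def toSec : (𝓕 ⟶ 𝒢) ⥤ Sec (Pseudofunctor.CoGrothendieck.forget 𝓕) 𝒢 where
  obj := Sec.ofTrans
  map Γ :=
    { app e := Tot.vert ((Γ.as.app (.mk (op e.base))).toNatTrans.app e.fiber)
      app_base _ := rfl
      naturality u := totMap_comp_vert Γ u }
  map_id _ := Sec.hom_ext fun _ => Tot.vert_id _
  map_comp _ _ := Sec.hom_ext fun _ => Tot.vert_comp _ _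

instance : (toSec 𝓕 𝒢).Faithful where
  map_injective {η θ} Γ Γ' h := by
    refine Pseudofunctor.StrongTrans.homCategory.ext fun ⟨⟨S⟩⟩ => ?_
    refine Cat.Hom₂.ext (NatTrans.ext (funext fun x => ?_))
    exact Tot.vert_injective (congrArg (fun t => Sec.Hom.app t (Tot.mk x)) h)

lemma exists_modification {η θ : 𝓕 ⟶ 𝒢}
    (φ : ∀ {S : C} (x : 𝓕.obj (.mk (op S))), Tot.mk (appObj η x) ⟶ Tot.mk (appObj θ x))
    (hφ : ∀ {S : C} (x : 𝓕.obj (.mk (op S))), (φ x).base = 𝟙 S)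
    (hnat : ∀ {a b : Tot 𝓕} (u : a ⟶ b), totMap η u ≫ φ b.fiber = φ a.fiber ≫ totMap θ u) :
    ∃ Γ : η ⟶ θ, ∀ {S : C} (x : 𝓕.obj (.mk (op S))),
      Tot.vert ((Γ.as.app (.mk (op S))).toNatTrans.app x) = φ x := by
  let Γ (S : C) : (η.app (.mk (op S))).toFunctor ⟶ (θ.app (.mk (op S))).toFunctor :=
    { app x := Tot.fiberHom (φ x) (hφ x)
      naturality x y u := by
        apply Tot.vert_injective
        rw [Tot.vert_comp, Tot.vert_comp, Tot.vert_fiberHom, Tot.vert_fiberHom, ← totMap_vert,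
          ← totMap_vert]
        exact hnat (Tot.vert u) }
  have hΓ {S : C} (x : 𝓕.obj (.mk (op S))) : Tot.vert ((Γ S).app x) = φ x := Tot.vert_fiberHom _ _
  have hΓ' {S T : C} (f : T ⟶ S) (x : 𝓕.obj (.mk (op S))) :
      (Γ T).app (pull 𝓕 f x) ≫ (appPull θ f x).hom =
        (appPull η f x).hom ≫ (𝒢.map f.op.toLoc).toFunctor.map ((Γ S).app x) := by
    apply Tot.eq_of_vert_comp_cart
    rw [Tot.vert_comp, Category.assoc, ← totMap_cart, Tot.vert_comp, Category.assoc,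
      Tot.vert_map_comp_cart, ← Category.assoc, ← totMap_cart, hΓ, hΓ]
    exact (hnat (Tot.cart f x)).symm
  refine ⟨⟨{ app := fun ⟨⟨S⟩⟩ => (Γ S).toCatHom₂, naturality := ?_ }⟩, hΓ⟩
  rintro ⟨⟨S⟩⟩ ⟨⟨T⟩⟩ ⟨f⟩
  refine Cat.Hom₂.ext (NatTrans.ext (funext fun x => ?_))
  exact hΓ' f.unop x

instance : (toSec 𝓕 𝒢).Full where
  map_surjective {η θ} φ := by
    obtain ⟨Γ, hΓ⟩ := exists_modification (η := η) (θ := θ) (fun x => φ.app (Tot.mk x))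
      (fun x => φ.app_base _) (fun u => φ.naturality u)
    exact ⟨Γ, Sec.hom_ext fun e => hΓ e.fiber⟩

lemma comp_comp_eq_comp_id_comp {a b c d : C} (p : a ⟶ b) (q : b ⟶ c) (r : c ⟶ d) :
    p ≫ q ≫ r = p ≫ 𝟙 _ ≫ q ≫ 𝟙 _ ≫ r ≫ 𝟙 _ := by
  simp only [Category.id_comp, Category.comp_id]

namespace Sec

section Values

variable {𝓕 : PreStk.{v, u} C} {𝒢 : PreStk.{w, w'} C} (h𝒢 : IsGroupoidValued 𝒢)
  (y : Sec (Pseudofunctor.CoGrothendieck.forget 𝓕) 𝒢)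

/-- The value at `x ∈ 𝓕(S)` of a section over the total category of `𝓕`, in the fiber over `S`
rather than over the unreduced `(forget 𝓕).obj ⟨S, x⟩`. -/
def val {S : C} (x : 𝓕.obj (.mk (op S))) : 𝒢.obj (.mk (op S)) := y.fib (Tot.mk x)

/-- The action of a section on morphisms, with the same unfolding of the base as in `Sec.val`. -/
def valMap {S T : C} {x : 𝓕.obj (.mk (op S))} {x' : 𝓕.obj (.mk (op T))} (u : Tot.mk x ⟶ Tot.mk x') :
    Tot.mk (y.val x) ⟶ Tot.mk (y.val x') := y.map u

lemma valMap_base {S T : C} {x : 𝓕.obj (.mk (op S))} {x' : 𝓕.obj (.mk (op T))}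
    (u : Tot.mk x ⟶ Tot.mk x') : (y.valMap u).base = u.base := y.map_base u

lemma valMap_id {S : C} (x : 𝓕.obj (.mk (op S))) : y.valMap (𝟙 (Tot.mk x)) = 𝟙 _ := y.map_id _

lemma valMap_comp {S T Z : C} {x : 𝓕.obj (.mk (op S))} {x' : 𝓕.obj (.mk (op T))}
    {x'' : 𝓕.obj (.mk (op Z))} (u : Tot.mk x ⟶ Tot.mk x') (u' : Tot.mk x' ⟶ Tot.mk x'') :
    y.valMap (u ≫ u') = y.valMap u ≫ y.valMap u' := y.map_comp _ _

/-- The action of a section on morphisms of a fiber. -/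
def fiberMap {S : C} {x x' : 𝓕.obj (.mk (op S))} (φ : x ⟶ x') : y.val x ⟶ y.val x' :=
  Tot.fiberHom (y.valMap (Tot.vert φ)) ((y.valMap_base _).trans (Tot.vert_base φ))

lemma vert_fiberMap {S : C} {x x' : 𝓕.obj (.mk (op S))} (φ : x ⟶ x') :
    Tot.vert (y.fiberMap φ) = y.valMap (Tot.vert φ) :=
  Tot.vert_fiberHom _ _

/-- The functor between fibers given by a section over the total category. -/
def fiberFunctor (S : C) : 𝓕.obj (.mk (op S)) ⥤ 𝒢.obj (.mk (op S)) where
  obj x := y.val x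
  map φ := y.fiberMap φ
  map_id x := by
    apply Tot.vert_injective
    rw [vert_fiberMap, Tot.vert_id, Tot.vert_id, y.valMap_id]
  map_comp φ ψ := by
    apply Tot.vert_injective
    rw [vert_fiberMap, Tot.vert_comp, Tot.vert_comp, vert_fiberMap, vert_fiberMap, y.valMap_comp]

/-- The comparison between the values of a section and pullbacks. -/
def fiberPull {S T : C} (f : T ⟶ S) (x : 𝓕.obj (.mk (op S))) :
    y.val (pull 𝓕 f x) ⟶ pull 𝒢 f (y.val x) :=
  Tot.fiberOver (y.valMap (Tot.cart f x)) f (y.valMap_base _)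

lemma vert_fiberPull_comp_cart {S T : C} (f : T ⟶ S) (x : 𝓕.obj (.mk (op S))) :
    Tot.vert (y.fiberPull f x) ≫ Tot.cart f (y.val x) = y.valMap (Tot.cart f x) :=
  Tot.vert_fiberOver_comp_cart (y.valMap (Tot.cart f x)) f (y.valMap_base _)

lemma fiberPull_naturality {S T : C} (f : T ⟶ S) {x x' : 𝓕.obj (.mk (op S))} (φ : x ⟶ x') :
    y.fiberMap ((𝓕.map f.op.toLoc).toFunctor.map φ) ≫ y.fiberPull f x' =
      y.fiberPull f x ≫ (𝒢.map f.op.toLoc).toFunctor.map (y.fiberMap φ) := by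
  apply Tot.eq_of_vert_comp_cart
  rw [Tot.vert_comp, Tot.vert_comp, Category.assoc, Category.assoc, vert_fiberPull_comp_cart,
    Tot.vert_map_comp_cart, ← Category.assoc (Tot.vert (y.fiberPull f x)),
    vert_fiberPull_comp_cart, vert_fiberMap, vert_fiberMap, ← y.valMap_comp,
    ← y.valMap_comp, Tot.vert_map_comp_cart]

lemma fiberPull_id {S : C} (x : 𝓕.obj (.mk (op S))) :
    y.fiberPull (𝟙 S) x ≫ (Tot.pullId (y.val x)).inv =
      y.fiberMap (Tot.pullId x).inv := by
  apply Tot.vert_injective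
  rw [Tot.vert_comp, ← Tot.cart_id, vert_fiberPull_comp_cart, Tot.cart_id]
  exact (y.vert_fiberMap _).symm

include h𝒢 in
lemma fiberPull_comp {S T Z : C} (f : T ⟶ S) (g : Z ⟶ T) (x : 𝓕.obj (.mk (op S))) :
    y.fiberPull (g ≫ f) x ≫ (Tot.pullComp f g (g ≫ f) rfl (y.val x)).inv =
      y.fiberMap (Tot.pullComp f g (g ≫ f) rfl x).inv ≫
        y.fiberPull g (pull 𝓕 f x) ≫ (𝒢.map g.op.toLoc).toFunctor.map (y.fiberPull f x) := by
  apply Tot.eq_of_vert_comp_cart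
  refine Tot.hom_ext_of_comp h𝒢 (Tot.cart f (y.val x)) rfl ?_
  simp only [Tot.vert_comp, Category.assoc]
  rw [Tot.vert_pullComp_inv_comp_cart, vert_fiberPull_comp_cart, Tot.vert_map_comp_cart_assoc,
    vert_fiberPull_comp_cart, ← Category.assoc (Tot.vert (y.fiberPull g _)),
    vert_fiberPull_comp_cart, vert_fiberMap, ← y.valMap_comp, ← y.valMap_comp,
    Tot.vert_pullComp_inv_comp_cart]

include h𝒢 in
lemma isIso_fiberPull {S T : C} (f : T ⟶ S) (x : 𝓕.obj (.mk (op S))) : IsIso (y.fiberPull f x) :=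
  have := h𝒢 T
  IsGroupoid.all_isIso _

end Values

variable (h𝒢 : IsGroupoidValued 𝒢) (y : Sec (Pseudofunctor.CoGrothendieck.forget 𝓕) 𝒢)

/-- The components of the morphism of presheaves given by a section. -/
def transApp (S : LocallyDiscrete Cᵒᵖ) : 𝓕.obj S ⟶ 𝒢.obj S :=
  (y.fiberFunctor S.as.unop).toCatHom

/-- The naturality constraints of the morphism of presheaves given by a section. -/
def transNaturality {S T : LocallyDiscrete Cᵒᵖ} (f : S ⟶ T) :
    𝓕.map f ≫ y.transApp T ≅ y.transApp S ≫ 𝒢.map f :=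
  let α : (𝓕.map f).toFunctor ⋙ y.fiberFunctor T.as.unop ≅
      y.fiberFunctor S.as.unop ⋙ (𝒢.map f).toFunctor :=
    NatIso.ofComponents (fun x => @asIso _ _ _ _ _ (y.isIso_fiberPull h𝒢 f.as.unop x))
      (fun φ => y.fiberPull_naturality f.as.unop φ)
  Cat.Hom.isoMk α

/-- The morphism of presheaves given by a section over the total category. -/
def toTrans : 𝓕 ⟶ 𝒢 where
  app := y.transApp
  naturality := y.transNaturality h𝒢
  naturality_naturality {a b f g} φ := by
    obtain rfl := LocallyDiscrete.eq_of_hom φ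
    obtain rfl : φ = 𝟙 _ := Subsingleton.elim _ _
    rw [PrelaxFunctor.map₂_id, PrelaxFunctor.map₂_id, Bicategory.id_whiskerRight,
      Bicategory.whiskerLeft_id, Category.id_comp, Category.comp_id]
  naturality_id := by
    rintro ⟨⟨S⟩⟩
    refine Cat.Hom₂.ext (NatTrans.ext (funext fun x => ?_))
    refine (y.fiberPull_id x).trans ?_
    exact (Category.comp_id _).symm.trans (congrArg (_ ≫ ·) (Category.comp_id _).symm)
  naturality_comp := by
    rintro ⟨⟨S⟩⟩ ⟨⟨T⟩⟩ ⟨⟨Z⟩⟩ ⟨f⟩ ⟨g⟩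
    refine Cat.Hom₂.ext (NatTrans.ext (funext fun x => ?_))
    have h := y.fiberPull_comp h𝒢 f.unop g.unop x
    rw [Tot.pullComp_inv_eq, Tot.pullComp_inv_eq] at h
    exact h.trans (comp_comp_eq_comp_id_comp _ _ _)

lemma totMap_toTrans {a b : Tot 𝓕} (u : a ⟶ b) : totMap (y.toTrans h𝒢) u = y.map u := by
  have h : Tot.vert (y.fiberMap (Tot.fiberOver u u.base rfl)) ≫
      Tot.vert (y.fiberPull u.base b.fiber) ≫ Tot.cart u.base (y.val b.fiber) = y.map u := by
    rw [vert_fiberMap, vert_fiberPull_comp_cart, ← y.valMap_comp, Tot.vert_fiberOver_comp_cart]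
    rfl
  refine (totMap_eq _ u).trans (Eq.trans ?_ h)
  rw [Tot.vert_comp, Category.assoc]
  rfl

end Sec

lemma isEquivalence_toSec (h𝒢 : IsGroupoidValued 𝒢) : (toSec 𝓕 𝒢).IsEquivalence where
  essSurj := ⟨fun y => ⟨y.toTrans h𝒢, ⟨Sec.isoOfHom h𝒢
    { app := fun _ => 𝟙 _
      app_base := fun _ => rfl
      naturality := fun u => (Category.comp_id _).trans
        ((y.totMap_toTrans h𝒢 u).trans (Category.id_comp _).symm) }⟩⟩⟩

end Transformations

section RestrictionOfTransformations

variable {C : Type u₁} [Category.{v₁} C] {D : Type u₂} [Category.{v₂} D] {ι : D ⥤ C}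
  {𝒳 𝒴 : PreStk.{w, w'} C}

/-- The identification of sections over total categories with morphisms of presheaves is compatible
with restriction along `ι`. -/
def toSecCompPre (ι : D ⥤ C) (𝒳 𝒴 : PreStk.{w, w'} C) :
    toSec 𝒳 𝒴 ⋙ Sec.pre (totRestrict ι 𝒳) (Pseudofunctor.CoGrothendieck.forget 𝒳) 𝒴 ≅
      restrictMor ι 𝒳 𝒴 ⋙ toSec (restrict ι 𝒳) (restrict ι 𝒴) ⋙
        secRestrict (Pseudofunctor.CoGrothendieck.forget (restrict ι 𝒳)) ι 𝒴 :=
  NatIso.ofComponents (fun η => Iso.refl _) (fun {η θ} Γ => by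
    refine (Category.comp_id _).trans (Eq.trans ?_ (Category.id_comp _).symm)
    refine Sec.hom_ext fun e => ?_
    exact (totRestrictHom_vert (ι := ι) (S := e.base)
      ((Γ.as.app (.mk (op (ι.obj e.base)))).toNatTrans.app e.fiber)).symm)

theorem isEquivalence_restrictMor {W : MorphismProperty C} (hW : HasWeakBaseChange W)
    (h𝒳 : IsGroupoidValued 𝒳) (h𝒴 : HasDescent W 𝒴) {v : Tot (restrict ι 𝒳)}
    (hv : IsAtlas (W.inverseImage (Pseudofunctor.CoGrothendieck.forget 𝒳)) (totRestrict ι 𝒳) v) :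
    (restrictMor ι 𝒳 𝒴).IsEquivalence := by
  have h𝒴' := h𝒴.isGroupoidValued
  have : (toSec 𝒳 𝒴).IsEquivalence := isEquivalence_toSec h𝒴'
  have : (toSec (restrict ι 𝒳) (restrict ι 𝒴)).IsEquivalence :=
    isEquivalence_toSec fun S => h𝒴' (ι.obj S)
  have : (Sec.pre (totRestrict ι 𝒳) (Pseudofunctor.CoGrothendieck.forget 𝒳) 𝒴).IsEquivalence :=
    hv.isEquivalence_pre_forget hW h𝒳 h𝒴
  have hpre : (toSec 𝒳 𝒴 ⋙ Sec.pre (totRestrict ι 𝒳)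
      (Pseudofunctor.CoGrothendieck.forget 𝒳) 𝒴).IsEquivalence := inferInstance
  have := isEquivalence_secRestrict (Pseudofunctor.CoGrothendieck.forget (restrict ι 𝒳)) ι h𝒴'
  have : (restrictMor ι 𝒳 𝒴 ⋙ toSec (restrict ι 𝒳) (restrict ι 𝒴) ⋙
      secRestrict (Pseudofunctor.CoGrothendieck.forget (restrict ι 𝒳)) ι 𝒴).IsEquivalence :=
    @Functor.isEquivalence_of_iso _ _ _ _ _ _ (toSecCompPre ι 𝒳 𝒴) hpre
  exact Functor.isEquivalence_of_comp_right _ (toSec (restrict ι 𝒳) (restrict ι 𝒴) ⋙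
    secRestrict (Pseudofunctor.CoGrothendieck.forget (restrict ι 𝒳)) ι 𝒴)

end RestrictionOfTransformations

/-! ### Left Kan extensions -/

section FreeStack

variable {C : Type u₁} [Category.{v₁} C] {B : Type u₂} [Category.{v₂} B]

lemma freeGroupoid_naturality {G : Type u₃} [Category.{v₃} G] [IsGroupoid G]
    (F F' : FreeGroupoid B ⥤ G)
    (τ : ∀ X : B, F.obj (FreeGroupoid.mk X) ⟶ F'.obj (FreeGroupoid.mk X))
    (hτ : ∀ {X Y : B} (f : X ⟶ Y),
      F.map (FreeGroupoid.homMk f) ≫ τ Y = τ X ≫ F'.map (FreeGroupoid.homMk f))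
    {X Y : B} (m : FreeGroupoid.mk X ⟶ FreeGroupoid.mk Y) : F.map m ≫ τ Y = τ X ≫ F'.map m := by
  let _ : Groupoid G := Groupoid.ofIsGroupoid
  have (X : B) : IsIso (τ X) := IsGroupoid.all_isIso _
  have h := (FreeGroupoid.liftNatIso F F'
    (NatIso.ofComponents (fun X => asIso (τ X)) hτ)).hom.naturality m
  rwa [FreeGroupoid.liftNatIso_hom_app, FreeGroupoid.liftNatIso_hom_app] at h

/-- The strict presheaf of groupoids freely generated by `p : B ⥤ C`: its value at `T` is the free
groupoid on the category of morphisms `T ⟶ p.obj e`. -/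
def freeFunctor (p : B ⥤ C) : Cᵒᵖ ⥤ Cat.{max u₂ v₁ v₂, max u₂ v₁} where
  obj T := Cat.of (FreeGroupoid (StructuredArrow T.unop p))
  map g := (FreeGroupoid.map (StructuredArrow.map g.unop)).toCatHom
  map_id T := by
    have h : StructuredArrow.map (T := p) (𝟙 T.unop) = 𝟭 _ :=
      CategoryTheory.Functor.ext (fun _ => StructuredArrow.map_id) fun _ _ f => by ext; simp
    exact Cat.ext ((congrArg FreeGroupoid.map h).trans (FreeGroupoid.map_id _))
  map_comp g g' := by
    have h : StructuredArrow.map (T := p) (g'.unop ≫ g.unop) =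
        StructuredArrow.map g.unop ⋙ StructuredArrow.map g'.unop :=
      CategoryTheory.Functor.ext (fun _ => StructuredArrow.map_comp) fun _ _ f => by ext; simp
    exact Cat.ext ((congrArg FreeGroupoid.map h).trans (FreeGroupoid.map_comp _ _))

/-- The presheaf of groupoids freely generated by `p : B ⥤ C`. -/
def freeStk (p : B ⥤ C) : PreStk.{max u₂ v₁ v₂, max u₂ v₁} C := (freeFunctor p).toPseudofunctor'

namespace freeStk

variable {p : B ⥤ C}

variable (p) in
lemma isGroupoidValued : IsGroupoidValued (freeStk p) := fun S =>
  inferInstanceAs (IsGroupoid (FreeGroupoid (StructuredArrow S p)))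

/-- The object of the free groupoid given by a morphism to a value of `p`. -/
def pt {T : C} (a : StructuredArrow T p) : (freeStk p).obj (.mk (op T)) := FreeGroupoid.mk a

/-- The generating morphisms of the free groupoid. -/
def ptMap {T : C} {a b : StructuredArrow T p} (φ : a ⟶ b) : pt a ⟶ pt b := FreeGroupoid.homMk φ

/-- The morphism to a value of `p` underlying an object of the free groupoid. -/
def arr {T : C} (x : (freeStk p).obj (.mk (op T))) : StructuredArrow T p :=
  (show FreeGroupoid (StructuredArrow T p) from x).as.as

lemma ptMap_id {T : C} (a : StructuredArrow T p) : ptMap (𝟙 a) = 𝟙 _ :=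
  (FreeGroupoid.of _).map_id a

lemma ptMap_comp {T : C} {a b c : StructuredArrow T p} (φ : a ⟶ b) (ψ : b ⟶ c) :
    ptMap (φ ≫ ψ) = ptMap φ ≫ ptMap ψ := (FreeGroupoid.of _).map_comp φ ψ

lemma ptMap_eqToHom {T : C} {a b : StructuredArrow T p} (h : a = b) :
    ptMap (eqToHom h) = eqToHom (congrArg pt h) := eqToHom_map (FreeGroupoid.of _) h

lemma naturality_of_ptMap {T : C} {G : Type u₃} [Category.{v₃} G] [IsGroupoid G]
    (F F' : (freeStk p).obj (.mk (op T)) ⥤ G)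
    (τ : ∀ a : StructuredArrow T p, F.obj (pt a) ⟶ F'.obj (pt a))
    (hτ : ∀ {a b : StructuredArrow T p} (φ : a ⟶ b),
      F.map (ptMap φ) ≫ τ b = τ a ≫ F'.map (ptMap φ))
    {a b : StructuredArrow T p} (m : pt a ⟶ pt b) : F.map m ≫ τ b = τ a ≫ F'.map m :=
  freeGroupoid_naturality F F' τ hτ m

lemma mapId_inv_app {T : C} (a : StructuredArrow T p) :
    ((freeStk p).mapId (.mk (op T))).inv.toNatTrans.app (pt a) =
      ptMap (eqToHom StructuredArrow.map_id.symm) :=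
  (Cat.eqToHom_app _ _ ((freeFunctor p).map_id (op T)).symm _).trans (ptMap_eqToHom _).symm

lemma mapComp_inv_app {T T' T'' : C} (g : T' ⟶ T) (g' : T'' ⟶ T') (a : StructuredArrow T p) :
    ((freeStk p).mapComp g.op.toLoc g'.op.toLoc).inv.toNatTrans.app (pt a) =
      ptMap (eqToHom StructuredArrow.map_comp.symm) :=
  (Cat.eqToHom_app _ _ ((freeFunctor p).map_comp g.op g'.op).symm _).trans (ptMap_eqToHom _).symm

/-- The generating morphisms of the total category: every morphism is the composition of one with a
morphism of a fiber, see `freeStk.vert_fiberHom_comp_genCart`. -/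
def gen {T T' : C} {a : StructuredArrow T' p} {b : StructuredArrow T p} (g : T' ⟶ T)
    (u : a.right ⟶ b.right) (w : a.hom ≫ p.map u = g ≫ b.hom) : Tot.mk (pt a) ⟶ Tot.mk (pt b) :=
  Tot.homMk g (ptMap (b := (StructuredArrow.map g).obj b) (StructuredArrow.homMk u w))

lemma gen_congr {T T' : C} {a : StructuredArrow T' p} {b : StructuredArrow T p} {g g' : T' ⟶ T}
    {u u' : a.right ⟶ b.right} (w : a.hom ≫ p.map u = g ≫ b.hom) (hg : g = g') (hu : u = u') :
    gen g u w = gen g' u' (by rw [← hg, ← hu, w]) := by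
  subst hg hu; rfl

lemma gen_id {T : C} (a : StructuredArrow T p) (w : a.hom ≫ p.map (𝟙 _) = 𝟙 T ≫ a.hom) :
    gen (𝟙 T) (𝟙 _) w = 𝟙 (Tot.mk (pt a)) := by
  refine congrArg (Tot.homMk (a := Tot.mk (pt a)) (b := Tot.mk (pt a)) (𝟙 T)) ?_
  refine Eq.trans ?_ (mapId_inv_app a).symm
  have h : (eqToHom (StructuredArrow.map_id (f := a)).symm).right = 𝟙 a.right :=
    StructuredArrow.eqToHom_right _
  exact congrArg ptMap (StructuredArrow.hom_ext _ _ h.symm)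

lemma gen_comp {T T' T'' : C} {a : StructuredArrow T'' p} {b : StructuredArrow T' p}
    {c : StructuredArrow T p} (g : T'' ⟶ T') (g' : T' ⟶ T) (u : a.right ⟶ b.right)
    (u' : b.right ⟶ c.right) (w : a.hom ≫ p.map u = g ≫ b.hom)
    (w' : b.hom ≫ p.map u' = g' ≫ c.hom) :
    gen g u w ≫ gen g' u' w' = gen (g ≫ g') (u ≫ u') (by
      rw [p.map_comp, ← Category.assoc, w, Category.assoc, w', Category.assoc]) := by
  refine congrArg (Tot.homMk (a := Tot.mk (pt a)) (b := Tot.mk (pt c)) (g ≫ g')) ?_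
  let φ : a ⟶ (StructuredArrow.map g).obj b := StructuredArrow.homMk u w
  let φ' : b ⟶ (StructuredArrow.map g').obj c := StructuredArrow.homMk u' w'
  refine (congrArg (ptMap φ ≫ ptMap ((StructuredArrow.map g).map φ') ≫ ·)
    (mapComp_inv_app g' g c)).trans ?_
  refine (congrArg (ptMap φ ≫ ·) (ptMap_comp _ _).symm).trans ((ptMap_comp _ _).symm.trans ?_)
  refine congrArg ptMap (StructuredArrow.hom_ext _ _ (congrArg (u ≫ ·) ?_))
  have h : (eqToHom (StructuredArrow.map_comp (f := g) (f' := g') (h := c)).symm).right =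
      𝟙 c.right := StructuredArrow.eqToHom_right _
  exact (congrArg (u' ≫ ·) h).trans (Category.comp_id u')

lemma vert_ptMap {T : C} {a b : StructuredArrow T p} (φ : a ⟶ b) :
    Tot.vert (ptMap φ) = gen (𝟙 T) φ.right
      ((StructuredArrow.w φ).trans (Category.id_comp b.hom).symm) := by
  refine congrArg (Tot.homMk (a := Tot.mk (pt a)) (b := Tot.mk (pt b)) (𝟙 T)) ?_
  refine (congrArg (ptMap φ ≫ ·) (mapId_inv_app b)).trans ?_
  refine (ptMap_comp _ _).symm.trans ?_
  refine congrArg ptMap (StructuredArrow.hom_ext _ _ ?_)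
  exact (congrArg (φ.right ≫ ·) (StructuredArrow.eqToHom_right _)).trans (Category.comp_id _)

/-- The fiber component of a morphism of the total category. -/
def fiberHom {T T' : C} {a : StructuredArrow T' p} {b : StructuredArrow T p}
    (m : Tot.mk (pt a) ⟶ Tot.mk (pt b)) : pt a ⟶ pt ((StructuredArrow.map m.base).obj b) := m.fiber

/-- The canonical morphism from the pullback of a morphism to a value of `p`. -/
def genCart {T T' : C} (g : T' ⟶ T) (b : StructuredArrow T p) :
    Tot.mk (pt ((StructuredArrow.map g).obj b)) ⟶ Tot.mk (pt b) :=
  gen (a := (StructuredArrow.map g).obj b) g (𝟙 b.right)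
    ((congrArg ((g ≫ b.hom) ≫ ·) (p.map_id b.right)).trans (Category.comp_id _))

lemma vert_fiberHom_comp_genCart {T T' : C} {a : StructuredArrow T' p} {b : StructuredArrow T p}
    (m : Tot.mk (pt a) ⟶ Tot.mk (pt b)) : Tot.vert (fiberHom m) ≫ genCart m.base b = m := by
  refine (Tot.vert_comp_homMk (b := Tot.mk (pt b)) (fiberHom m) m.base _).trans ?_
  refine congrArg (Tot.homMk m.base) ((congrArg (m.fiber ≫ ·) ?_).trans (Category.comp_id _))
  exact ptMap_id ((StructuredArrow.map m.base).obj b)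

variable (p) in
/-- The identity of a value of `p`. -/
abbrev self (e : B) : StructuredArrow (p.obj e) p := StructuredArrow.mk (𝟙 (p.obj e))

/-- The action on morphisms of the tautological section. -/
def genSelf {e e' : B} (u : e ⟶ e') : Tot.mk (pt (self p e)) ⟶ Tot.mk (pt (self p e')) :=
  gen (p.map u) u ((Category.id_comp _).trans (Category.comp_id _).symm)

variable (p) in
/-- The tautological section over `p` of the presheaf of groupoids freely generated by `p`. -/
def taut : Sec p (freeStk p) where
  fib e := pt (self p e)
  map u := genSelf u
  map_base _ := rfl
  map_id e := (gen_congr _ (p.map_id e) rfl).trans (gen_id (self p e)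
    ((congrArg (𝟙 _ ≫ ·) (p.map_id e)).trans rfl))
  map_comp {a b c} u u' := (gen_congr _ (p.map_comp u u') rfl).trans
    (gen_comp (a := self p a) (b := self p b) (c := self p c) (p.map u) (p.map u') u u' _ _).symm

/-- The morphism from a generating object to the value of the tautological section it comes from. -/
def toTaut {T : C} (a : StructuredArrow T p) : Tot.mk (pt a) ⟶ Tot.mk (pt (self p a.right)) :=
  gen a.hom (𝟙 a.right) (congrArg (a.hom ≫ ·) (p.map_id a.right))

lemma toTaut_self (e : B) : toTaut (self p e) = 𝟙 _ := gen_id _ _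

lemma gen_comp_toTaut {T T' : C} {a : StructuredArrow T' p} {b : StructuredArrow T p} (g : T' ⟶ T)
    (u : a.right ⟶ b.right) (w : a.hom ≫ p.map u = g ≫ b.hom) :
    gen g u w ≫ toTaut b = toTaut a ≫ genSelf u := by
  refine (gen_comp (c := self p b.right) g b.hom u (𝟙 b.right) _ _).trans (Eq.trans ?_
    (gen_comp (b := self p a.right) (c := self p b.right) a.hom (p.map u) (𝟙 a.right) u
      _ _).symm)
  exact gen_congr _ w.symm ((Category.comp_id u).trans (Category.id_comp u).symm)

end freeStk

namespace Sec

variable {p : B ⥤ C} {𝒦 : PreStk.{v, u} C} {𝒢 : PreStk.{w, w'} C}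

/-- The composition of a section of `𝒦` with sections over the total category of `𝒦`. -/
def preSec (t : Sec p 𝒦) (𝒢 : PreStk.{w, w'} C) :
    Sec (Pseudofunctor.CoGrothendieck.forget 𝒦) 𝒢 ⥤ Sec p 𝒢 where
  obj y :=
    { fib e := y.fib (Tot.mk (t.fib e))
      map u := y.map (t.map u)
      map_base u := (y.map_base _).trans (t.map_base u)
      map_id e := (congrArg y.map (t.map_id e)).trans (y.map_id _)
      map_comp u u' := (congrArg y.map (t.map_comp u u')).trans (y.map_comp _ _) }
  map φ :=
    { app e := φ.app (Tot.mk (t.fib e))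
      app_base e := φ.app_base _
      naturality u := φ.naturality _ }

/-- Isomorphic sections have isomorphic compositions. -/
def preSecIso (h𝒢 : IsGroupoidValued 𝒢) {t t' : Sec p 𝒦} (ψ : t ⟶ t') :
    preSec t 𝒢 ≅ preSec t' 𝒢 :=
  NatIso.ofComponents (fun y => isoOfHom h𝒢
    { app e := y.map (ψ.app e)
      app_base e := (y.map_base _).trans (ψ.app_base e)
      naturality u := (y.map_comp _ _).symm.trans
        ((congrArg y.map (ψ.naturality u)).trans (y.map_comp _ _)) })
    (fun φ => hom_ext fun e => (φ.naturality (ψ.app e)).symm)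

end Sec

namespace freeStk

variable {p : B ⥤ C} {𝒢 : PreStk.{w, w'} C}

section FullyFaithful

variable (h𝒢 : IsGroupoidValued 𝒢)

include h𝒢 in
lemma faithful_preSec_taut : (Sec.preSec (taut p) 𝒢).Faithful where
  map_injective {y y'} φ ψ h := by
    have app_eq {T : C} (a : StructuredArrow T p) :
        φ.app (Tot.mk (pt a)) = ψ.app (Tot.mk (pt a)) := by
      refine Tot.hom_ext_of_comp h𝒢 (y'.map (toTaut a))
        ((φ.app_base _).trans (ψ.app_base _).symm) ?_
      rw [← φ.naturality, ← ψ.naturality]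
      exact congrArg (y.map (toTaut a) ≫ ·) (congrArg (fun t => Sec.Hom.app t a.right) h)
    exact Sec.hom_ext fun e => app_eq (arr e.fiber)

variable {y y' : Sec (Pseudofunctor.CoGrothendieck.forget (freeStk p)) 𝒢}
  (m : (Sec.preSec (taut p) 𝒢).obj y ⟶ (Sec.preSec (taut p) 𝒢).obj y')

/-- The components of `m`, with the same unfolding of the base as in `Sec.val`. -/
def tautApp (e : B) : Tot.mk (y.val (pt (self p e))) ⟶ Tot.mk (y'.val (pt (self p e))) := m.app e

lemma tautApp_base (e : B) : (tautApp m e).base = 𝟙 _ := m.app_base e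

include h𝒢 in
lemma exists_comp_toTaut {T : C} (a : StructuredArrow T p) :
    ∃ α : Tot.mk (y.val (pt a)) ⟶ Tot.mk (y'.val (pt a)), α.base = 𝟙 T ∧
      α ≫ y'.valMap (toTaut a) = y.valMap (toTaut a) ≫ tautApp m a.right := by
  refine Tot.exists_lift (a := Tot.mk (y.val (pt a))) h𝒢 (y'.valMap (toTaut a))
    (y.valMap (toTaut a) ≫ tautApp m a.right) (𝟙 T) ?_
  rw [Tot.comp_base, y.valMap_base, y'.valMap_base, tautApp_base]
  exact (Category.id_comp _).trans (Category.comp_id _).symm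

/-- The extension to the generating objects of a morphism between the restrictions of `y` and `y'`
along the tautological section. -/
def extendApp {T : C} (a : StructuredArrow T p) : y.val (pt a) ⟶ y'.val (pt a) :=
  Tot.fiberHom (exists_comp_toTaut h𝒢 m a).choose (exists_comp_toTaut h𝒢 m a).choose_spec.1

lemma vert_extendApp_comp_toTaut {T : C} (a : StructuredArrow T p) :
    Tot.vert (extendApp h𝒢 m a) ≫ y'.valMap (toTaut a) =
      y.valMap (toTaut a) ≫ tautApp m a.right := by
  rw [extendApp, Tot.vert_fiberHom]
  exact (exists_comp_toTaut h𝒢 m a).choose_spec.2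

lemma vert_extendApp_self (e : B) : Tot.vert (extendApp h𝒢 m (self p e)) = tautApp m e := by
  have h := vert_extendApp_comp_toTaut h𝒢 m (self p e)
  rw [toTaut_self] at h
  refine (Category.comp_id _).symm.trans ((congrArg (_ ≫ ·) (y'.valMap_id _)).symm.trans ?_)
  exact h.trans ((congrArg (· ≫ tautApp m e) (y.valMap_id _)).trans (Category.id_comp _))

lemma extendApp_naturality_gen {T T' : C} {a : StructuredArrow T' p} {b : StructuredArrow T p}
    (g : T' ⟶ T) (u : a.right ⟶ b.right) (w : a.hom ≫ p.map u = g ≫ b.hom) :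
    y.valMap (gen g u w) ≫ Tot.vert (extendApp h𝒢 m b) =
      Tot.vert (extendApp h𝒢 m a) ≫ y'.valMap (gen g u w) := by
  refine Tot.hom_ext_of_comp h𝒢 (y'.valMap (toTaut b)) ?_ ?_
  · rw [Tot.comp_base, Tot.comp_base, y.valMap_base, y'.valMap_base]
    exact (Category.comp_id _).trans (Category.id_comp _).symm
  · have hm : y.valMap (genSelf u) ≫ tautApp m b.right =
        tautApp m a.right ≫ y'.valMap (genSelf u) := m.naturality u
    rw [Category.assoc, Category.assoc, vert_extendApp_comp_toTaut, ← y'.valMap_comp,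
      gen_comp_toTaut, y'.valMap_comp, ← Category.assoc (Tot.vert (extendApp h𝒢 m a)),
      vert_extendApp_comp_toTaut, Category.assoc, ← hm, ← Category.assoc, ← Category.assoc,
      ← y.valMap_comp, ← y.valMap_comp, gen_comp_toTaut]

lemma extendApp_naturality_fiber {T : C} {a b : StructuredArrow T p} (β : pt a ⟶ pt b) :
    y.fiberMap β ≫ extendApp h𝒢 m b = extendApp h𝒢 m a ≫ y'.fiberMap β := by
  have := h𝒢 T
  refine naturality_of_ptMap (y.fiberFunctor T) (y'.fiberFunctor T) (extendApp h𝒢 m)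
    (fun {a b} φ => Tot.vert_injective ?_) β
  have h := extendApp_naturality_gen h𝒢 m (𝟙 T) φ.right
    ((StructuredArrow.w φ).trans (Category.id_comp b.hom).symm)
  rw [← vert_ptMap, ← y.vert_fiberMap, ← y'.vert_fiberMap] at h
  exact (Tot.vert_comp _ _).trans (h.trans (Tot.vert_comp _ _).symm)

lemma extendApp_naturality {T T' : C} {a : StructuredArrow T' p} {b : StructuredArrow T p}
    (n : Tot.mk (pt a) ⟶ Tot.mk (pt b)) :
    y.valMap n ≫ Tot.vert (extendApp h𝒢 m b) = Tot.vert (extendApp h𝒢 m a) ≫ y'.valMap n := by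
  have hcart : y.valMap (genCart n.base b) ≫ Tot.vert (extendApp h𝒢 m b) =
      Tot.vert (extendApp h𝒢 m ((StructuredArrow.map n.base).obj b)) ≫
        y'.valMap (genCart n.base b) := extendApp_naturality_gen h𝒢 m _ _ _
  rw [← vert_fiberHom_comp_genCart n, y.valMap_comp, y'.valMap_comp, Category.assoc, hcart,
    ← y.vert_fiberMap, ← y'.vert_fiberMap, ← Category.assoc, ← Category.assoc, ← Tot.vert_comp,
    ← Tot.vert_comp, extendApp_naturality_fiber]

include h𝒢 in
lemma full_preSec_taut : (Sec.preSec (taut p) 𝒢).Full where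
  map_surjective m :=
    ⟨{ app := fun e => Tot.vert (extendApp h𝒢 m (arr e.fiber))
       app_base := fun _ => rfl
       naturality := fun {e e'} n =>
        extendApp_naturality h𝒢 m (a := arr e.fiber) (b := arr e'.fiber) n },
      Sec.hom_ext fun e => vert_extendApp_self h𝒢 m e⟩

end FullyFaithful

end freeStk

end FreeStack
section Extension

variable {C : Type u₁} [Category.{v₁} C] {B : Type u₂} [Category.{v₂} B] {p : B ⥤ C}
  {𝒢 : PreStk.{w, w'} C}

namespace Sec

variable (s : Sec p 𝒢)

/-- The pullback of the value of a section along a morphism to a value of `p`. -/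
def arrObj {T : C} (a : StructuredArrow T p) : 𝒢.obj (.mk (op T)) := pull 𝒢 a.hom (s.fib a.right)

/-- The canonical morphism to the value of a section. -/
def arrCart {T : C} (a : StructuredArrow T p) : Tot.mk (s.arrObj a) ⟶ Tot.mk (s.fib a.right) :=
  Tot.cart a.hom (s.fib a.right)

/-- The action on morphisms of the pullback of the values of a section. -/
def arrMap {T : C} {a b : StructuredArrow T p} (φ : a ⟶ b) : s.arrObj a ⟶ s.arrObj b :=
  Tot.fiberOver (b := Tot.mk (s.fib b.right)) (s.arrCart a ≫ s.map φ.right) b.hom (by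
    rw [Tot.comp_base, s.map_base]
    exact φ.w)

lemma vert_arrMap_comp_arrCart {T : C} {a b : StructuredArrow T p} (φ : a ⟶ b) :
    Tot.vert (s.arrMap φ) ≫ s.arrCart b = s.arrCart a ≫ s.map φ.right :=
  Tot.vert_fiberOver_comp_cart _ _ _

lemma eq_of_vert_comp_arrCart {T : C} {x : 𝒢.obj (.mk (op T))} {b : StructuredArrow T p}
    {φ ψ : x ⟶ s.arrObj b} (h : Tot.vert φ ≫ s.arrCart b = Tot.vert ψ ≫ s.arrCart b) : φ = ψ :=
  Tot.eq_of_vert_comp_cart h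

/-- The pullbacks of the values of a section, as a functor. -/
def arrFunctor (T : C) : StructuredArrow T p ⥤ 𝒢.obj (.mk (op T)) where
  obj a := s.arrObj a
  map φ := s.arrMap φ
  map_id a := by
    apply s.eq_of_vert_comp_arrCart
    rw [vert_arrMap_comp_arrCart, StructuredArrow.id_right, s.map_id, Category.comp_id, Tot.vert_id,
      Category.id_comp]
  map_comp φ ψ := by
    apply s.eq_of_vert_comp_arrCart
    rw [vert_arrMap_comp_arrCart, StructuredArrow.comp_right, s.map_comp, Tot.vert_comp,
      Category.assoc, vert_arrMap_comp_arrCart, ← Category.assoc, ← Category.assoc,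
      vert_arrMap_comp_arrCart]

/-- The comparison of `Sec.arrObj` at a composition `g ≫ b.hom` with the pullback along `g`. -/
def arrPull {T T' : C} (g : T' ⟶ T) (b : StructuredArrow T p) :
    s.arrObj ((StructuredArrow.map g).obj b) ⟶ pull 𝒢 g (s.arrObj b) :=
  (Tot.pullComp b.hom g (g ≫ b.hom) rfl (s.fib b.right)).inv

/-- The morphism over `g` between pullbacks of the value of a section. -/
def arrPullHom {T T' : C} (g : T' ⟶ T) (b : StructuredArrow T p) :
    Tot.mk (s.arrObj ((StructuredArrow.map g).obj b)) ⟶ Tot.mk (s.arrObj b) :=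
  Tot.vert (s.arrPull g b) ≫ Tot.cart g (s.arrObj b)

@[simp] lemma arrPullHom_base {T T' : C} (g : T' ⟶ T) (b : StructuredArrow T p) :
    (s.arrPullHom g b).base = g := Category.id_comp g

lemma arrPullHom_comp_arrCart {T T' : C} (g : T' ⟶ T) (b : StructuredArrow T p) :
    s.arrPullHom g b ≫ s.arrCart b = s.arrCart ((StructuredArrow.map g).obj b) := by
  rw [arrPullHom, Category.assoc]
  exact Tot.vert_pullComp_inv_comp_cart b.hom g (g ≫ b.hom) rfl (s.fib b.right)

variable (h𝒢 : IsGroupoidValued 𝒢)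

/-- The extension of a section to the free groupoids. -/
def extendFunctor (T : C) : (freeStk p).obj (.mk (op T)) ⥤ 𝒢.obj (.mk (op T)) :=
  have := h𝒢 T
  let _ : Groupoid (𝒢.obj (.mk (op T))) := Groupoid.ofIsGroupoid
  FreeGroupoid.lift (s.arrFunctor T)

/-- The action of the extension of a section on the morphisms of the free groupoids. -/
def extendFiberMap {T : C} {a b : StructuredArrow T p} (β : freeStk.pt a ⟶ freeStk.pt b) :
    s.arrObj a ⟶ s.arrObj b := (s.extendFunctor h𝒢 T).map β

lemma extendFiberMap_ptMap {T : C} {a b : StructuredArrow T p} (φ : a ⟶ b) :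
    s.extendFiberMap h𝒢 (freeStk.ptMap φ) = s.arrMap φ :=
  have := h𝒢 T
  let _ : Groupoid (𝒢.obj (.mk (op T))) := Groupoid.ofIsGroupoid
  FreeGroupoid.lift_map_homMk (s.arrFunctor T) φ

lemma extendFiberMap_comp {T : C} {a b c : StructuredArrow T p} (β : freeStk.pt a ⟶ freeStk.pt b)
    (γ : freeStk.pt b ⟶ freeStk.pt c) :
    s.extendFiberMap h𝒢 (β ≫ γ) = s.extendFiberMap h𝒢 β ≫ s.extendFiberMap h𝒢 γ :=
  (s.extendFunctor h𝒢 T).map_comp β γ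

end Sec

namespace freeStk

/-- The pullback of morphisms of the free groupoids. -/
def pullMap {T T' : C} (g : T' ⟶ T) {a b : StructuredArrow T p} (β : pt a ⟶ pt b) :
    pt ((StructuredArrow.map g).obj a) ⟶ pt ((StructuredArrow.map g).obj b) :=
  ((freeStk p).map g.op.toLoc).toFunctor.map β

lemma fiberHom_comp {T T' T'' : C} {a : StructuredArrow T'' p} {b : StructuredArrow T' p}
    {c : StructuredArrow T p} (m : Tot.mk (pt a) ⟶ Tot.mk (pt b))
    (m' : Tot.mk (pt b) ⟶ Tot.mk (pt c)) :
    fiberHom (m ≫ m') = fiberHom m ≫ pullMap m.base (fiberHom m') ≫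
      ptMap (eqToHom StructuredArrow.map_comp.symm) := by
  refine congrArg (fun t => fiberHom m ≫ pullMap m.base (fiberHom m') ≫ t) ?_
  exact mapComp_inv_app m'.base m.base c

end freeStk

namespace Sec

open freeStk

variable (s : Sec p 𝒢) (h𝒢 : IsGroupoidValued 𝒢)

include h𝒢 in
lemma arrMap_comp_arrPull {T T' : C} (g : T' ⟶ T) {a b : StructuredArrow T p} (φ : a ⟶ b) :
    s.arrMap ((StructuredArrow.map g).map φ) ≫ s.arrPull g b =
      s.arrPull g a ≫ (𝒢.map g.op.toLoc).toFunctor.map (s.arrMap φ) := by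
  apply Tot.eq_of_vert_comp_cart
  refine Tot.hom_ext_of_comp h𝒢 (s.arrCart b) rfl ?_
  have h : (Tot.vert (s.arrMap ((StructuredArrow.map g).map φ)) ≫ s.arrPullHom g b) ≫ s.arrCart b =
      (s.arrPullHom g a ≫ Tot.vert (s.arrMap φ)) ≫ s.arrCart b := by
    rw [Category.assoc, Category.assoc, vert_arrMap_comp_arrCart, arrPullHom_comp_arrCart,
      vert_arrMap_comp_arrCart, ← Category.assoc, arrPullHom_comp_arrCart]
    rfl
  rw [arrPullHom, arrPullHom, Category.assoc (Tot.vert (s.arrPull g a)),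
    ← Tot.vert_map_comp_cart] at h
  rw [Tot.vert_comp, Tot.vert_comp, Category.assoc (Tot.vert (s.arrPull g a)),
    Category.assoc (Tot.vert (s.arrMap ((StructuredArrow.map g).map φ)))]
  exact h

lemma extendFiberMap_pullMap_comp_arrPull {T T' : C} (g : T' ⟶ T) {a b : StructuredArrow T p}
    (β : pt a ⟶ pt b) :
    s.extendFiberMap h𝒢 (pullMap g β) ≫ s.arrPull g b =
      s.arrPull g a ≫ (𝒢.map g.op.toLoc).toFunctor.map (s.extendFiberMap h𝒢 β) := by
  have := h𝒢 T'
  refine naturality_of_ptMap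
    (((freeStk p).map g.op.toLoc).toFunctor ⋙ s.extendFunctor h𝒢 T')
    (s.extendFunctor h𝒢 T ⋙ (𝒢.map g.op.toLoc).toFunctor)
    (fun a => s.arrPull g a) (fun {a b} φ => ?_) β
  refine (congrArg (· ≫ s.arrPull g b) (s.extendFiberMap_ptMap h𝒢
    ((StructuredArrow.map g).map φ))).trans ?_
  refine (s.arrMap_comp_arrPull h𝒢 g φ).trans ?_
  exact congrArg (fun t => s.arrPull g a ≫ (𝒢.map g.op.toLoc).toFunctor.map t)
    (s.extendFiberMap_ptMap h𝒢 φ).symm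

lemma vert_extendFiberMap_comp_arrPullHom {T T' : C} (g : T' ⟶ T) {a b : StructuredArrow T p}
    (β : pt a ⟶ pt b) :
    Tot.vert (s.extendFiberMap h𝒢 (pullMap g β)) ≫ s.arrPullHom g b =
      s.arrPullHom g a ≫ Tot.vert (s.extendFiberMap h𝒢 β) := by
  rw [arrPullHom, arrPullHom, ← Category.assoc, ← Tot.vert_comp,
    extendFiberMap_pullMap_comp_arrPull, Tot.vert_comp, Category.assoc, Category.assoc,
    Tot.vert_map_comp_cart]

/-- The action of the extension of a section on morphisms. -/
def extendMap {T T' : C} {a : StructuredArrow T' p} {b : StructuredArrow T p}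
    (m : Tot.mk (pt a) ⟶ Tot.mk (pt b)) :
    Tot.mk (s.arrObj a) ⟶ Tot.mk (s.arrObj b) :=
  Tot.vert (s.extendFiberMap h𝒢 (fiberHom m)) ≫ s.arrPullHom m.base b

lemma extendMap_base {T T' : C} {a : StructuredArrow T' p} {b : StructuredArrow T p}
    (m : Tot.mk (pt a) ⟶ Tot.mk (pt b)) :
    (s.extendMap h𝒢 m).base = m.base := by
  rw [extendMap, Tot.comp_base, arrPullHom_base]
  exact Category.id_comp _

lemma extendMap_gen_comp_arrCart {T T' : C} {a : StructuredArrow T' p} {b : StructuredArrow T p}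
    (g : T' ⟶ T) (u : a.right ⟶ b.right) (w : a.hom ≫ p.map u = g ≫ b.hom) :
    s.extendMap h𝒢 (gen g u w) ≫ s.arrCart b = s.arrCart a ≫ s.map u := by
  let φ : a ⟶ (StructuredArrow.map g).obj b := StructuredArrow.homMk u w
  have extendMap_gen : s.extendMap h𝒢 (gen g u w) = Tot.vert (s.arrMap φ) ≫ s.arrPullHom g b :=
    congrArg (fun t => Tot.vert t ≫ s.arrPullHom g b) (s.extendFiberMap_ptMap h𝒢 φ)
  rw [extendMap_gen, Category.assoc, arrPullHom_comp_arrCart]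
  exact s.vert_arrMap_comp_arrCart φ

lemma extendMap_id {T : C} (a : StructuredArrow T p) :
    s.extendMap h𝒢 (𝟙 (Tot.mk (pt a))) = 𝟙 _ := by
  refine Tot.hom_ext_of_comp h𝒢 (s.arrCart a) (s.extendMap_base h𝒢 _) ?_
  rw [← gen_id a ((congrArg (a.hom ≫ ·) (p.map_id a.right)).trans
    ((Category.comp_id _).trans (Category.id_comp _).symm)), extendMap_gen_comp_arrCart, s.map_id,
    Category.id_comp, Category.comp_id]

include h𝒢 in
lemma vert_arrMap_eqToHom_comp_arrPullHom {T T' T'' : C} (g : T' ⟶ T) (g' : T'' ⟶ T')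
    (c : StructuredArrow T p) :
    Tot.vert (s.arrMap (eqToHom (StructuredArrow.map_comp (f := g') (f' := g) (h := c)).symm)) ≫
        s.arrPullHom (g' ≫ g) c =
      s.arrPullHom g' ((StructuredArrow.map g).obj c) ≫ s.arrPullHom g c := by
  have hright : (eqToHom (StructuredArrow.map_comp (f := g') (f' := g) (h := c)).symm).right =
      𝟙 c.right := StructuredArrow.eqToHom_right _
  refine Tot.hom_ext_of_comp h𝒢 (s.arrCart c) ?_ ?_
  · rw [Tot.comp_base, Tot.comp_base, arrPullHom_base, arrPullHom_base, arrPullHom_base]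
    exact Category.id_comp _
  · rw [Category.assoc, Category.assoc, arrPullHom_comp_arrCart, arrPullHom_comp_arrCart,
      arrPullHom_comp_arrCart, vert_arrMap_comp_arrCart]
    refine (congrArg (_ ≫ ·) ((congrArg s.map hright).trans (s.map_id c.right))).trans ?_
    exact Category.comp_id _

lemma extendMap_comp {T T' T'' : C} {a : StructuredArrow T'' p} {b : StructuredArrow T' p}
    {c : StructuredArrow T p} (m : Tot.mk (pt a) ⟶ Tot.mk (pt b))
    (m' : Tot.mk (pt b) ⟶ Tot.mk (pt c)) :
    s.extendMap h𝒢 (m ≫ m') = s.extendMap h𝒢 m ≫ s.extendMap h𝒢 m' := by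
  refine (congrArg (fun t => Tot.vert (s.extendFiberMap h𝒢 t) ≫
    s.arrPullHom (m.base ≫ m'.base) c) (fiberHom_comp m m')).trans ?_
  rw [extendFiberMap_comp, extendFiberMap_comp, extendFiberMap_ptMap, Tot.vert_comp, Tot.vert_comp,
    Category.assoc, Category.assoc, s.vert_arrMap_eqToHom_comp_arrPullHom h𝒢, ← Category.assoc
      (Tot.vert (s.extendFiberMap h𝒢 (pullMap m.base (fiberHom m')))),
    vert_extendFiberMap_comp_arrPullHom, extendMap, extendMap, Category.assoc, Category.assoc]

/-- The extension of a section to the presheaf of groupoids freely generated by `p`. -/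
def extend : Sec (Pseudofunctor.CoGrothendieck.forget (freeStk p)) 𝒢 where
  fib e := s.arrObj (arr e.fiber)
  map {e e'} m := s.extendMap h𝒢 (a := arr e.fiber) (b := arr e'.fiber) m
  map_base {e e'} m := s.extendMap_base h𝒢 (a := arr e.fiber) (b := arr e'.fiber) m
  map_id e := s.extendMap_id h𝒢 (arr e.fiber)
  map_comp {e e' e''} m m' := s.extendMap_comp h𝒢 (a := arr e.fiber) (b := arr e'.fiber)
    (c := arr e''.fiber) m m'

/-- The extension of a section restricts to the section along the tautological section. -/
def extendIso : (preSec (taut p) 𝒢).obj (s.extend h𝒢) ≅ s :=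
  isoOfHom h𝒢
    { app e := s.arrCart (self p e)
      app_base _ := rfl
      naturality u := s.extendMap_gen_comp_arrCart h𝒢 (a := self p _) (b := self p _) (p.map u) u
        ((Category.id_comp _).trans (Category.comp_id _).symm) }

end Sec

lemma freeStk.isEquivalence_preSec_taut (h𝒢 : IsGroupoidValued 𝒢) :
    (Sec.preSec (freeStk.taut p) 𝒢).IsEquivalence where
  faithful := freeStk.faithful_preSec_taut h𝒢
  full := freeStk.full_preSec_taut h𝒢
  essSurj := ⟨fun s => ⟨s.extend h𝒢, ⟨s.extendIso h𝒢⟩⟩⟩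

end Extension

section KanExtension

lemma leftUnitor_inv_whiskerRight_associator_naturality {A : Type u₁} [Bicategory.{v₁, w} A]
    {a b c : A} (f : a ⟶ b) (g : b ⟶ a) (e : 𝟙 a ⟶ f ≫ g) {h h' : a ⟶ c} (γ : h ⟶ h') :
    γ ≫ (λ_ h').inv ≫ e ▷ h' ≫ (α_ f g h').hom =
      ((λ_ h).inv ≫ e ▷ h ≫ (α_ f g h).hom) ≫ f ◁ g ◁ γ := by
  simp only [Bicategory.leftUnitor_inv_naturality_assoc, Category.assoc,
    Bicategory.whisker_exchange_assoc, Bicategory.comp_whiskerLeft, Iso.inv_hom_id,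
    Category.comp_id]

section

variable {C : Type u₁} [Category.{v₁} C] {D : Type u₂} [Category.{v₂} D] (ι : D ⥤ C)

/-- A morphism `𝓕 ⟶ restrict ι 𝒦`, seen as a section of `𝒦` over the total category of `𝓕`. -/
def transSec {𝓕 : PreStk.{w, w'} D} {𝒦 : PreStk.{w, w'} C} (η : 𝓕 ⟶ restrict ι 𝒦) :
    Sec (Pseudofunctor.CoGrothendieck.forget 𝓕 ⋙ ι) 𝒦 :=
  (secRestrict (Pseudofunctor.CoGrothendieck.forget 𝓕) ι 𝒦).obj ((toSec 𝓕 (restrict ι 𝒦)).obj η)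

/-- Under the identification of morphisms with sections, sending `θ : 𝒦 ⟶ 𝒢` to the composition of
`η` with the restriction of `θ` corresponds to composing sections. -/
def restrictMorPrecompCompToSec {𝓕 : PreStk.{w, w'} D} {𝒦 : PreStk.{w, w'} C}
    (η : 𝓕 ⟶ restrict ι 𝒦) (𝒢 : PreStk.{w, w'} C) :
    (restrictMor ι 𝒦 𝒢 ⋙ Bicategory.precomp (restrict ι 𝒢) η) ⋙ toSec 𝓕 (restrict ι 𝒢) ⋙
        secRestrict (Pseudofunctor.CoGrothendieck.forget 𝓕) ι 𝒢 ≅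
      toSec 𝒦 𝒢 ⋙ Sec.preSec (transSec ι η) 𝒢 := by
  have totRestrictHom_totMap (θ : 𝒦 ⟶ 𝒢) {a b : Tot 𝓕} (u : a ⟶ b) :=
    congrArg (totRestrictHom (ι := ι)) (totMap_trans η ((restrictMor ι 𝒦 𝒢).obj θ) u)
  refine NatIso.ofComponents (fun θ =>
    { hom :=
        { app := fun _ => 𝟙 _
          app_base := fun _ => rfl
          naturality := fun u => (Category.comp_id _).trans
            ((totRestrictHom_totMap θ u).trans (Category.id_comp _).symm) }
      inv :=
        { app := fun _ => 𝟙 _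
          app_base := fun _ => rfl
          naturality := fun u => (Category.comp_id _).trans
            ((totRestrictHom_totMap θ u).symm.trans (Category.id_comp _).symm) }
      hom_inv_id := Sec.hom_ext fun _ => Category.comp_id _
      inv_hom_id := Sec.hom_ext fun _ => Category.comp_id _ }) fun {θ θ'} Γ =>
    Sec.hom_ext fun e => (Category.comp_id _).trans (Eq.trans ?_ (Category.id_comp _).symm)
  exact totRestrictHom_vert (ι := ι) (S := e.base)
      ((Γ.as.app (.mk (op (ι.obj e.base)))).toNatTrans.app (appObj η e.fiber))

/-- Precomposition with `θ` after restriction to `restrict ι 𝒳`, when the restriction of `θ` is a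
retraction of `η`. -/
def restrictMorIsoOfRetraction {𝓕 : PreStk.{w, w'} C} {𝒳 : PreStk.{w, w'} C}
    {η : restrict ι 𝒳 ⟶ restrict ι 𝓕} {θ : 𝓕 ⟶ 𝒳}
    (e : η ≫ (restrictMor ι 𝓕 𝒳).obj θ ≅ 𝟙 (restrict ι 𝒳)) (𝒴 : PreStk.{w, w'} C) :
    restrictMor ι 𝒳 𝒴 ≅
      Bicategory.precomp 𝒴 θ ⋙ restrictMor ι 𝓕 𝒴 ⋙ Bicategory.precomp (restrict ι 𝒴) η :=
  NatIso.ofComponents (fun ψ => (λ_ ((restrictMor ι 𝒳 𝒴).obj ψ)).symm ≪≫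
    Bicategory.whiskerRightIso e.symm _ ≪≫ α_ _ _ _) fun Γ =>
      leftUnitor_inv_whiskerRight_associator_naturality η ((restrictMor ι 𝓕 𝒳).obj θ) e.inv
        ((restrictMor ι 𝒳 𝒴).map Γ)

lemma isEquivalence_restrictMor_comp_precomp {𝓕 : PreStk.{w, w'} D} {𝒦 𝒢 : PreStk.{w, w'} C}
    (h𝒢 : IsGroupoidValued 𝒢) {η : 𝓕 ⟶ restrict ι 𝒦}
    (hη : (Sec.preSec (transSec ι η) 𝒢).IsEquivalence) :
    (restrictMor ι 𝒦 𝒢 ⋙ Bicategory.precomp (restrict ι 𝒢) η).IsEquivalence := by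
  have : (toSec 𝒦 𝒢).IsEquivalence := isEquivalence_toSec h𝒢
  have : (toSec 𝓕 (restrict ι 𝒢)).IsEquivalence := isEquivalence_toSec fun S => h𝒢 (ι.obj S)
  have := isEquivalence_secRestrict (Pseudofunctor.CoGrothendieck.forget 𝓕) ι h𝒢
  have hcomp : (toSec 𝒦 𝒢 ⋙ Sec.preSec (transSec ι η) 𝒢).IsEquivalence := inferInstance
  have := @Functor.isEquivalence_of_iso _ _ _ _ _ _ (restrictMorPrecompCompToSec ι η 𝒢).symm hcomp
  exact Functor.isEquivalence_of_comp_right _ (toSec 𝓕 (restrict ι 𝒢) ⋙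
    secRestrict (Pseudofunctor.CoGrothendieck.forget 𝓕) ι 𝒢)

end

variable {C : Type (u + 1)} [Category.{u} C] {D : Type (u + 1)} [Category.{u} D]

theorem exists_isLeftKanExtension (ι : D ⥤ C) (𝓕 : PreStk.{max w (u + 1), max w (u + 1)} D) :
    ∃ (𝒦 : PreStk.{max w (u + 1), max w (u + 1)} C) (η : 𝓕 ⟶ restrict ι 𝒦),
      IsLeftKanExtension ι η := by
  let p : Tot 𝓕 ⥤ C := Pseudofunctor.CoGrothendieck.forget 𝓕 ⋙ ι
  let 𝒦 : PreStk.{max w (u + 1), max w (u + 1)} C := freeStk p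
  have h𝒦 : IsGroupoidValued 𝒦 := freeStk.isGroupoidValued p
  have : (toSec 𝓕 (restrict ι 𝒦)).IsEquivalence := isEquivalence_toSec fun S => h𝒦 (ι.obj S)
  have := isEquivalence_secRestrict (Pseudofunctor.CoGrothendieck.forget 𝓕) ι h𝒦
  have essSurj_toSec_comp : (toSec 𝓕 (restrict ι 𝒦) ⋙
    secRestrict (Pseudofunctor.CoGrothendieck.forget 𝓕) ι 𝒦).EssSurj := inferInstance
  obtain ⟨η, ⟨e⟩⟩ := essSurj_toSec_comp.mem_essImage (freeStk.taut p)
  refine ⟨𝒦, η, h𝒦, fun 𝒢 h𝒢 => isEquivalence_restrictMor_comp_precomp ι h𝒢 ?_⟩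
  exact @Functor.isEquivalence_of_iso _ _ _ _ _ _ (Sec.preSecIso h𝒢 e.inv)
    (freeStk.isEquivalence_preSec_taut h𝒢)

theorem isSheafifiedLeftKanExtension_id (J : GrothendieckTopology C) (ι : D ⥤ C)
    {𝒳 : PreStk.{max w (u + 1), max w (u + 1)} C} (h𝒳 : IsGroupoidStack J 𝒳)
    (hrestrict : ∀ 𝒴 : PreStk.{max w (u + 1), max w (u + 1)} C, IsGroupoidStack J 𝒴 →
      (restrictMor ι 𝒳 𝒴).IsEquivalence) :
    IsSheafifiedLeftKanExtension J ι (𝟙 (restrict ι 𝒳)) := by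
  obtain ⟨𝒦, η, hη⟩ := exists_isLeftKanExtension.{w} ι (restrict ι 𝒳)
  obtain ⟨θ, ⟨e⟩⟩ := (hη.isEquivalence 𝒳 h𝒳.isGroupoidValued).essSurj.mem_essImage
    (𝟙 (restrict ι 𝒳))
  refine ⟨𝒦, η, θ, hη, ⟨h𝒳, fun 𝒴 h𝒴 => ?_⟩, ⟨e⟩⟩
  have := hη.isEquivalence 𝒴 h𝒴.isGroupoidValued
  have := @Functor.isEquivalence_of_iso _ _ _ _ _ _ (restrictMorIsoOfRetraction ι e 𝒴)
    (hrestrict 𝒴 h𝒴)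
  exact Functor.isEquivalence_of_comp_right _ (restrictMor ι 𝒦 𝒴 ⋙
    Bicategory.precomp (restrict ι 𝒴) η)

end KanExtension

/-! ### Charts of products with a smooth atlas -/

section WeakFiberProducts

variable {C : Type u₁} [Category.{v₁} C] {e v w z z' : C}

/-- The object `z'` is a weak limit of the diagram `z ⇉ e × v ⇇ w`: commuting pairs of morphisms to
`z` and `w` factor through `z'`, not necessarily uniquely. -/
structure IsWeakFiberProduct (p : w ⟶ e) (q : w ⟶ v) (f : z ⟶ e) (g : z ⟶ v) (s : z' ⟶ z)
    (h : z' ⟶ w) : Prop where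
  comm_left : s ≫ f = h ≫ p
  comm_right : s ≫ g = h ≫ q
  exists_lift {y : C} (k : y ⟶ z) (l : y ⟶ w) : k ≫ f = l ≫ p → k ≫ g = l ≫ q →
    ∃ m : y ⟶ z', m ≫ s = k ∧ m ≫ h = l

lemma IsWeakFiberProduct.of_iso_comp {p : w ⟶ e} {q : w ⟶ v} {x : C} (δ : x ≅ z) {f : z ⟶ e}
    {g : z ⟶ v} {s : z' ⟶ x} {h : z' ⟶ w}
    (H : IsWeakFiberProduct p q (δ.hom ≫ f) (δ.hom ≫ g) s h) :
    IsWeakFiberProduct p q f g (s ≫ δ.hom) h where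
  comm_left := (Category.assoc _ _ _).trans H.comm_left
  comm_right := (Category.assoc _ _ _).trans H.comm_right
  exists_lift k l hf hg := by
    obtain ⟨m, hm, hml⟩ := H.exists_lift (k ≫ δ.inv) l (by simpa using hf) (by simpa using hg)
    exact ⟨m, by rw [← Category.assoc, hm, Category.assoc, δ.inv_hom_id, Category.comp_id], hml⟩

end WeakFiberProducts

section SmoothAtlases

variable {C : Type u₁} [Category.{v₁} C] {𝒳 : PreStk.{w, w'} C}

section Isom

open Tot

variable {S : C} {M N : 𝒳.obj (.mk (op S))}

variable (M) in
/-- The canonical morphism between the pullbacks of `M` to two objects over `S`. -/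
def overMap {Z Z' : Over S} (l : Z' ⟶ Z) :
    Tot.mk (pull 𝒳 Z'.hom M) ⟶ Tot.mk (pull 𝒳 Z.hom M) :=
  vert (pullComp Z.hom l.left Z'.hom (Over.w l) M).inv ≫ cart l.left (pull 𝒳 Z.hom M)

@[simp] lemma overMap_base {Z Z' : Over S} (l : Z' ⟶ Z) : (overMap M l).base = l.left :=
  Category.id_comp l.left

lemma overMap_comp_cart {Z Z' : Over S} (l : Z' ⟶ Z) :
    overMap M l ≫ cart Z.hom M = cart Z'.hom M := by
  rw [overMap, Category.assoc]
  exact vert_pullComp_inv_comp_cart Z.hom l.left Z'.hom (Over.w l) M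

/-- A section over `Z` of the presheaf of morphisms from `M` to `N`, as a morphism of the total
category from the pullback of `M` to `N`. -/
def ofHomSection {Z : Over S} (β : (𝒳.presheafHom M N).obj (op Z)) :
    Tot.mk (pull 𝒳 Z.hom M) ⟶ Tot.mk N :=
  vert (show pull 𝒳 Z.hom M ⟶ pull 𝒳 Z.hom N from β) ≫ cart Z.hom N

@[simp] lemma ofHomSection_base {Z : Over S} (β : (𝒳.presheafHom M N).obj (op Z)) :
    (ofHomSection β).base = Z.hom :=
  Category.id_comp Z.hom

lemma ofHomSection_injective {Z : Over S} :
    Function.Injective (ofHomSection (𝒳 := 𝒳) (M := M) (N := N) (Z := Z)) :=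
  fun _ _ h => eq_of_vert_comp_cart h

lemma exists_ofHomSection_eq {Z : Over S} (n : Tot.mk (pull 𝒳 Z.hom M) ⟶ Tot.mk N)
    (hn : n.base = Z.hom) : ∃ β : (𝒳.presheafHom M N).obj (op Z), ofHomSection β = n :=
  ⟨fiberOver n Z.hom hn, vert_fiberOver_comp_cart n Z.hom hn⟩

lemma ofHomSection_map {Z Z' : Over S} (l : Z' ⟶ Z) (β : (𝒳.presheafHom M N).obj (op Z)) :
    ofHomSection ((𝒳.presheafHom M N).map l.op β) = overMap M l ≫ ofHomSection β := by
  have h : ((𝒳.presheafHom M N).map l.op β : pull 𝒳 Z'.hom M ⟶ pull 𝒳 Z'.hom N) =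
      (pullComp Z.hom l.left Z'.hom (Over.w l) M).inv ≫ (𝒳.map l.left.op.toLoc).toFunctor.map
        (show pull 𝒳 Z.hom M ⟶ pull 𝒳 Z.hom N from β) ≫
          (pullComp Z.hom l.left Z'.hom (Over.w l) N).hom := rfl
  rw [ofHomSection, h, vert_comp, vert_comp, Category.assoc, Category.assoc,
    vert_pullComp_hom_comp_cart, vert_map_comp_cart_assoc, overMap, ofHomSection, Category.assoc]

lemma exists_comp_eq_overMap (h𝒳 : IsGroupoidValued 𝒳) {W Z : Over S} {y : Tot 𝒳}
    (l : y ⟶ Tot.mk (pull 𝒳 W.hom M)) (k : y ⟶ Tot.mk (pull 𝒳 Z.hom M))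
    (hkl : k ≫ cart Z.hom M = l ≫ cart W.hom M) :
    ∃ (Z₂ : Over S) (a : Z₂ ⟶ W) (b : Z₂ ⟶ Z) (e : Tot.mk (pull 𝒳 Z₂.hom M) ≅ y),
      e.hom ≫ l = overMap M a ∧ e.hom ≫ k = overMap M b := by
  have hbase : k.base ≫ Z.hom = l.base ≫ W.hom := congrArg (fun t => t.base) hkl
  let Z₂ : Over S := Over.mk (k.base ≫ Z.hom)
  obtain ⟨e, he, hek⟩ : ∃ e : Tot.mk (pull 𝒳 Z₂.hom M) ≅ y, e.hom.base = 𝟙 y.base ∧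
      e.hom ≫ k ≫ cart Z.hom M = cart Z₂.hom M := exists_iso_pull h𝒳 (k ≫ cart Z.hom M)
  refine ⟨Z₂, Over.homMk l.base hbase.symm, Over.homMk k.base rfl, e, ?_, ?_⟩
  · refine hom_ext_of_comp h𝒳 (cart W.hom M) ?_ ?_
    · rw [comp_base, he, overMap_base]
      exact Category.id_comp _
    · rw [Category.assoc, ← hkl, hek]
      exact (overMap_comp_cart (Z' := Z₂) _).symm
  · refine hom_ext_of_comp h𝒳 (cart Z.hom M) ?_ ?_
    · rw [comp_base, he, overMap_base]
      exact Category.id_comp _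
    · rw [Category.assoc, hek]
      exact (overMap_comp_cart (Z' := Z₂) _).symm

lemma overMap_comp (h𝒳 : IsGroupoidValued 𝒳) {Z Z' Z'' : Over S} (l' : Z'' ⟶ Z') (l : Z' ⟶ Z) :
    overMap M (l' ≫ l) = overMap M l' ≫ overMap M l := by
  refine hom_ext_of_comp h𝒳 (cart Z.hom M) ?_ ?_
  · rw [comp_base, overMap_base, overMap_base, overMap_base, Over.comp_left]
  · rw [Category.assoc, overMap_comp_cart, overMap_comp_cart, overMap_comp_cart]

lemma IsFiberProduct.isWeakFiberProduct_ofHomSection (h𝒳 : IsGroupoidValued 𝒳)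
    {W Z Z₁ : Over S} {α : (𝒳.presheafHom M N).obj (op W)}
    {β : (𝒳.presheafHom M N).obj (op Z)} {a : Z₁ ⟶ W} {b : Z₁ ⟶ Z}
    (H : IsFiberProduct (𝒳.presheafHom M N) α β a b) :
    IsWeakFiberProduct (ofHomSection α) (cart W.hom M) (ofHomSection β) (cart Z.hom M)
      (overMap M b) (overMap M a) where
  comm_left := by rw [← ofHomSection_map, ← ofHomSection_map, H.comm]
  comm_right := by rw [overMap_comp_cart, overMap_comp_cart]
  exists_lift k l hβα hkl := by
    obtain ⟨Z₂, a', b', e, hel, hek⟩ := exists_comp_eq_overMap h𝒳 l k hkl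
    have hα : (𝒳.presheafHom M N).map a'.op α = (𝒳.presheafHom M N).map b'.op β := by
      apply ofHomSection_injective
      rw [ofHomSection_map, ofHomSection_map, ← hel, ← hek, Category.assoc, Category.assoc, hβα]
    obtain ⟨m, ⟨hma, hmb⟩, -⟩ := H.existsUnique Z₂ a' b' hα
    refine ⟨e.inv ≫ overMap M m, ?_, ?_⟩
    · rw [Category.assoc, ← overMap_comp h𝒳, hmb, ← hek, e.inv_hom_id_assoc]
    · rw [Category.assoc, ← overMap_comp h𝒳, hma, ← hel, e.inv_hom_id_assoc]

lemma IsEtaleAtlas.exists_isWeakFiberProduct {U : C ⥤ Scheme.{u}} (h𝒳 : IsGroupoidValued 𝒳)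
    {W : Over S} {α : (𝒳.presheafHom M N).obj (op W)}
    (hα : IsEtaleAtlas (Over.forget S ⋙ U) (𝒳.presheafHom M N) α)
    {z : Tot 𝒳} (f : z ⟶ Tot.mk N) (g : z ⟶ Tot.mk M) (hfg : f.base = g.base) :
    ∃ (z' : Tot 𝒳) (s : z' ⟶ z) (h : z' ⟶ Tot.mk (pull 𝒳 W.hom M)),
      Etale (U.map s.base) ∧ Surjective (U.map s.base) ∧
        IsWeakFiberProduct (ofHomSection α) (cart W.hom M) f g s h := by
  let Z : Over S := Over.mk g.base
  obtain ⟨δ, hδ, hδg⟩ := exists_iso_pull h𝒳 g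
  have hδf : (δ.hom ≫ f).base = Z.hom := by
    rw [comp_base, hδ, hfg]
    exact Category.id_comp _
  obtain ⟨β, hβ⟩ := exists_ofHomSection_eq (Z := Z) (δ.hom ≫ f) hδf
  obtain ⟨Z₁, a, b, hab, hetale, hsurj⟩ := hα Z β
  have hbase : (overMap M b ≫ δ.hom).base = b.left := by
    rw [comp_base, overMap_base, hδ]
    exact Category.comp_id _
  refine ⟨_, overMap M b ≫ δ.hom, overMap M a, ?_, ?_, IsWeakFiberProduct.of_iso_comp δ ?_⟩
  · rwa [hbase]
  · rwa [hbase]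
  · rw [← hβ, hδg]
    exact hab.isWeakFiberProduct_ofHomSection h𝒳

end Isom

section Product

open Tot

variable (U : C ⥤ Scheme.{u})

/-- The morphisms of `C` whose underlying morphism of schemes is smooth and surjective. -/
def smoothSurjections : MorphismProperty C :=
  fun _ _ f => Smooth (U.map f) ∧ Surjective (U.map f)

variable {U} [HasBinaryProducts C] {V : C} {v : 𝒳.obj (.mk (op V))}

lemma IsEtaleAtlas.exists_isWeakFiberProduct_prod (h𝒳 : IsGroupoidValued 𝒳) {T : C}
    {t : 𝒳.obj (.mk (op T))} {W : Over (V ⨯ T)}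
    {α : (𝒳.presheafHom (pull 𝒳 prod.fst v) (pull 𝒳 prod.snd t)).obj (op W)}
    (hα : IsEtaleAtlas (Over.forget (V ⨯ T) ⋙ U)
      (𝒳.presheafHom (pull 𝒳 prod.fst v) (pull 𝒳 prod.snd t)) α)
    {z : Tot 𝒳} (f : z ⟶ Tot.mk t) (g : z ⟶ Tot.mk v) :
    ∃ (z' : Tot 𝒳) (s : z' ⟶ z) (h : z' ⟶ Tot.mk (pull 𝒳 W.hom (pull 𝒳 prod.fst v))),
      Etale (U.map s.base) ∧ Surjective (U.map s.base) ∧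
        IsWeakFiberProduct (ofHomSection α ≫ cart prod.snd t)
          (cart W.hom (pull 𝒳 prod.fst v) ≫ cart prod.fst v) f g s h := by
  obtain ⟨f₀, hf₀, rfl⟩ := exists_lift h𝒳 (cart prod.snd t) f (prod.lift g.base f.base)
    (prod.lift_snd _ _)
  obtain ⟨g₀, hg₀, rfl⟩ := exists_lift h𝒳 (cart prod.fst v) g f₀.base
    (by rw [hf₀]; exact prod.lift_fst _ _)
  obtain ⟨z', s, h, hetale, hsurj, H⟩ := hα.exists_isWeakFiberProduct h𝒳 f₀ g₀ hg₀.symm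
  refine ⟨z', s, h, hetale, hsurj, by rw [← Category.assoc, H.comm_left, Category.assoc],
    by rw [← Category.assoc, H.comm_right, Category.assoc], fun k l hsnd hfst => ?_⟩
  have hbase : k.base ≫ f₀.base = l.base ≫ (ofHomSection α).base := by
    refine prod.hom_ext ?_ ?_
    · rw [← hg₀, Category.assoc, Category.assoc, ofHomSection_base]
      exact congrArg (fun t => t.base) hfst
    · rw [Category.assoc, Category.assoc]
      exact congrArg (fun t => t.base) hsnd
  refine H.exists_lift k l (hom_ext_of_comp h𝒳 (cart prod.snd t) ?_ ?_)
    (hom_ext_of_comp h𝒳 (cart prod.fst v) ?_ ?_)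
  · exact hbase
  · rw [Category.assoc, Category.assoc, hsnd]
  · rw [comp_base, comp_base, hg₀, hbase, ofHomSection_base, cart_base]
  · rw [Category.assoc, Category.assoc, hfst]

lemma IsSmoothAtlas.exists_isWeakFiberProduct (h𝒳 : IsGroupoidValued 𝒳) (hv : IsSmoothAtlas U 𝒳 v)
    (e : Tot 𝒳) : ∃ (w : Tot 𝒳) (p : w ⟶ e) (q : w ⟶ Tot.mk v), smoothSurjections U p.base ∧
      ∀ {z : Tot 𝒳} (f : z ⟶ e) (g : z ⟶ Tot.mk v), ∃ (z' : Tot 𝒳) (s : z' ⟶ z) (h : z' ⟶ w),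
        smoothSurjections U s.base ∧ IsWeakFiberProduct p q f g s h := by
  obtain ⟨W, α, hα, hsmooth, hsurj⟩ := hv e.base e.fiber
  have hbase : (ofHomSection α ≫ cart prod.snd e.fiber).base = W.hom ≫ prod.snd := by
    rw [comp_base, ofHomSection_base]; rfl
  refine ⟨_, ofHomSection α ≫ cart prod.snd e.fiber, cart W.hom _ ≫ cart prod.fst v, ?_,
    fun f g => ?_⟩
  · rw [hbase]
    exact ⟨hsmooth, hsurj⟩
  · obtain ⟨z', s, h, hetale, hs, H⟩ := hα.exists_isWeakFiberProduct_prod h𝒳 f g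
    exact ⟨z', s, h, ⟨inferInstance, hs⟩, H⟩

end Product

section FullSubcategory

variable {D : Type u₂} [Category.{v₂} D] (ι : D ⥤ C)

instance [ι.Faithful] : (totRestrict ι 𝒳).Faithful where
  map_injective h := totRestrict_map_injective
    (ι.map_injective (congrArg (fun t => t.base) h)) h

instance [ι.Full] : (totRestrict ι 𝒳).Full where
  map_surjective n := by
    obtain ⟨f, hf⟩ := ι.map_surjective n.base
    obtain ⟨m, -, hm⟩ := exists_totRestrict_map_eq f n hf.symm
    exact ⟨m, hm⟩

variable [HasBinaryProducts C] {U : C ⥤ Scheme.{u}} {J : GrothendieckTopology C}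
  {P : ObjectProperty C}

lemma IsSmoothAtlas.isAtlas (hJ : smoothSurjections U ≤ coveringMorphisms J)
    (hP : ∀ ⦃X Y : C⦄ (f : X ⟶ Y), smoothSurjections U f → P Y → P X)
    (h𝒳 : IsGroupoidValued 𝒳) {V : C} {v : 𝒳.obj (.mk (op V))} (hv : IsSmoothAtlas U 𝒳 v)
    (hV : P V) :
    IsAtlas ((coveringMorphisms J).inverseImage (Pseudofunctor.CoGrothendieck.forget 𝒳))
      (totRestrict P.ι 𝒳) ⟨⟨V, hV⟩, v⟩ where
  exists_cover e := by
    obtain ⟨w, p, q, hp, -⟩ := hv.exists_isWeakFiberProduct h𝒳 e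
    exact ⟨w, p, q, hJ _ hp⟩
  exists_productChart d := by
    let j := totRestrict P.ι 𝒳
    obtain ⟨w, p, q, hp, hpq⟩ := hv.exists_isWeakFiberProduct h𝒳 (j.obj d)
    have hw : P w.base := hP p.base hp d.base.property
    let w₀ : Tot (restrict P.ι 𝒳) := ⟨⟨w.base, hw⟩, w.fiber⟩
    obtain ⟨p₀, rfl⟩ := j.map_surjective (X := w₀) (Y := d) p
    obtain ⟨q₀, rfl⟩ := j.map_surjective (X := w₀) (Y := ⟨⟨V, hV⟩, v⟩) q
    refine ⟨w₀, p₀, q₀, fun z f g => ?_, fun {a} f g => ?_⟩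
    · obtain ⟨z', s, h, hs, H⟩ := hpq f g
      exact ⟨z', s, h, hJ _ hs, H.comm_left, H.comm_right⟩
    · obtain ⟨z', s, h, hs, H⟩ := hpq (j.map f) (j.map g)
      have hz' : P z'.base := hP s.base hs a.base.property
      let a' : Tot (restrict P.ι 𝒳) := ⟨⟨z'.base, hz'⟩, z'.fiber⟩
      obtain ⟨s₀, rfl⟩ := j.map_surjective (X := a') (Y := a) s
      obtain ⟨h₀, rfl⟩ := j.map_surjective (X := a') (Y := w₀) h
      refine ⟨a', s₀, h₀, j.map_injective ?_, j.map_injective ?_, fun y k l => H.exists_lift k l⟩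
      · exact ((j.map_comp _ _).trans H.comm_left).trans (j.map_comp _ _).symm
      · exact ((j.map_comp _ _).trans H.comm_right).trans (j.map_comp _ _).symm

lemma HasProperty.isEquivalence_restrictMor [HasPullbacks C]
    (hJ : smoothSurjections U ≤ coveringMorphisms J)
    (hP : ∀ ⦃X Y : C⦄ (f : X ⟶ Y), smoothSurjections U f → P Y → P X)
    (h𝒳 : IsGroupoidValued 𝒳) (hP𝒳 : HasProperty U P 𝒳) {𝒴 : PreStk.{w, w'} C}
    (h𝒴 : IsGroupoidStack J 𝒴) : (restrictMor P.ι 𝒳 𝒴).IsEquivalence := by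
  obtain ⟨V, v, hv, hV⟩ := hP𝒳
  exact StackyYoneda.isEquivalence_restrictMor (hasWeakBaseChange_coveringMorphisms J) h𝒳
    h𝒴.hasDescent (hv.isAtlas hJ hP h𝒳 hV)

end FullSubcategory

end SmoothAtlases

section Schemes

lemma IsSmoothLocal.of_smoothSurjections {P : ObjectProperty Scheme.{u}} (hP : IsSmoothLocal P)
    ⦃X Y : Scheme.{u}⦄ (f : X ⟶ Y) (hf : smoothSurjections (𝟭 Scheme.{u}) f) (hY : P Y) : P X :=
  (hP Y (Scheme.Cover.mkOfCovers PUnit.{u + 1} (fun _ => X) (fun _ => f)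
    (fun y => ⟨⟨⟩, hf.2.surj y⟩) (fun _ => hf.1))).mp hY ⟨⟩

lemma smoothSurjections_id_le_coveringMorphisms :
    smoothSurjections (𝟭 Scheme.{u}) ≤ coveringMorphisms Scheme.etaleTopology :=
  fun _ _ f hf => @generate_singleton_mem_etaleTopology _ _ f hf.1 hf.2

lemma smoothSurjections_forget_le_coveringMorphisms (S : Scheme.{u}) :
    smoothSurjections (Over.forget S) ≤ coveringMorphisms (Scheme.etaleTopology.over S) := by
  intro X Y f hf
  rw [coveringMorphisms, GrothendieckTopology.mem_over_iff, Sieve.overEquiv_generate]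
  refine Scheme.etaleTopology.superset_covering (Sieve.generate_mono ?_)
    (@generate_singleton_mem_etaleTopology _ _ f.left hf.1 hf.2)
  rintro _ _ ⟨⟩
  exact ⟨X, f, 𝟙 _, Presieve.singleton_self f, (Category.id_comp _).symm⟩

lemma smooth_hom_of_smoothSurjections {S : Scheme.{u}} {X Y : Over S} (f : X ⟶ Y)
    (hf : smoothSurjections (Over.forget S) f) (hY : Smooth Y.hom) : Smooth X.hom := by
  have : Smooth f.left := hf.1
  rw [← Over.w f]
  infer_instance

end Schemes

end StackyYoneda

end

theorem mainTheorem6_general {C : Type (u + 1)} [Category.{u} C] [HasPullbacks C]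
    [HasBinaryProducts C] (U : C ⥤ Scheme.{u}) (J : GrothendieckTopology C)
    (hJ : smoothSurjections U ≤ coveringMorphisms J) (P : ObjectProperty C)
    (hP : ∀ ⦃X Y : C⦄ (f : X ⟶ Y), smoothSurjections U f → P Y → P X) :
    (∀ 𝒳 : PreStk.{w, w'} C, IsGroupoidValued 𝒳 → HasProperty U P 𝒳 →
      ∀ 𝒴 : PreStk.{w, w'} C, IsGroupoidStack J 𝒴 → (restrictMor P.ι 𝒳 𝒴).IsEquivalence) ∧
    (∀ 𝒳 : PreStk.{max w (u + 1), max w (u + 1)} C, IsGroupoidStack J 𝒳 → HasProperty U P 𝒳 →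
      IsSheafifiedLeftKanExtension J P.ι (𝟙 (restrict P.ι 𝒳))) :=
  ⟨fun _ h𝒳 hP𝒳 _ h𝒴 => hP𝒳.isEquivalence_restrictMor hJ hP h𝒳 h𝒴,
    fun _ h𝒳 hP𝒳 => isSheafifiedLeftKanExtension_id.{w, u} J P.ι h𝒳 fun _ h𝒴 =>
      hP𝒳.isEquivalence_restrictMor hJ hP h𝒳.isGroupoidValued h𝒴⟩

theorem mainTheorem6 :
    (∀ P : ObjectProperty Scheme.{u}, IsSmoothLocal P →
      (∀ 𝒳 : SchPreStk.{w, w', u}, IsAlgStk P 𝒳 →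
        ∀ 𝒴 : SchPreStk.{w, w', u}, IsStk 𝒴 → (restrictMor P.ι 𝒳 𝒴).IsEquivalence) ∧
      (∀ 𝒳 : SchPreStk.{max w (u + 1), max w (u + 1), u}, IsAlgStk P 𝒳 →
        IsSheafifiedLeftKanExtension Scheme.etaleTopology P.ι (𝟙 (restrict P.ι 𝒳)))) ∧
    (∀ p : ℕ, p.Prime →
      (∀ 𝒳 𝒴 : PreStk.{w, w'} (SchF.{u} p), IsSmoothAlgStkF p 𝒳 → IsSmoothAlgStkF p 𝒴 →
        (restrictMor (smF p).ι 𝒳 𝒴).IsEquivalence) ∧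
      (∀ 𝒳 : PreStk.{max w (u + 1), max w (u + 1)} (SchF.{u} p), IsSmoothAlgStkF p 𝒳 →
        IsSheafifiedLeftKanExtension (etaleF p) (smF p).ι (𝟙 (restrict (smF p).ι 𝒳)))) := by
  refine ⟨fun P hP => ?_, fun p _ => ?_⟩
  · obtain ⟨hrestrict, hkan⟩ := mainTheorem6_general.{w, w', u} (𝟭 Scheme.{u}) _
      smoothSurjections_id_le_coveringMorphisms P hP.of_smoothSurjections
    exact ⟨fun 𝒳 h𝒳 => hrestrict 𝒳 h𝒳.1.isGroupoidStack.isGroupoidValued h𝒳.2,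
      fun 𝒳 h𝒳 => hkan 𝒳 h𝒳.1.isGroupoidStack h𝒳.2⟩
  · obtain ⟨hrestrict, hkan⟩ := mainTheorem6_general.{w, w', u} (Over.forget (specF p)) _
      (smoothSurjections_forget_le_coveringMorphisms (specF p)) (smF p)
      fun _ _ => smooth_hom_of_smoothSurjections
    exact ⟨fun 𝒳 𝒴 h𝒳 h𝒴 => hrestrict 𝒳 h𝒳.1.isGroupoidStack.isGroupoidValued h𝒳.2 𝒴
        h𝒴.1.isGroupoidStack,
      fun 𝒳 h𝒳 => hkan 𝒳 h𝒳.1.isGroupoidStack h𝒳.2⟩
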